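/- Let $k$ be a field and let $\mathcal T$ be a $k$-linear pretriangulated category (that is, a triangulated category which need not satisfy the octahedral axiom) with translation $\Sigma$. Assume that $\mathcal T$ is idempotent complete and Hom-finite, i.e. every $\mathrm{Hom}_{\mathcal T}(X,Y)$ is finite dimensional over $k$. All functors are $k$-linear. A triangle functor is a pair $(F,\omega)$ consisting of a functor $F$ and a natural isomorphism $\omega\colon F\Sigma\to\Sigma F$ such that $F$ sends exact triangles to exact triangles by means of $\omega$; isomorphisms of triangle functors are natural isomorphisms compatible with the isomorphisms $\omega$. Let $G$ be a finite abelian group that splits over $k$, i.e. the group algebra $kG$ is isomorphic as a $k$-algebra to a product of copies of $k$. Fix a triangle $G$-action on $\mathcal T$: triangle autoequivalences $F_g=(F_g,\omega_g)$ $(g\in G)$ and isomorphisms of triangle functors $\varepsilon_{g,h}\colon F_gF_h\to F_{gh}$ with $\varepsilon_{gh,l}\circ\varepsilon_{g,h}F_l=\varepsilon_{g,hl}\circ F_g\varepsilon_{h,l}$ for all $g,h,l\in G$. The category $\mathcal T^G$ of equivariant objects has as objects the pairs $(X,\alpha)$, where $X\in\mathcal T$ and $\alpha=(\alpha_g\colon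 X\to F_gX)_{g\in G}$ are isomorphisms with $\alpha_{gh}=(\varepsilon_{g,h})_X\circ F_g(\alpha_h)\circ\alpha_g$; a morphism $(X,\alpha)\to(Y,\beta)$ is a morphism $f\colon X\to Y$ with $\beta_g\circ f=F_g(f)\circ\alpha_g$ for all $g$. Its translation is $(X,\alpha)\mapsto(\Sigma X,((\omega_g)_X^{-1}\circ\Sigma\alpha_g)_g)$, and a triangle in $\mathcal T^G$ is exact if its underlying triangle in $\mathcal T$ is exact. Let $\mathrm{Ind}\colon\mathcal T\to\mathcal T^G$ be the induction functor, $\mathrm{Ind}(X)=\bigl(\bigoplus_{h\in G}F_hX,\ (\varepsilon^{-1})\bigr)$, whose equivariant structure is given on summands by the maps $(\varepsilon_{g,g^{-1}h})_X^{-1}\colon F_hX\to F_gF_{g^{-1}h}X$. The character group $\widehat G=\mathrm{Hom}(G,k^\times)$ acts strictly on $\mathcal T^G$ (the dual action) by $F_\chi(X,\alpha)=(X,\chi\otimes\alpha)$, where $(\chi\otimes\alpha)_g=\chi(g^{-1})\alpha_g$; the functors $F_\chi$ are the identity on morphisms and have trivial connecting isomorphisms. For a category $\mathcal C$ with a triangle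 action of a group $H$ (here $(\mathcal T,G)$ or $(\mathcal T^G,\widehat G)$): * $\mathrm{Aut}_\vartriangle(\mathcal C;H)$ is the set of isomorphism classes of $H$-equivariant triangle autoequivalences $((F,\omega),\delta)$, where $(F,\omega)$ is a triangle autoequivalence and $\delta_h\colon FF_h\to F_hF$ $(h\in H)$ are isomorphisms of triangle functors with $\delta_{hl}\circ F\varepsilon_{h,l}=\varepsilon_{h,l}F\circ F_h\delta_l\circ\delta_hF_l$; isomorphisms are isomorphisms of triangle functors compatible with the $\delta_h$, and the multiplication is induced by composition. * An object $M$ is tilting if $\mathrm{Hom}(M,\Sigma^iM)=0$ for all $i\neq0$ and the smallest thick triangulated subcategory containing $M$ (thick: closed under direct summands) is $\mathcal C$. It is basic if every indecomposable direct summand of $M$ has multiplicity one. It is $H$-stable if $F_hM\simeq M$ for all $h\in H$. * $\mathrm{Tilt}^H(\mathcal C)$ is the set of isomorphism classes of basic $H$-stable tilting objects; $\mathrm{Aut}_\vartriangle(\mathcal C;H)$ acts on it by $[(F,\omega),\delta].M=F(M)$. * $\mathrm{add}\,M$ is the full subcategory of direct summands of finite direct sums of copies of $M$. Then $\mathrm{Aut}_\vartriangle(\mathcal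 T;G)$ and $\mathrm{Aut}_\vartriangle(\mathcal T^G;\widehat G)$ are groups, and equivariantization $$(-)^G\colon \mathrm{Aut}_\vartriangle(\mathcal T;G)\longrightarrow\mathrm{Aut}_\vartriangle(\mathcal T^G;\widehat G),\qquad [(F,\omega),\delta]\mapsto[((F,\omega),\delta)^G],$$ is an isomorphism of groups, where $((F,\omega),\delta)^G$ sends $(X,\alpha)$ to $(FX,((\delta_g)_X\circ F(\alpha_g))_g)$, acts on morphisms by $F$, has the components $\omega_X$ as connecting isomorphism, and commutes strictly with every $F_\chi$. Moreover, there is a bijection $$\iota\colon\mathrm{Tilt}^G(\mathcal T)\longrightarrow\mathrm{Tilt}^{\widehat G}(\mathcal T^G)$$ such that $\mathrm{add}\,\iota(M)=\mathrm{add}\,\mathrm{Ind}(M)$ for every $M$, and which is compatible with $(-)^G$: $\iota(a.M)=a^G.\iota(M)$ for all $a\in\mathrm{Aut}_\vartriangle(\mathcal T;G)$ and $M\in\mathrm{Tilt}^G(\mathcal T)$. Consequently $\iota$ induces a bijection of orbit sets $$\mathrm{Tilt}^G(\mathcal T)/\mathrm{Aut}_\vartriangle(\mathcal T;G)\longrightarrow\mathrm{Tilt}^{\widehat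 G}(\mathcal T^G)/\mathrm{Aut}_\vartriangle(\mathcal T^G;\widehat G).$$ -/

import Mathlib

open CategoryTheory CategoryTheory.Limits CategoryTheory.Pretriangulated

universe v u w

namespace EquivariantTilting

noncomputable section

/-! ### Additive functors and finite direct sums -/

section Additive

variable {C : Type u} [Category.{v} C] [Preadditive C] [HasFiniteBiproducts C]

lemma map_biproduct_hom_ext {J : Type*} [Finite J] (F : C ⥤ C) [F.Additive] (Q : J → C) {W : C}
    {a b : F.obj (⨁ Q) ⟶ W}
    (h : ∀ j, F.map (biproduct.ι Q j) ≫ a = F.map (biproduct.ι Q j) ≫ b) : a = b := by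
  have := Fintype.ofFinite J
  have ht : ∑ j, biproduct.π Q j ≫ biproduct.ι Q j = 𝟙 (⨁ Q) := by
    apply biproduct.hom_ext'
    intro i
    rw [Preadditive.comp_sum, Finset.sum_eq_single i (fun j _ h => by
      rw [biproduct.ι_π_ne_assoc _ h.symm, zero_comp]) (by simp)]
    simp
  rw [← Category.id_comp a, ← Category.id_comp b, ← F.map_id, ← ht]
  simp only [Functor.map_sum, Preadditive.sum_comp, Functor.map_comp, Category.assoc, h]

/-- The isomorphism `⨁ P ≅ F (⨁ Q)` given by isomorphisms `P j ≅ F (Q (σ j))` for a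
permutation `σ` of the index set. -/
@[simps]
def biproductIsoMap {J : Type*} [Finite J] (F : C ⥤ C) [F.Additive] (P Q : J → C) (σ : J ≃ J)
    (e : ∀ j, P j ≅ F.obj (Q (σ j))) : ⨁ P ≅ F.obj (⨁ Q) where
  hom := biproduct.desc fun j => (e j).hom ≫ F.map (biproduct.ι Q (σ j))
  inv := biproduct.lift fun j => F.map (biproduct.π Q (σ j)) ≫ (e j).inv
  hom_inv_id := by
    apply biproduct.hom_ext
    intro i
    apply biproduct.hom_ext'
    intro j
    by_cases h : j = i
    · subst h
      simp [← Functor.map_comp_assoc]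
    · have h' : σ j ≠ σ i := fun h2 => h (σ.injective h2)
      simp [← Functor.map_comp_assoc, biproduct.ι_π_ne _ h', biproduct.ι_π_ne _ h]
  inv_hom_id := by
    apply map_biproduct_hom_ext
    intro l
    obtain ⟨i, rfl⟩ := σ.surjective l
    have h1 : F.map (biproduct.ι Q (σ i)) ≫
        (biproduct.lift fun j => F.map (biproduct.π Q (σ j)) ≫ (e j).inv) =
          (e i).inv ≫ biproduct.ι P i := by
      apply biproduct.hom_ext
      intro j
      by_cases h : i = j
      · subst h
        simp [← Functor.map_comp_assoc]
      · have h' : σ i ≠ σ j := fun h2 => h (σ.injective h2)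
        simp [← Functor.map_comp_assoc, biproduct.ι_π_ne _ h', biproduct.ι_π_ne _ h]
    rw [reassoc_of% h1]
    simp

lemma ι_biproductIsoMap_hom {J : Type*} [Finite J] (F : C ⥤ C) [F.Additive] (P Q : J → C)
    (σ : J ≃ J) (e : ∀ j, P j ≅ F.obj (Q (σ j))) (j : J) :
    biproduct.ι P j ≫ (biproductIsoMap F P Q σ e).hom =
      (e j).hom ≫ F.map (biproduct.ι Q (σ j)) := by
  simp

end Additive

/-! ### Triangle functors -/

/-- A category with a shift together with a distinguished class of triangles, called exact. -/
class HasExactTriangles (C : Type u) [Category.{v} C] [HasShift C ℤ] where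
  /-- the class of exact triangles -/
  exact : Set (Triangle C)

/-- In a pretriangulated category the exact triangles are the distinguished ones. -/
instance exactOfPretriangulated (C : Type u) [Category.{v} C] [HasShift C ℤ] [Preadditive C]
    [HasZeroObject C] [∀ n : ℤ, (shiftFunctor C n).Additive] [Pretriangulated C] :
    HasExactTriangles C where
  exact := distTriang C

section TriangleFunctors

variable (k : Type w) [Field k] (C : Type u) [Category.{v} C] [Preadditive C] [Linear k C]
  [HasShift C ℤ] [HasExactTriangles C]

/-- A `k`-linear triangle endofunctor `(F, ω)` of `C`. The connecting isomorphism `ω : FΣ ≅ ΣF`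
is contained in `commShift` (it is the component at `1 : ℤ`, and determines the others). -/
structure TriangleEndofunctor where
  /-- the underlying functor -/
  toFunctor : C ⥤ C
  additive : toFunctor.Additive
  linear : toFunctor.Linear k
  /-- the connecting isomorphisms -/
  commShift : toFunctor.CommShift ℤ
  map_exact : ∀ Δ ∈ HasExactTriangles.exact (C := C),
    toFunctor.mapTriangle.obj Δ ∈ HasExactTriangles.exact (C := C)

attribute [instance] TriangleEndofunctor.additive TriangleEndofunctor.linear
  TriangleEndofunctor.commShift

end TriangleFunctors

/-! ### Triangle actions and equivariant objects -/

section Actions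

variable (k : Type w) [Field k] (G : Type*) [Group G] (C : Type u) [Category.{v} C]
  [Preadditive C] [Linear k C] [HasShift C ℤ] [HasExactTriangles C]

/-- A `k`-linear triangle action of a group `G` on `C`: triangle autoequivalences `F g` and
isomorphisms of triangle functors `ε g h : F g ∘ F h ≅ F (g * h)` subject to the 2-cocycle
condition. To avoid transports along equalities in `G`, the isomorphism `ε g h` is indexed by
`g`, `h`, an element `m` and a proof of `g * h = m`. -/
structure TriangleAction where
  /-- the triangle functor attached to a group element -/
  F : G → TriangleEndofunctor k C
  isEquivalence : ∀ g, (F g).toFunctor.IsEquivalence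
  /-- the structure isomorphism `F g ∘ F h ≅ F (g * h)` -/
  ε : ∀ g h m : G, g * h = m → ((F h).toFunctor ⋙ (F g).toFunctor ≅ (F m).toFunctor)
  ε_commShift : ∀ (g h m : G) (e : g * h = m), NatTrans.CommShift (ε g h m e).hom ℤ
  cocycle : ∀ (g h l gh hl m : G) (e₁ : g * h = gh) (e₂ : h * l = hl) (e₃ : gh * l = m)
    (e₄ : g * hl = m) (X : C),
    (ε g h gh e₁).hom.app ((F l).toFunctor.obj X) ≫ (ε gh l m e₃).hom.app X =
      (F g).toFunctor.map ((ε h l hl e₂).hom.app X) ≫ (ε g hl m e₄).hom.app X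

attribute [instance] TriangleAction.isEquivalence TriangleAction.ε_commShift

end Actions

section Equivariant

variable {k : Type w} [Field k] {G : Type*} [Group G] {C : Type u} [Category.{v} C]
  [Preadditive C] [Linear k C] [HasShift C ℤ] [HasExactTriangles C]

/-- The underlying functor of the triangle functor attached to `g`. -/
abbrev TriangleAction.fn (A : TriangleAction k G C) (g : G) : C ⥤ C := (A.F g).toFunctor

/-- An object is stable if it is isomorphic to all its translates under the action. -/
def TriangleAction.IsStable (A : TriangleAction k G C) (X : C) : Prop :=
  ∀ g : G, Nonempty (X ≅ (A.fn g).obj X)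

/-- An equivariant object `(X, α)`. -/
structure EquivariantObject (A : TriangleAction k G C) where
  /-- the underlying object -/
  X : C
  /-- the equivariant structure -/
  α : ∀ g : G, X ≅ (A.fn g).obj X
  α_mul : ∀ (g h m : G) (e : g * h = m),
    (α m).hom = (α g).hom ≫ (A.fn g).map (α h).hom ≫ (A.ε g h m e).hom.app X

namespace EquivariantObject

variable {A : TriangleAction k G C}

/-- A morphism of equivariant objects. -/
@[ext]
structure Hom (X Y : EquivariantObject A) where
  /-- the underlying morphism -/
  f : X.X ⟶ Y.X
  comm : ∀ g : G, f ≫ (Y.α g).hom = (X.α g).hom ≫ (A.fn g).map f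

instance : Category (EquivariantObject A) where
  Hom X Y := Hom X Y
  id X := ⟨𝟙 X.X, fun g => by simp⟩
  comp φ ψ := ⟨φ.f ≫ ψ.f, fun g => by
    rw [Category.assoc, ψ.comm, ← Category.assoc, φ.comm, Category.assoc, Functor.map_comp]⟩
  id_comp φ := by cases φ; simp
  comp_id φ := by cases φ; simp
  assoc φ ψ χ := by simp

@[ext]
lemma hom_ext {X Y : EquivariantObject A} {φ ψ : X ⟶ Y} (h : φ.f = ψ.f) : φ = ψ :=
  Hom.ext h

@[simp] lemma id_f (X : EquivariantObject A) : (𝟙 X : X ⟶ X).f = 𝟙 X.X := rfl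

@[simp] lemma comp_f {X Y Z : EquivariantObject A} (φ : X ⟶ Y) (ψ : Y ⟶ Z) :
    (φ ≫ ψ).f = φ.f ≫ ψ.f := rfl

lemma eqToHom_f {X Y : EquivariantObject A} (h : X = Y) :
    (eqToHom h).f = eqToHom (by rw [h]) := by
  subst h; rfl

/-- An isomorphism of underlying objects that is compatible with the equivariant structures. -/
@[simps]
def isoMk {X Y : EquivariantObject A} (e : X.X ≅ Y.X)
    (comm : ∀ g : G, e.hom ≫ (Y.α g).hom = (X.α g).hom ≫ (A.fn g).map e.hom) : X ≅ Y where
  hom := ⟨e.hom, comm⟩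
  inv := ⟨e.inv, fun g => by
    rw [Iso.inv_comp_eq, ← Category.assoc, comm, Category.assoc, ← Functor.map_comp]
    simp⟩

/-- Two equivariant structures with equal components on the same object are isomorphic through
the identity. -/
def isoId (Z : C) {a b : ∀ g : G, Z ≅ (A.fn g).obj Z} (ha hb)
    (h : ∀ g, (b g).hom = (a g).hom) :
    (⟨Z, a, ha⟩ : EquivariantObject A) ≅ (⟨Z, b, hb⟩ : EquivariantObject A) :=
  isoMk (Iso.refl Z) fun g => by simp [h g]

instance (X Y : EquivariantObject A) : Zero (X ⟶ Y) := ⟨⟨0, by simp⟩⟩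
instance (X Y : EquivariantObject A) : Add (X ⟶ Y) :=
  ⟨fun φ ψ => ⟨φ.f + ψ.f, by simp [φ.comm, ψ.comm]⟩⟩
instance (X Y : EquivariantObject A) : Neg (X ⟶ Y) := ⟨fun φ => ⟨-φ.f, by simp [φ.comm]⟩⟩
instance (X Y : EquivariantObject A) : Sub (X ⟶ Y) :=
  ⟨fun φ ψ => ⟨φ.f - ψ.f, by simp [φ.comm, ψ.comm]⟩⟩
instance (X Y : EquivariantObject A) : SMul ℕ (X ⟶ Y) :=
  ⟨fun n φ => ⟨n • φ.f, by simp [φ.comm]⟩⟩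
instance (X Y : EquivariantObject A) : SMul ℤ (X ⟶ Y) :=
  ⟨fun n φ => ⟨n • φ.f, by simp [φ.comm]⟩⟩
instance (X Y : EquivariantObject A) : SMul k (X ⟶ Y) :=
  ⟨fun n φ => ⟨n • φ.f, by simp [φ.comm]⟩⟩

lemma f_injective (X Y : EquivariantObject A) :
    Function.Injective (fun φ : X ⟶ Y => φ.f) := fun _ _ h => hom_ext h

instance (X Y : EquivariantObject A) : AddCommGroup (X ⟶ Y) :=
  Function.Injective.addCommGroup (fun φ : X ⟶ Y => φ.f) (f_injective X Y) rfl
    (fun _ _ => rfl) (fun _ => rfl) (fun _ _ => rfl) (fun _ _ => rfl) (fun _ _ => rfl)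

@[simp] lemma zero_f (X Y : EquivariantObject A) : (0 : X ⟶ Y).f = 0 := rfl
@[simp] lemma add_f {X Y : EquivariantObject A} (φ ψ : X ⟶ Y) : (φ + ψ).f = φ.f + ψ.f := rfl
@[simp] lemma smul_f {X Y : EquivariantObject A} (c : k) (φ : X ⟶ Y) :
    (c • φ).f = c • φ.f := rfl

/-- Taking underlying morphisms, as an additive map. -/
def fHom (X Y : EquivariantObject A) : (X ⟶ Y) →+ (X.X ⟶ Y.X) where
  toFun φ := φ.f
  map_zero' := rfl
  map_add' _ _ := rfl

instance (X Y : EquivariantObject A) : Module k (X ⟶ Y) :=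
  Function.Injective.module k (fHom X Y) (f_injective X Y) (fun _ _ => rfl)

instance : Preadditive (EquivariantObject A) where

instance : Linear k (EquivariantObject A) where

@[simp] lemma sum_f {X Y : EquivariantObject A} {J : Type*} (s : Finset J) (φ : J → (X ⟶ Y)) :
    (∑ j ∈ s, φ j).f = ∑ j ∈ s, (φ j).f :=
  map_sum (fHom X Y) φ s

/-- The forgetful functor. -/
@[simps]
def forget (A : TriangleAction k G C) : EquivariantObject A ⥤ C where
  obj X := X.X
  map φ := φ.f

/-! #### The shift on equivariant objects -/

/-- The functor `Σⁿ` on equivariant objects,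
`(X, α) ↦ (Σⁿ X, ω⁻¹ ∘ Σⁿ α)`. -/
@[simps]
def shiftObj (n : ℤ) : EquivariantObject A ⥤ EquivariantObject A where
  obj X :=
    { X := (shiftFunctor C n).obj X.X
      α := fun g => (shiftFunctor C n).mapIso (X.α g) ≪≫
        (((A.fn g).commShiftIso n).app X.X).symm
      α_mul := fun g h m e => by
        have h1 := NatTrans.shift_app_comm (A.ε g h m e).hom n X.X
        rw [Functor.commShiftIso_comp_hom_app] at h1
        have h2 : (((A.ε g h m e).hom.app X.X)⟦n⟧') ≫ ((A.fn m).commShiftIso n).inv.app X.X =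
            ((A.fn g).commShiftIso n).inv.app _ ≫
              (A.fn g).map (((A.fn h).commShiftIso n).inv.app X.X) ≫
              (A.ε g h m e).hom.app (X.X⟦n⟧) := by
          rw [← cancel_mono (((A.fn m).commShiftIso n).hom.app X.X)]
          simp only [Category.assoc, ← h1, Iso.inv_hom_id_app]
          simp [← Functor.map_comp_assoc]
        have h3 := ((A.fn g).commShiftIso_inv_naturality (X.α h).hom n)
        simp only [Iso.trans_hom, Functor.mapIso_hom, Iso.symm_hom, Iso.app_inv,
          X.α_mul g h m e, Functor.map_comp, Category.assoc, h2]
        dsimp at h3 ⊢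
        rw [reassoc_of% h3] }
  map φ := ⟨(shiftFunctor C n).map φ.f, fun g => by
    have h3 := ((A.fn g).commShiftIso_inv_naturality φ.f n)
    dsimp at h3 ⊢
    rw [← Functor.map_comp_assoc, φ.comm, Functor.map_comp_assoc, h3, Category.assoc]⟩


lemma shiftZero_comm (X : EquivariantObject A) (g : G) :
    (shiftFunctorZero C ℤ).hom.app X.X ≫ (X.α g).hom =
      ((shiftFunctor C (0 : ℤ)).map (X.α g).hom ≫ ((A.fn g).commShiftIso (0 : ℤ)).inv.app X.X) ≫
        (A.fn g).map ((shiftFunctorZero C ℤ).hom.app X.X) := by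
  have h := (shiftFunctorZero C ℤ).hom.naturality (X.α g).hom
  dsimp at h
  rw [Functor.commShiftIso_zero, Functor.CommShift.isoZero_inv_app]
  simp [← Functor.map_comp]

lemma shiftAdd_comm (X : EquivariantObject A) (g : G) (n m : ℤ) :
    (shiftFunctorAdd C n m).hom.app X.X ≫
        (shiftFunctor C m).map ((shiftFunctor C n).map (X.α g).hom ≫
          ((A.fn g).commShiftIso n).inv.app X.X) ≫
        ((A.fn g).commShiftIso m).inv.app (X.X⟦n⟧) =
      ((shiftFunctor C (n + m)).map (X.α g).hom ≫
        ((A.fn g).commShiftIso (n + m)).inv.app X.X) ≫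
        (A.fn g).map ((shiftFunctorAdd C n m).hom.app X.X) := by
  have h := (shiftFunctorAdd C n m).hom.naturality (X.α g).hom
  dsimp at h
  rw [Functor.commShiftIso_add, Functor.CommShift.isoAdd_inv_app]
  simp only [Functor.map_comp, Category.assoc, ← reassoc_of% h]
  simp [← Functor.map_comp]

/-- The data exhibiting the functors `Σⁿ` as a shift by the integers. -/
def shiftMkCore (A : TriangleAction k G C) : ShiftMkCore (EquivariantObject A) ℤ where
  F := shiftObj
  zero := NatIso.ofComponents
    (fun X => isoMk ((shiftFunctorZero C ℤ).app X.X) (shiftZero_comm X))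
    (fun φ => hom_ext ((shiftFunctorZero C ℤ).hom.naturality φ.f))
  add n m := NatIso.ofComponents
    (fun X => isoMk ((shiftFunctorAdd C n m).app X.X) (fun g => shiftAdd_comm X g n m))
    (fun φ => hom_ext ((shiftFunctorAdd C n m).hom.naturality φ.f))
  assoc_hom_app n m l X := by
    have h := NatTrans.congr_app (congr_arg Iso.hom (shiftFunctorAdd_assoc C n m l)) X.X
    simp only [shiftFunctorAdd', Iso.trans_hom, NatTrans.comp_app, Functor.isoWhiskerRight_hom,
      Functor.whiskerRight_app, Functor.associator_hom_app, Category.comp_id, eqToIso.hom,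
      eqToHom_app, Functor.isoWhiskerLeft_hom, Functor.whiskerLeft_app, Category.assoc] at h
    exact hom_ext (h.trans (congrArg (fun t => t ≫ (shiftFunctorAdd C n (m + l)).hom.app X.X ≫
      (shiftFunctorAdd C m l).hom.app (X.X⟦n⟧))
      (eqToHom_f (X := (shiftObj (n + m + l)).obj X) (Y := (shiftObj (n + (m + l))).obj X)
        (by rw [add_assoc])).symm))
  zero_add_hom_app n X :=
    hom_ext ((shiftFunctorAdd_zero_add_hom_app n X.X).trans
      (congrArg (fun t => t ≫ ((shiftFunctorZero C ℤ).inv.app X.X)⟦n⟧')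
        (eqToHom_f (X := (shiftObj (0 + n)).obj X) (Y := (shiftObj n).obj X)
          (by rw [zero_add])).symm))
  add_zero_hom_app n X :=
    hom_ext ((shiftFunctorAdd_add_zero_hom_app n X.X).trans
      (congrArg (fun t => t ≫ (shiftFunctorZero C ℤ).inv.app (X.X⟦n⟧))
        (eqToHom_f (X := (shiftObj (n + 0)).obj X) (Y := (shiftObj n).obj X)
          (by rw [add_zero])).symm))

instance (A : TriangleAction k G C) : HasShift (EquivariantObject A) ℤ :=
  hasShiftMk _ _ (shiftMkCore A)

/-- The underlying triangle of a triangle of equivariant objects. -/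
def forgetTriangle (A : TriangleAction k G C) (Δ : Triangle (EquivariantObject A)) : Triangle C where
  obj₁ := Δ.obj₁.X
  obj₂ := Δ.obj₂.X
  obj₃ := Δ.obj₃.X
  mor₁ := Δ.mor₁.f
  mor₂ := Δ.mor₂.f
  mor₃ := Δ.mor₃.f

/-- A triangle of equivariant objects is exact if its underlying triangle is exact. -/
instance (A : TriangleAction k G C) : HasExactTriangles (EquivariantObject A) where
  exact := {Δ | forgetTriangle A Δ ∈ HasExactTriangles.exact (C := C)}

/-! #### Finite direct sums and induction -/

section Biproducts

variable [HasFiniteBiproducts C]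

/-- The equivariant structure of a direct sum. -/
def sumα {J : Type*} [Finite J] (X : J → EquivariantObject A) (g : G) :
    (⨁ fun j => (X j).X) ≅ (A.fn g).obj (⨁ fun j => (X j).X) :=
  biproductIsoMap (A.fn g) (fun j => (X j).X) (fun j => (X j).X) (Equiv.refl J)
    fun j => (X j).α g

lemma ι_sumα {J : Type*} [Finite J] (X : J → EquivariantObject A) (g : G) (j : J) :
    biproduct.ι (fun j => (X j).X) j ≫ (sumα X g).hom =
      ((X j).α g).hom ≫ (A.fn g).map (biproduct.ι (fun j => (X j).X) j) :=
  ι_biproductIsoMap_hom _ _ _ _ _ j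

/-- The direct sum of a finite family of equivariant objects. -/
def bicone {J : Type*} [Finite J] (X : J → EquivariantObject A) : Bicone X where
  pt :=
    { X := ⨁ fun j => (X j).X
      α := sumα X
      α_mul := fun g h m e => by
        apply biproduct.hom_ext'
        intro j
        rw [reassoc_of% (ι_sumα X g j), ι_sumα, (X j).α_mul g h m e, ← Functor.map_comp_assoc,
          ι_sumα]
        have hn := (A.ε g h m e).hom.naturality (biproduct.ι (fun j => (X j).X) j)
        dsimp at hn
        simp only [Functor.map_comp, Category.assoc, hn] }
  π j := ⟨biproduct.π _ j, fun g => by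
    apply biproduct.hom_ext'
    intro i
    rw [reassoc_of% (ι_sumα X g i), ← Functor.map_comp]
    by_cases h : i = j
    · subst h
      simp
    · simp [biproduct.ι_π_ne _ h, biproduct.ι_π_ne_assoc _ h]⟩
  ι j := ⟨biproduct.ι (fun j => (X j).X) j, fun g => ι_sumα X g j⟩
  ι_π i j := by
    apply hom_ext
    by_cases h : i = j
    · subst h
      simp
    · simp [h, biproduct.ι_π_ne (fun j => (X j).X) h]

instance : HasFiniteBiproducts (EquivariantObject A) where
  out n := ⟨fun X => ⟨⟨_, isBilimitOfTotal (bicone X) (by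
    apply hom_ext
    have h := biproduct.total (f := fun j => (X j).X)
    rw [sum_f]
    exact h)⟩⟩⟩

section Induction

variable [Finite G] (A) (X : C)

/-- The equivariant structure of an induced object: on the summand indexed by `h` it is
`(ε g (g⁻¹ * h))⁻¹ : F h X ≅ F g (F (g⁻¹ * h) X)`. -/
def indα (g : G) :
    (⨁ fun h => (A.fn h).obj X) ≅ (A.fn g).obj (⨁ fun h => (A.fn h).obj X) :=
  biproductIsoMap (A.fn g) (fun h => (A.fn h).obj X) (fun h => (A.fn h).obj X)
    (Equiv.mulLeft g⁻¹) fun h => ((A.ε g (g⁻¹ * h) h (by simp)).app X).symm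

lemma ι_indα (g l h : G) (e : g * l = h) :
    biproduct.ι (fun h => (A.fn h).obj X) h ≫ (indα A X g).hom =
      (A.ε g l h e).inv.app X ≫ (A.fn g).map (biproduct.ι (fun h => (A.fn h).obj X) l) := by
  obtain rfl : l = g⁻¹ * h := by simp [← e]
  exact ι_biproductIsoMap_hom _ _ _ _ _ h

/-- The induced equivariant object `Ind X = ⨁ h, F h X`. -/
def ind : EquivariantObject A where
  X := ⨁ fun h => (A.fn h).obj X
  α := indα A X
  α_mul g h m e := by
    apply biproduct.hom_ext'
    intro p
    have e₁ : m * (m⁻¹ * p) = p := by simp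
    have e₂ : h * (m⁻¹ * p) = g⁻¹ * p := by rw [← e]; group
    have e₃ : g * (g⁻¹ * p) = p := by simp
    rw [ι_indα A X m _ p e₁, reassoc_of% (ι_indα A X g _ p e₃), ← Functor.map_comp_assoc,
      ι_indα A X h _ _ e₂]
    have hn := (A.ε g h m e).hom.naturality
      (biproduct.ι (fun h => (A.fn h).obj X) (m⁻¹ * p))
    have hc := A.cocycle g h (m⁻¹ * p) m (g⁻¹ * p) p e e₂ e₁ e₃ X
    have hc' : (A.ε m (m⁻¹ * p) p e₁).inv.app X = (A.ε g (g⁻¹ * p) p e₃).inv.app X ≫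
        (A.fn g).map ((A.ε h (m⁻¹ * p) (g⁻¹ * p) e₂).inv.app X) ≫
          (A.ε g h m e).hom.app ((A.fn (m⁻¹ * p)).obj X) := by
      rw [← cancel_mono ((A.ε m (m⁻¹ * p) p e₁).hom.app X)]
      simp only [Category.assoc, hc, Iso.inv_hom_id_app]
      rw [← Functor.map_comp_assoc, Iso.inv_hom_id_app]
      simp
    dsimp at hn
    rw [Functor.map_comp_assoc, hn, hc']
    simp only [Category.assoc]

end Induction

end Biproducts

end EquivariantObject
end Equivariant

/-! ### Equivariant triangle functors -/

section TriangleFunctors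

variable {k : Type w} [Field k] {C : Type u} [Category.{v} C] [Preadditive C] [Linear k C]
  [HasShift C ℤ] [HasExactTriangles C]

namespace TriangleEndofunctor

variable (k C) in
/-- The identity triangle functor. -/
def id : TriangleEndofunctor k C where
  toFunctor := 𝟭 C
  additive := inferInstance
  linear := inferInstance
  commShift := inferInstance
  map_exact Δ h := by
    have e : (𝟭 C).mapTriangle.obj Δ = Δ := by
      cases Δ
      simp [Functor.mapTriangle, Triangle.mk]
    rwa [e]

/-- The composition `E ∘ E'` of triangle functors. -/
def comp (E E' : TriangleEndofunctor k C) : TriangleEndofunctor k C where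
  toFunctor := E'.toFunctor ⋙ E.toFunctor
  additive := inferInstance
  linear := inferInstance
  commShift := inferInstance
  map_exact Δ h := by
    have e : (E'.toFunctor ⋙ E.toFunctor).mapTriangle.obj Δ =
        E.toFunctor.mapTriangle.obj (E'.toFunctor.mapTriangle.obj Δ) := by
      simp [Functor.mapTriangle, Triangle.mk, Functor.commShiftIso_comp_hom_app]
    rw [e]
    exact E.map_exact _ (E'.map_exact _ h)

end TriangleEndofunctor

end TriangleFunctors

section EquivariantFunctors

variable {k : Type w} [Field k] {G : Type*} [Group G] {C : Type u} [Category.{v} C]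
  [Preadditive C] [Linear k C] [HasShift C ℤ] [HasExactTriangles C]

/-- An equivariant triangle endofunctor `((F, ω), δ)`. -/
structure EquivariantEndofunctor (A : TriangleAction k G C) extends TriangleEndofunctor k C where
  /-- the isomorphism `F ∘ F g ≅ F g ∘ F` -/
  δ : ∀ g : G, A.fn g ⋙ toFunctor ≅ toFunctor ⋙ A.fn g
  δ_commShift : ∀ g : G, NatTrans.CommShift (δ g).hom ℤ
  δ_mul : ∀ (g h m : G) (e : g * h = m) (X : C),
    toFunctor.map ((A.ε g h m e).hom.app X) ≫ (δ m).hom.app X =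
      (δ g).hom.app ((A.fn h).obj X) ≫ (A.fn g).map ((δ h).hom.app X) ≫
        (A.ε g h m e).hom.app (toFunctor.obj X)

attribute [instance] EquivariantEndofunctor.δ_commShift

namespace EquivariantEndofunctor

variable {A : TriangleAction k G C}

/-- The relation of being isomorphic as equivariant triangle functors. -/
def Isomorphic (E E' : EquivariantEndofunctor A) : Prop :=
  ∃ φ : E.toFunctor ≅ E'.toFunctor, NatTrans.CommShift φ.hom ℤ ∧
    ∀ (g : G) (X : C), (E.δ g).hom.app X ≫ (A.fn g).map (φ.hom.app X) =
      φ.hom.app ((A.fn g).obj X) ≫ (E'.δ g).hom.app X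

lemma Isomorphic.refl (E : EquivariantEndofunctor A) : Isomorphic E E :=
  ⟨Iso.refl _, inferInstanceAs (NatTrans.CommShift (𝟙 _) ℤ), fun g X => by simp⟩

lemma Isomorphic.symm {E E' : EquivariantEndofunctor A} :
    Isomorphic E E' → Isomorphic E' E := by
  rintro ⟨φ, h, hδ⟩
  refine ⟨φ.symm, inferInstance, fun g X => ?_⟩
  rw [← cancel_epi (φ.hom.app ((A.fn g).obj X)), ← reassoc_of% (hδ g X), ← Functor.map_comp]
  simp

lemma Isomorphic.trans {E E' E'' : EquivariantEndofunctor A} :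
    Isomorphic E E' → Isomorphic E' E'' → Isomorphic E E'' := by
  rintro ⟨φ, h, hδ⟩ ⟨ψ, h', hδ'⟩
  refine ⟨φ ≪≫ ψ, inferInstanceAs (NatTrans.CommShift (φ.hom ≫ ψ.hom) ℤ), fun g X => ?_⟩
  simp only [Iso.trans_hom, NatTrans.comp_app, Functor.map_comp, Category.assoc]
  rw [reassoc_of% (hδ g X), hδ']

variable (A) in
/-- The identity as an equivariant triangle functor. -/
def id : EquivariantEndofunctor A where
  __ := TriangleEndofunctor.id k C
  δ g := (A.fn g).rightUnitor ≪≫ (A.fn g).leftUnitor.symm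
  δ_commShift g := inferInstanceAs
    (NatTrans.CommShift ((A.fn g).rightUnitor.hom ≫ (A.fn g).leftUnitor.inv) ℤ)
  δ_mul g h m e X := by simp [TriangleEndofunctor.id]

/-- The composition `E ∘ E'` of equivariant triangle functors. -/
def comp (E E' : EquivariantEndofunctor A) : EquivariantEndofunctor A where
  __ := TriangleEndofunctor.comp E.toTriangleEndofunctor E'.toTriangleEndofunctor
  δ g := (Functor.associator _ _ _).symm ≪≫ Functor.isoWhiskerRight (E'.δ g) E.toFunctor ≪≫
    Functor.associator _ _ _ ≪≫ Functor.isoWhiskerLeft E'.toFunctor (E.δ g) ≪≫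
      (Functor.associator _ _ _).symm
  δ_commShift g := inferInstanceAs
    (NatTrans.CommShift ((Functor.associator (A.fn g) E'.toFunctor E.toFunctor).inv ≫
      Functor.whiskerRight (E'.δ g).hom E.toFunctor ≫
      (Functor.associator E'.toFunctor (A.fn g) E.toFunctor).hom ≫
      Functor.whiskerLeft E'.toFunctor (E.δ g).hom ≫
      (Functor.associator E'.toFunctor E.toFunctor (A.fn g)).inv) ℤ)
  δ_mul g h m e X := by
    have h1 := E'.δ_mul g h m e X
    have h2 := E.δ_mul g h m e (E'.toFunctor.obj X)
    have h3 := (E.δ g).hom.naturality ((E'.δ h).hom.app X)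
    dsimp [TriangleEndofunctor.comp] at h3 ⊢
    simp only [Category.id_comp, Category.comp_id, Functor.map_comp, Category.assoc]
    rw [← Functor.map_comp_assoc, h1, Functor.map_comp, Functor.map_comp, Category.assoc,
      Category.assoc, h2, reassoc_of% h3]

lemma Isomorphic.comp {E₁ E₁' E₂ E₂' : EquivariantEndofunctor A} :
    Isomorphic E₁ E₁' → Isomorphic E₂ E₂' → Isomorphic (E₁.comp E₂) (E₁'.comp E₂') := by
  rintro ⟨φ, h, hδ⟩ ⟨ψ, h', hδ'⟩
  refine ⟨Functor.isoWhiskerRight ψ _ ≪≫ Functor.isoWhiskerLeft _ φ,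
    inferInstanceAs (NatTrans.CommShift (Functor.whiskerRight ψ.hom E₁.toFunctor ≫
      Functor.whiskerLeft E₂'.toFunctor φ.hom) ℤ), fun g X => ?_⟩
  have h1 := (E₁.δ g).hom.naturality (ψ.hom.app X)
  have h2 := φ.hom.naturality ((E₂'.δ g).hom.app X)
  have h3 := hδ' g X
  have h4 := hδ g (E₂'.toFunctor.obj X)
  dsimp [EquivariantEndofunctor.comp, TriangleEndofunctor.comp] at h1 h2 h3 h4 ⊢
  simp only [Category.id_comp, Category.comp_id, Functor.map_comp, Category.assoc]
  rw [← reassoc_of% h1, h4, ← Functor.map_comp_assoc, h3, Functor.map_comp_assoc,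
    reassoc_of% h2]

end EquivariantEndofunctor

/-- An equivariant triangle autoequivalence. -/
structure EquivariantAutoequivalence (A : TriangleAction k G C) extends
    EquivariantEndofunctor A where
  isEquivalence : toFunctor.IsEquivalence

attribute [instance] EquivariantAutoequivalence.isEquivalence

/-- Isomorphism of equivariant triangle autoequivalences. -/
instance autSetoid (A : TriangleAction k G C) : Setoid (EquivariantAutoequivalence A) where
  r E E' := E.toEquivariantEndofunctor.Isomorphic E'.toEquivariantEndofunctor
  iseqv := ⟨fun _ => .refl _, .symm, .trans⟩

/-- `TriangleAut A`: isomorphism classes of equivariant triangle autoequivalences. -/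
def TriangleAut (A : TriangleAction k G C) : Type _ := Quotient (autSetoid A)

namespace TriangleAut

variable (A : TriangleAction k G C)

/-- The multiplication is induced by composition. -/
instance : Monoid (TriangleAut A) where
  one := Quotient.mk _
    { toEquivariantEndofunctor := EquivariantEndofunctor.id A
      isEquivalence := inferInstanceAs (𝟭 C).IsEquivalence }
  mul := Quotient.map₂ (fun E E' =>
    { toEquivariantEndofunctor := E.toEquivariantEndofunctor.comp E'.toEquivariantEndofunctor
      isEquivalence := inferInstanceAs (E'.toFunctor ⋙ E.toFunctor).IsEquivalence })
    (fun _ _ h _ _ h' => EquivariantEndofunctor.Isomorphic.comp h h')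
  mul_assoc := by
    rintro ⟨E₁⟩ ⟨E₂⟩ ⟨E₃⟩
    refine Quotient.sound ⟨(Functor.associator E₃.toFunctor E₂.toFunctor E₁.toFunctor).symm,
      ?_, ?_⟩
    · exact inferInstanceAs (NatTrans.CommShift
        (Functor.associator E₃.toFunctor E₂.toFunctor E₁.toFunctor).inv ℤ)
    · intro g X
      simp [EquivariantEndofunctor.comp, TriangleEndofunctor.comp]
  one_mul := by
    rintro ⟨E⟩
    refine Quotient.sound ⟨E.toFunctor.rightUnitor, ?_, ?_⟩
    · exact inferInstanceAs (NatTrans.CommShift E.toFunctor.rightUnitor.hom ℤ)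
    · intro g X
      simp [EquivariantEndofunctor.comp, TriangleEndofunctor.comp, EquivariantEndofunctor.id,
        TriangleEndofunctor.id]
  mul_one := by
    rintro ⟨E⟩
    refine Quotient.sound ⟨E.toFunctor.leftUnitor, ?_, ?_⟩
    · exact inferInstanceAs (NatTrans.CommShift E.toFunctor.leftUnitor.hom ℤ)
    · intro g X
      simp [EquivariantEndofunctor.comp, TriangleEndofunctor.comp, EquivariantEndofunctor.id,
        TriangleEndofunctor.id]

end TriangleAut

end EquivariantFunctors

/-! ### The dual action -/

section Dual

variable {k : Type w} [Field k] {G : Type*} [Group G] {C : Type u} [Category.{v} C]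
  [Preadditive C] [Linear k C] [HasShift C ℤ] [HasExactTriangles C] {A : TriangleAction k G C}

lemma shiftZero_hom_f (X : EquivariantObject A) :
    ((shiftFunctorZero (EquivariantObject A) ℤ).hom.app X).f =
      (shiftFunctorZero C ℤ).hom.app X.X := rfl

lemma shiftZero_inv_f (X : EquivariantObject A) :
    ((shiftFunctorZero (EquivariantObject A) ℤ).inv.app X).f =
      (shiftFunctorZero C ℤ).inv.app X.X := rfl

lemma shiftAdd_hom_f (X : EquivariantObject A) (n m : ℤ) :
    ((shiftFunctorAdd (EquivariantObject A) n m).hom.app X).f =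
      (shiftFunctorAdd C n m).hom.app X.X := rfl

lemma shiftAdd_inv_f (X : EquivariantObject A) (n m : ℤ) :
    ((shiftFunctorAdd (EquivariantObject A) n m).inv.app X).f =
      (shiftFunctorAdd C n m).inv.app X.X := rfl

/-- An invertible scalar multiple of an isomorphism. -/
@[simps]
def smulIso {X Y : C} (c : kˣ) (e : X ≅ Y) : X ≅ Y where
  hom := (c : k) • e.hom
  inv := ((c⁻¹ : kˣ) : k) • e.inv
  hom_inv_id := by simp [smul_smul]
  inv_hom_id := by simp [smul_smul]

variable (A) in
/-- The functor `F χ : (X, α) ↦ (X, χ ⊗ α)`, where `(χ ⊗ α) g = χ (g⁻¹) • α g`. -/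
@[simps]
def twist (χ : G →* kˣ) : EquivariantObject A ⥤ EquivariantObject A where
  obj X :=
    { X := X.X
      α := fun g => smulIso (χ g⁻¹) (X.α g)
      α_mul := fun g h m e => by
        subst e
        have h1 : ((χ (g * h)⁻¹ : kˣ) : k) = (χ h⁻¹ : kˣ) * (χ g⁻¹ : kˣ) := by
          rw [mul_inv_rev, map_mul, Units.val_mul]
        simp only [smulIso_hom, X.α_mul g h _ rfl, Functor.map_smul, Linear.smul_comp,
          Linear.comp_smul, smul_smul, h1] }
  map φ := ⟨φ.f, fun g => by simp [φ.comm]⟩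

instance (χ : G →* kˣ) : (twist A χ).Additive where

instance (χ : G →* kˣ) : (twist A χ).Linear k where

instance (χ : G →* kˣ) : (twist A χ).Faithful where
  map_injective {X Y} φ ψ h := by
    have h' : ((twist A χ).map φ).f = ((twist A χ).map ψ).f := by rw [h]
    exact EquivariantObject.hom_ext h'

instance (χ : G →* kˣ) : (twist A χ).Full where
  map_surjective {X Y} φ := by
    have key : ∀ (f : X.X ⟶ Y.X) (g : G), f ≫ (((χ g⁻¹ : kˣ) : k) • (Y.α g).hom) =
        (((χ g⁻¹ : kˣ) : k) • (X.α g).hom) ≫ (A.fn g).map f →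
        f ≫ (Y.α g).hom = (X.α g).hom ≫ (A.fn g).map f := by
      intro f g h
      rw [Linear.smul_comp, Linear.comp_smul] at h
      have h' := congrArg (fun t => ((χ g⁻¹ : kˣ) : k)⁻¹ • t) h
      simpa only [smul_smul, inv_mul_cancel₀ (χ g⁻¹).ne_zero, one_smul] using h'
    exact ⟨⟨φ.f, fun g => key φ.f g (φ.comm g)⟩, rfl⟩

variable (A) in
/-- `F χ ∘ F χ' = F (χ χ')`; the isomorphism is the identity on underlying objects. -/
def twistMul (χ χ' ψ : G →* kˣ) (e : χ * χ' = ψ) :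
    twist A χ' ⋙ twist A χ ≅ twist A ψ :=
  NatIso.ofComponents (fun X => EquivariantObject.isoId X.X _ _ (fun g => by
    subst e
    exact (smul_smul ((χ g⁻¹ : kˣ) : k) ((χ' g⁻¹ : kˣ) : k) (X.α g).hom).symm)) (fun φ => EquivariantObject.hom_ext
      ((Category.comp_id φ.f).trans (Category.id_comp φ.f).symm))

lemma twistMul_hom_f (χ χ' ψ : G →* kˣ) (e : χ * χ' = ψ) (X : EquivariantObject A) :
    ((twistMul A χ χ' ψ e).hom.app X).f = 𝟙 X.X := rfl

variable (A) in
/-- `F 1` is the identity. -/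
def twistOne : twist A 1 ≅ 𝟭 _ :=
  NatIso.ofComponents (fun X => EquivariantObject.isoId X.X _ X.α_mul (fun g => by simp))
    (fun φ => EquivariantObject.hom_ext
      ((Category.comp_id φ.f).trans (Category.id_comp φ.f).symm))

instance (χ : G →* kˣ) : (twist A χ).IsEquivalence where
  essSurj := ⟨fun X => ⟨(twist A χ⁻¹).obj X,
    ⟨(twistMul A χ χ⁻¹ 1 (mul_inv_cancel χ)).app X ≪≫ (twistOne A).app X⟩⟩⟩

section Linear

variable [∀ n : ℤ, (shiftFunctor C n).Linear k]

variable (A) in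
/-- The connecting isomorphisms of `F χ` are the identity on underlying objects. -/
def twistShift (χ : G →* kˣ) (n : ℤ) :
    shiftFunctor (EquivariantObject A) n ⋙ twist A χ ≅
      twist A χ ⋙ shiftFunctor (EquivariantObject A) n :=
  NatIso.ofComponents (fun X => EquivariantObject.isoId (X.X⟦n⟧) _ _ (fun g => by
    have h : (((χ g⁻¹ : kˣ) : k) • (X.α g).hom)⟦n⟧' ≫ ((A.fn g).commShiftIso n).inv.app X.X =
        ((χ g⁻¹ : kˣ) : k) • ((X.α g).hom⟦n⟧' ≫ ((A.fn g).commShiftIso n).inv.app X.X) := by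
      rw [Functor.map_smul, Linear.smul_comp]
    exact h)) (fun φ => EquivariantObject.hom_ext
      ((Category.comp_id (φ.f⟦n⟧')).trans (Category.id_comp (φ.f⟦n⟧')).symm))

instance (χ : G →* kˣ) : (twist A χ).CommShift ℤ where
  commShiftIso := twistShift A χ
  commShiftIso_zero := by
    ext X : 3
    rw [Functor.CommShift.isoZero_hom_app]
    exact EquivariantObject.hom_ext ((shiftFunctorZero C ℤ).hom_inv_id_app X.X).symm
  commShiftIso_add n m := by
    ext X : 3
    rw [Functor.CommShift.isoAdd_hom_app]
    have h : 𝟙 (X.X⟦n + m⟧) = (shiftFunctorAdd C n m).hom.app X.X ≫ 𝟙 _ ≫ (𝟙 (X.X⟦n⟧))⟦m⟧' ≫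
        (shiftFunctorAdd C n m).inv.app X.X := by simp
    exact EquivariantObject.hom_ext h

lemma twist_forgetTriangle (χ : G →* kˣ) (Δ : Triangle (EquivariantObject A)) :
    EquivariantObject.forgetTriangle A ((twist A χ).mapTriangle.obj Δ) =
      EquivariantObject.forgetTriangle A Δ := by
  have h : Δ.mor₃.f ≫ 𝟙 _ = Δ.mor₃.f := Category.comp_id _
  exact congrArg (fun t => (⟨Δ.obj₁.X, Δ.obj₂.X, Δ.obj₃.X, Δ.mor₁.f, Δ.mor₂.f, t⟩ : Triangle C)) h

variable (A) in
/-- `F χ` as a triangle functor. -/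
def twistTriangle (χ : G →* kˣ) : TriangleEndofunctor k (EquivariantObject A) where
  toFunctor := twist A χ
  additive := inferInstance
  linear := inferInstance
  commShift := inferInstance
  map_exact Δ h := by
    change EquivariantObject.forgetTriangle A ((twist A χ).mapTriangle.obj Δ) ∈
      HasExactTriangles.exact (C := C)
    rw [twist_forgetTriangle]
    exact h

instance (χ χ' ψ : G →* kˣ) (e : χ * χ' = ψ) :
    NatTrans.CommShift (twistMul A χ χ' ψ e).hom ℤ where
  shift_comm n := by
    ext X : 2
    rw [NatTrans.comp_app, NatTrans.comp_app, Functor.commShiftIso_comp_hom_app]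
    have h : (𝟙 (X.X⟦n⟧) ≫ 𝟙 (X.X⟦n⟧)) ≫ (𝟙 X.X)⟦n⟧' = 𝟙 (X.X⟦n⟧) ≫ 𝟙 (X.X⟦n⟧) := by simp
    exact EquivariantObject.hom_ext h

variable (A) in
/-- The dual action of the character group on equivariant objects. -/
def dualAction : TriangleAction k (G →* kˣ) (EquivariantObject A) where
  F := twistTriangle A
  isEquivalence χ := (inferInstance : (twist A χ).IsEquivalence)
  ε := twistMul A
  ε_commShift χ χ' ψ e :=
    (inferInstance : NatTrans.CommShift (twistMul A χ χ' ψ e).hom ℤ)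
  cocycle _ _ _ _ _ _ _ _ _ _ _ := EquivariantObject.hom_ext rfl

end Linear

/-! ### Equivariantization -/

variable (E : EquivariantEndofunctor A)

/-- The functor `(F, δ)^G : (X, α) ↦ (F X, δ ∘ F α)`. -/
@[simps]
def equivariantFunctor : EquivariantObject A ⥤ EquivariantObject A where
  obj X :=
    { X := E.toFunctor.obj X.X
      α := fun g => E.toFunctor.mapIso (X.α g) ≪≫ (E.δ g).app X.X
      α_mul := fun g h m e => by
        have h1 := E.δ_mul g h m e X.X
        have h2 := (E.δ g).hom.naturality (X.α h).hom
        dsimp at h2 ⊢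
        simp only [X.α_mul g h m e, Functor.map_comp, Category.assoc, h1]
        rw [reassoc_of% h2] }
  map φ := ⟨E.toFunctor.map φ.f, fun g => by
    have h2 := (E.δ g).hom.naturality φ.f
    dsimp at h2 ⊢
    rw [← Functor.map_comp_assoc, φ.comm, Functor.map_comp_assoc, h2, Category.assoc]⟩

lemma equivariantFunctor_map_f' {X Y : EquivariantObject A} (φ : X ⟶ Y) :
    ((equivariantFunctor E).map φ).f = E.toFunctor.map φ.f := rfl

instance : (equivariantFunctor E).Additive where
  map_add := EquivariantObject.hom_ext E.toFunctor.map_add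

instance : (equivariantFunctor E).Linear k where
  map_smul φ c := EquivariantObject.hom_ext (E.toFunctor.map_smul c φ.f)

lemma equivariantShift_comm (n : ℤ) (X : EquivariantObject A) (g : G) :
    (E.toFunctor.commShiftIso n).hom.app X.X ≫
        (E.toFunctor.map (X.α g).hom ≫ (E.δ g).hom.app X.X)⟦n⟧' ≫
          ((A.fn g).commShiftIso n).inv.app (E.toFunctor.obj X.X) =
      (E.toFunctor.map ((X.α g).hom⟦n⟧' ≫ ((A.fn g).commShiftIso n).inv.app X.X) ≫
        (E.δ g).hom.app (X.X⟦n⟧)) ≫ (A.fn g).map ((E.toFunctor.commShiftIso n).hom.app X.X) := by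
  have h1 := NatTrans.shift_app_comm (E.δ g).hom n X.X
  rw [Functor.commShiftIso_comp_hom_app, Functor.commShiftIso_comp_hom_app] at h1
  have h2 := E.toFunctor.commShiftIso_hom_naturality (X.α g).hom n
  rw [← cancel_mono (((A.fn g).commShiftIso n).hom.app (E.toFunctor.obj X.X))]
  simp only [Functor.map_comp, Category.assoc, Iso.inv_hom_id_app] at h1 ⊢
  rw [← h1, ← Functor.map_comp_assoc E.toFunctor (((A.fn g).commShiftIso n).inv.app X.X),
    Iso.inv_hom_id_app]
  dsimp at h2 ⊢
  rw [CategoryTheory.Functor.map_id, Category.id_comp, Category.comp_id, reassoc_of% h2]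

/-- The connecting isomorphisms of `(F, δ)^G` are those of `F` on underlying objects. -/
def equivariantShift (n : ℤ) :
    shiftFunctor (EquivariantObject A) n ⋙ equivariantFunctor E ≅
      equivariantFunctor E ⋙ shiftFunctor (EquivariantObject A) n :=
  NatIso.ofComponents (fun X => EquivariantObject.isoMk ((E.toFunctor.commShiftIso n).app X.X)
      (equivariantShift_comm E n X))
    (fun φ => EquivariantObject.hom_ext ((E.toFunctor.commShiftIso n).hom.naturality φ.f))

instance : (equivariantFunctor E).CommShift ℤ where
  commShiftIso := equivariantShift E
  commShiftIso_zero := by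
    ext X : 3
    rw [Functor.CommShift.isoZero_hom_app]
    have h := congrArg (fun t => t.hom.app X.X) (E.toFunctor.commShiftIso_zero ℤ)
    exact EquivariantObject.hom_ext (h.trans (Functor.CommShift.isoZero_hom_app _ _ _))
  commShiftIso_add n m := by
    ext X : 3
    rw [Functor.CommShift.isoAdd_hom_app]
    have h := congrArg (fun t => t.hom.app X.X) (E.toFunctor.commShiftIso_add n m)
    exact EquivariantObject.hom_ext (h.trans (Functor.CommShift.isoAdd_hom_app _ _ _))

lemma equivariantFunctor_forgetTriangle (Δ : Triangle (EquivariantObject A)) :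
    EquivariantObject.forgetTriangle A ((equivariantFunctor E).mapTriangle.obj Δ) =
      E.toFunctor.mapTriangle.obj (EquivariantObject.forgetTriangle A Δ) := rfl

section

variable [E.toFunctor.IsEquivalence]

instance : (equivariantFunctor E).Faithful where
  map_injective {X Y} φ ψ h := by
    have h' : ((equivariantFunctor E).map φ).f = ((equivariantFunctor E).map ψ).f := by rw [h]
    exact EquivariantObject.hom_ext (E.toFunctor.map_injective h')

instance : (equivariantFunctor E).Full where
  map_surjective {X Y} φ := by
    obtain ⟨f, hf⟩ := E.toFunctor.map_surjective φ.f
    refine ⟨⟨f, fun g => ?_⟩, EquivariantObject.hom_ext hf⟩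
    apply E.toFunctor.map_injective
    have h : E.toFunctor.map f ≫ E.toFunctor.map (Y.α g).hom ≫ (E.δ g).hom.app Y.X =
        (E.toFunctor.map (X.α g).hom ≫ (E.δ g).hom.app X.X) ≫
          (A.fn g).map (E.toFunctor.map f) := by
      rw [hf]
      exact φ.comm g
    have h2 := (E.δ g).hom.naturality f
    dsimp at h2
    rw [← cancel_mono ((E.δ g).hom.app Y.X), Functor.map_comp, Functor.map_comp, Category.assoc,
      h, Category.assoc, Category.assoc, h2]

instance : (equivariantFunctor E).EssSurj where
  mem_essImage Z := by
    let X := E.toFunctor.objPreimage Z.X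
    let θ : E.toFunctor.obj X ≅ Z.X := E.toFunctor.objObjPreimageIso Z.X
    let a (g : G) : X ≅ (A.fn g).obj X := E.toFunctor.preimageIso
      (θ ≪≫ Z.α g ≪≫ (A.fn g).mapIso θ.symm ≪≫ ((E.δ g).app X).symm)
    have ha (g : G) : E.toFunctor.map (a g).hom ≫ (E.δ g).hom.app X =
        θ.hom ≫ (Z.α g).hom ≫ (A.fn g).map θ.inv := by
      simp [a]
    have hmul (g h m : G) (e : g * h = m) :
        (a m).hom = (a g).hom ≫ (A.fn g).map (a h).hom ≫ (A.ε g h m e).hom.app X := by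
      apply E.toFunctor.map_injective
      have h1 := E.δ_mul g h m e X
      have h2 := (E.δ g).hom.naturality (a h).hom
      have h3 := (A.ε g h m e).hom.naturality θ.inv
      dsimp at h2 h3
      rw [← cancel_mono ((E.δ m).hom.app X), ha, Z.α_mul g h m e]
      simp only [Functor.map_comp, Category.assoc, h1]
      rw [reassoc_of% h2, reassoc_of% (ha g), ← Functor.map_comp_assoc (A.fn g)
        (E.toFunctor.map (a h).hom), ha h]
      simp only [Functor.map_comp, Category.assoc, h3]
      rw [← Functor.map_comp_assoc (A.fn g) θ.inv θ.hom]
      simp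
    refine ⟨⟨X, a, hmul⟩, ⟨EquivariantObject.isoMk θ fun g => ?_⟩⟩
    have h : θ.hom ≫ (Z.α g).hom =
        (E.toFunctor.map (a g).hom ≫ (E.δ g).hom.app X) ≫ (A.fn g).map θ.hom := by
      rw [ha]
      simp [← Functor.map_comp]
    exact h

instance : (equivariantFunctor E).IsEquivalence where

end

section Linear

variable [∀ n : ℤ, (shiftFunctor C n).Linear k]

/-- `(F, δ)^G` commutes strictly with the functors `F χ`: the isomorphism is the identity on
underlying objects. -/
def strictIso (χ : G →* kˣ) :
    twist A χ ⋙ equivariantFunctor E ≅ equivariantFunctor E ⋙ twist A χ :=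
  NatIso.ofComponents (fun X => EquivariantObject.isoId (E.toFunctor.obj X.X) _ _ (fun g => by
    have h : ((χ g⁻¹ : kˣ) : k) • (E.toFunctor.map (X.α g).hom ≫ (E.δ g).hom.app X.X) =
        E.toFunctor.map (((χ g⁻¹ : kˣ) : k) • (X.α g).hom) ≫ (E.δ g).hom.app X.X := by
      rw [Functor.map_smul, Linear.smul_comp]
    exact h)) (fun φ => EquivariantObject.hom_ext
      ((Category.comp_id (E.toFunctor.map φ.f)).trans
        (Category.id_comp (E.toFunctor.map φ.f)).symm))

instance (χ : G →* kˣ) : NatTrans.CommShift (strictIso E χ).hom ℤ where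
  shift_comm n := by
    ext X : 2
    rw [NatTrans.comp_app, NatTrans.comp_app, Functor.commShiftIso_comp_hom_app,
      Functor.commShiftIso_comp_hom_app]
    have h : (E.toFunctor.map (𝟙 (X.X⟦n⟧)) ≫ (E.toFunctor.commShiftIso n).hom.app X.X) ≫
        (𝟙 (E.toFunctor.obj X.X))⟦n⟧' =
        𝟙 (E.toFunctor.obj (X.X⟦n⟧)) ≫ (E.toFunctor.commShiftIso n).hom.app X.X ≫
          𝟙 ((E.toFunctor.obj X.X)⟦n⟧) := by simp
    exact EquivariantObject.hom_ext h

/-- `(F, δ)^G` as an equivariant triangle endofunctor for the dual action. -/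
def EquivariantEndofunctor.equivariantization : EquivariantEndofunctor (dualAction A) where
  toFunctor := equivariantFunctor E
  additive := inferInstance
  linear := inferInstance
  commShift := inferInstance
  map_exact Δ h := by
    change EquivariantObject.forgetTriangle A ((equivariantFunctor E).mapTriangle.obj Δ) ∈
      HasExactTriangles.exact (C := C)
    rw [equivariantFunctor_forgetTriangle]
    exact E.map_exact _ h
  δ χ := strictIso E χ
  δ_commShift χ := (inferInstance : NatTrans.CommShift (strictIso E χ).hom ℤ)
  δ_mul χ χ' ψ e X := by
    have h : E.toFunctor.map (𝟙 X.X) ≫ 𝟙 (E.toFunctor.obj X.X) =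
        𝟙 (E.toFunctor.obj X.X) ≫ 𝟙 (E.toFunctor.obj X.X) ≫ 𝟙 (E.toFunctor.obj X.X) := by simp
    exact EquivariantObject.hom_ext h

/-- An isomorphism of functors on equivariant objects, from an isomorphism of equivariant
functors. -/
def equivariantFunctorIso {E E' : EquivariantEndofunctor A} (φ : E.toFunctor ≅ E'.toFunctor)
    (hφ : ∀ (g : G) (X : C), (E.δ g).hom.app X ≫ (A.fn g).map (φ.hom.app X) =
      φ.hom.app ((A.fn g).obj X) ≫ (E'.δ g).hom.app X) :
    equivariantFunctor E ≅ equivariantFunctor E' :=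
  NatIso.ofComponents (fun X => EquivariantObject.isoMk (φ.app X.X) (fun g => by
    have h1 := φ.hom.naturality (X.α g).hom
    have h : φ.hom.app X.X ≫ E'.toFunctor.map (X.α g).hom ≫ (E'.δ g).hom.app X.X =
        (E.toFunctor.map (X.α g).hom ≫ (E.δ g).hom.app X.X) ≫
          (A.fn g).map (φ.hom.app X.X) := by
      rw [Category.assoc, hφ, ← reassoc_of% h1]
    exact h)) (fun f => EquivariantObject.hom_ext (φ.hom.naturality f.f))

lemma EquivariantEndofunctor.Isomorphic.equivariantization {E E' : EquivariantEndofunctor A} :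
    E.Isomorphic E' → E.equivariantization.Isomorphic E'.equivariantization := by
  rintro ⟨φ, h, hφ⟩
  refine ⟨equivariantFunctorIso φ hφ, ⟨fun n => ?_⟩, fun χ X => ?_⟩
  · ext X : 2
    have h1 := NatTrans.shift_app_comm φ.hom n X.X
    exact EquivariantObject.hom_ext h1
  · have h1 : 𝟙 (E.toFunctor.obj X.X) ≫ φ.hom.app X.X =
        φ.hom.app X.X ≫ 𝟙 (E'.toFunctor.obj X.X) := by simp
    exact EquivariantObject.hom_ext h1

variable (A) in
/-- The equivariantization homomorphism `[F, δ] ↦ [(F, δ)^G]`. -/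
def TriangleAut.equivariantization : TriangleAut A →* TriangleAut (dualAction A) where
  toFun := Quotient.map (fun E =>
    { toEquivariantEndofunctor := E.toEquivariantEndofunctor.equivariantization
      isEquivalence := (inferInstance :
        (equivariantFunctor E.toEquivariantEndofunctor).IsEquivalence) })
    (fun _ _ h => EquivariantEndofunctor.Isomorphic.equivariantization h)
  map_one' := by
    refine Quotient.sound ⟨NatIso.ofComponents (fun X => EquivariantObject.isoMk (Iso.refl X.X)
      (fun g => ?_)) (fun φ => EquivariantObject.hom_ext
      ((Category.comp_id φ.f).trans (Category.id_comp φ.f).symm)), ⟨fun n => ?_⟩, fun χ X => ?_⟩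
    · have h : 𝟙 X.X ≫ (X.α g).hom =
          ((X.α g).hom ≫ 𝟙 _ ≫ 𝟙 _) ≫ (A.fn g).map (𝟙 X.X) := by simp
      exact h
    · ext X : 2
      have h : (𝟙 (X.X⟦n⟧) ≫ 𝟙 (X.X⟦n⟧)) ≫ (𝟙 X.X)⟦n⟧' =
          𝟙 (X.X⟦n⟧) ≫ 𝟙 (X.X⟦n⟧) ≫ 𝟙 (X.X⟦n⟧) := by simp
      exact EquivariantObject.hom_ext h
    · have h : 𝟙 X.X ≫ 𝟙 X.X = 𝟙 X.X ≫ 𝟙 X.X ≫ 𝟙 X.X := by simp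
      exact EquivariantObject.hom_ext h
  map_mul' := by
    rintro ⟨E⟩ ⟨E'⟩
    refine Quotient.sound ⟨NatIso.ofComponents (fun X => EquivariantObject.isoMk
      (Iso.refl (E.toFunctor.obj (E'.toFunctor.obj X.X)))
      (fun g => ?_)) (fun φ => EquivariantObject.hom_ext
      ((Category.comp_id (E.toFunctor.map (E'.toFunctor.map φ.f))).trans
        (Category.id_comp (E.toFunctor.map (E'.toFunctor.map φ.f))).symm)), ⟨fun n => ?_⟩,
          fun χ X => ?_⟩
    · have h : 𝟙 (E.toFunctor.obj (E'.toFunctor.obj X.X)) ≫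
          E.toFunctor.map (E'.toFunctor.map (X.α g).hom ≫ (E'.δ g).hom.app X.X) ≫
            (E.δ g).hom.app (E'.toFunctor.obj X.X) =
          (E.toFunctor.map (E'.toFunctor.map (X.α g).hom) ≫ 𝟙 _ ≫
            E.toFunctor.map ((E'.δ g).hom.app X.X) ≫ 𝟙 _ ≫
            (E.δ g).hom.app (E'.toFunctor.obj X.X) ≫ 𝟙 _) ≫ (A.fn g).map (𝟙 _) := by simp
      exact h
    · ext X : 2
      rw [NatTrans.comp_app, NatTrans.comp_app]
      have h : ((E'.toFunctor ⋙ E.toFunctor).commShiftIso n).hom.app X.X ≫ (𝟙 _)⟦n⟧' =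
        𝟙 _ ≫ E.toFunctor.map ((E'.toFunctor.commShiftIso n).hom.app X.X) ≫
          (E.toFunctor.commShiftIso n).hom.app (E'.toFunctor.obj X.X) := by
        simp [Functor.commShiftIso_comp_hom_app]
      refine EquivariantObject.hom_ext (h.trans (congrArg (fun t => 𝟙 _ ≫ t) ?_))
      exact congrArg EquivariantObject.Hom.f (Functor.commShiftIso_comp_hom_app
        (equivariantFunctor E'.toEquivariantEndofunctor)
        (equivariantFunctor E.toEquivariantEndofunctor) n X).symm
    · have h : 𝟙 (E.toFunctor.obj (E'.toFunctor.obj X.X)) ≫ 𝟙 _ =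
          𝟙 (E.toFunctor.obj (E'.toFunctor.obj X.X)) ≫ 𝟙 _ ≫ E.toFunctor.map (𝟙 _) ≫
            𝟙 _ ≫ 𝟙 (E.toFunctor.obj (E'.toFunctor.obj X.X)) ≫ 𝟙 _ := by simp
      exact EquivariantObject.hom_ext h

end Linear

end Dual

/-! ### Tilting objects -/

section Tilting

attribute [local instance] hasBinaryBiproducts_of_finite_biproducts

variable {C : Type u} [Category.{v} C] [Preadditive C] [HasShift C ℤ] [HasExactTriangles C]

/-- The objects of a thick triangulated subcategory: closed under all shifts, cones and direct
summands (in particular under isomorphisms). -/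
structure IsThick (P : ObjectProperty C) : Prop where
  shift : ∀ (X : C) (n : ℤ), P X → P (X⟦n⟧)
  cone : ∀ Δ ∈ HasExactTriangles.exact (C := C), P Δ.obj₁ → P Δ.obj₂ → P Δ.obj₃
  retract : ∀ X Y : C, Nonempty (Retract X Y) → P Y → P X

/-- The smallest thick triangulated subcategory containing `M`. -/
def thickClosure (M : C) : ObjectProperty C := fun X =>
  ∀ P : ObjectProperty C, IsThick P → P M → P X

/-- Tilting objects. -/
structure IsTilting (M : C) : Prop where
  hom_shift : ∀ i : ℤ, i ≠ 0 → ∀ f : M ⟶ M⟦i⟧, f = 0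
  generates : ∀ X : C, thickClosure M X

variable [HasFiniteBiproducts C]

/-- The full subcategory `add M` of direct summands of finite direct sums of copies of `M`. -/
def addClosure (M : C) : ObjectProperty C := fun X =>
  ∃ n : ℕ, Nonempty (Retract X (⨁ fun _ : Fin n => M))

/-- An object is basic if no indecomposable direct summand occurs with multiplicity two. -/
def IsBasic (M : C) : Prop :=
  ∀ X : C, Indecomposable X → IsEmpty (Retract (X ⊞ X) M)

end Tilting

section StableTilting

attribute [local instance] hasBinaryBiproducts_of_finite_biproducts

variable {k : Type w} [Field k] {G : Type*} [Group G] {C : Type u} [Category.{v} C]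
  [Preadditive C] [Linear k C] [HasShift C ℤ] [HasExactTriangles C] {A : TriangleAction k G C}

lemma isTilting_obj (E : EquivariantAutoequivalence A) {M : C} (h : IsTilting M) :
    IsTilting (E.toFunctor.obj M) where
  hom_shift i hi f := by
    obtain ⟨f', hf'⟩ := E.toFunctor.map_surjective
      (f ≫ (E.toFunctor.commShiftIso i).inv.app M)
    rw [h.hom_shift i hi f', Functor.map_zero] at hf'
    rw [← cancel_mono ((E.toFunctor.commShiftIso i).inv.app M), ← hf', zero_comp]
  generates Y P hP hM := by
    have hPiso : ∀ {X Y : C}, (X ≅ Y) → P Y → P X := fun e =>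
      hP.retract _ _ ⟨Retract.ofIso e⟩
    have hQ : IsThick (fun X => P (E.toFunctor.obj X)) :=
      { shift := fun X n hX => hPiso ((E.toFunctor.commShiftIso n).app X) (hP.shift _ n hX)
        cone := fun Δ hΔ h₁ h₂ => hP.cone _ (E.map_exact Δ hΔ) h₁ h₂
        retract := fun X Y ⟨r⟩ hY => hP.retract _ _ ⟨r.map E.toFunctor⟩ hY }
    exact hPiso (E.toFunctor.objObjPreimageIso Y).symm
      (h.generates (E.toFunctor.objPreimage Y) _ hQ hM)

lemma isStable_obj (E : EquivariantAutoequivalence A) {M : C} (h : A.IsStable M) :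
    A.IsStable (E.toFunctor.obj M) := fun g => by
  obtain ⟨e⟩ := h g
  exact ⟨E.toFunctor.mapIso e ≪≫ (E.δ g).app M⟩

variable [HasFiniteBiproducts C]

lemma isBasic_obj (E : EquivariantAutoequivalence A) {M : C} (h : IsBasic M) :
    IsBasic (E.toFunctor.obj M) := by
  intro Y hY
  refine ⟨fun r => ?_⟩
  have := preservesBinaryBiproducts_of_preservesBiproducts E.toFunctor
  have hz : ∀ B : C, IsZero (E.toFunctor.obj B) → IsZero B := fun B hB => by
    rw [IsZero.iff_id_eq_zero] at hB ⊢
    apply E.toFunctor.map_injective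
    rw [CategoryTheory.Functor.map_id, Functor.map_zero, hB]
  let X := E.toFunctor.objPreimage Y
  let θ : E.toFunctor.obj X ≅ Y := E.toFunctor.objObjPreimageIso Y
  have hX : Indecomposable X := by
    refine ⟨fun h0 => hY.1 ((E.toFunctor.map_isZero h0).of_iso θ.symm), fun B B' e => ?_⟩
    exact (hY.2 (E.toFunctor.obj B) (E.toFunctor.obj B')
      (θ.symm ≪≫ E.toFunctor.mapIso e ≪≫ E.toFunctor.mapBiprod B B')).imp (hz B) (hz B')
  have r' : Retract (E.toFunctor.obj (X ⊞ X)) (E.toFunctor.obj M) :=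
    (Retract.ofIso (E.toFunctor.mapBiprod X X ≪≫ biprod.mapIso θ θ)).trans r
  exact (h X hX).false
    { i := E.toFunctor.preimage r'.i
      r := E.toFunctor.preimage r'.r
      retract := E.toFunctor.map_injective (by simp) }

/-- Basic stable tilting objects. -/
def StableTilting (A : TriangleAction k G C) : Type _ :=
  {M : C // IsTilting M ∧ IsBasic M ∧ A.IsStable M}

instance tiltSetoid (A : TriangleAction k G C) : Setoid (StableTilting A) where
  r M N := Nonempty (M.1 ≅ N.1)
  iseqv := ⟨fun _ => ⟨Iso.refl _⟩, fun ⟨e⟩ => ⟨e.symm⟩, fun ⟨e⟩ ⟨e'⟩ => ⟨e ≪≫ e'⟩⟩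

/-- The set of isomorphism classes of basic stable tilting objects. -/
def TiltSet (A : TriangleAction k G C) : Type _ := Quotient (tiltSetoid A)

/-- The action `[F, δ] • M = F M`. -/
instance (A : TriangleAction k G C) : MulAction (TriangleAut A) (TiltSet A) where
  smul := Quotient.map₂ (fun E M => ⟨E.toFunctor.obj M.1, isTilting_obj E M.2.1,
      isBasic_obj E M.2.2.1, isStable_obj E M.2.2.2⟩)
    (fun _ _ ⟨φ, _⟩ _ _ ⟨e⟩ => ⟨φ.app _ ≪≫ Functor.mapIso _ e⟩)
  one_smul := by
    rintro ⟨M⟩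
    rfl
  mul_smul := by
    rintro ⟨E⟩ ⟨E'⟩ ⟨M⟩
    rfl

/-- The set of orbits of `TiltSet A` under the equivariant triangle autoequivalences. -/
def TiltOrbits (A : TriangleAction k G C) : Type _ :=
  Quot fun t t' : TiltSet A => ∃ a : TriangleAut A, a • t = t'

end StableTilting

/-- A finite group splits over `k` if its group algebra is isomorphic to a product of copies
of `k`. -/
def SplitsOver (k : Type w) [Field k] (G : Type*) [Group G] : Prop :=
  ∃ n : ℕ, Nonempty (MonoidAlgebra k G ≃ₐ[k] (Fin n → k))

end
end EquivariantTilting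

open EquivariantTilting

/-! Everything rests on a weight decomposition. For equivariant objects `X`, `Y` the group acts on
the morphisms between the underlying objects by conjugation (`conj`). Since `kG` is a product of
copies of `k`, the order of `G` is invertible in `k`, there are as many characters as group
elements, and the orthogonality relations hold. So every morphism `f : X.X ⟶ Y.X` is the sum of its
weight components (`sum_component`), and the component of weight `χ` is the same thing as an
equivariant morphism `X ⟶ F_χ Y`. The full subcategory of `T` on underlying objects of equivariant
objects is therefore encoded in `T^G` with its dual action. Moreover every object of `T` is a
retract of such an underlying object, namely of that of `Ind X` (`retractInd`).

Equivariantization is bijective for this reason, and the double equivariantization is never formed.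
Injectivity: an isomorphism between `E^G` and `E'^G` compatible with the dual action is natural for
morphisms of every weight, hence for all morphisms between underlying objects, and it extends along
retracts to `T`. Surjectivity: an equivariant endofunctor `H` of `T^G` acts on a morphism of weight
`χ` by applying `H` and then `H F_χ ≅ F_χ H`. Summing over weights gives a functor on underlying
objects (`mapU`), which extends to `T` by splitting idempotents (`descend`). The connecting
isomorphisms and the compatibility with `G` extend likewise. The extension is exact because each
triangle of `T` is a retract of the underlying triangle of its induced triangle, and retracts of
distinguished triangles are distinguished (`distinguished_of_retract`, which does not use the
octahedral axiom). Finally, `E` is an equivalence as soon as `E^G` is one.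

Quasi-inverses make the automorphism classes of `T` a group. Those of `T^G` are then units because
they come from `T`; no pretriangulated structure on `T^G` is needed.

For tilting objects, Hom-finiteness and split idempotents make endomorphism rings of indecomposables
local, so a basic object is determined by its additive closure (`IsBasic.iso_of_addClosure`) and
every object has a basic version with the same closure (`exists_isBasic`). Induction and the
forgetful functor take stable tilting objects to stable tilting objects, and up to additive closure
they are inverse to each other: `(Ind M).X` is a sum of copies of a stable `M`, and `Ind N.X` is a
summand of the sum of all `F_χ N`. The bijection pairs `M` with `N` when `M` and `N.X` have the same
additive closure (`Corresponds`). Since `E^G N` has underlying object `E N.X`, this relation is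
visibly compatible with the group actions. -/

set_option linter.unusedSectionVars false

namespace EquivariantTilting

/-! ### Additive closures -/

section AddClosure

variable {C : Type*} [Category C] [Preadditive C] [HasFiniteBiproducts C]

/-- With its converse below, this replaces biproducts of copies of `M` by factorizations of an
identity through `M`, indexed by any finite type. Transitivity and functoriality of additive
closures then become manipulations of sums. -/
lemma addClosure_of_sum {M X : C} {J : Type*} [Fintype J] (a : J → (X ⟶ M)) (b : J → (M ⟶ X))
    (h : ∑ j, a j ≫ b j = 𝟙 X) : addClosure M X := by
  let e := Fintype.equivFin J
  refine ⟨Fintype.card J, ⟨⟨biproduct.lift fun j => a (e.symm j),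
    biproduct.desc fun j => b (e.symm j), ?_⟩⟩⟩
  rw [biproduct.lift_desc, ← h]
  exact Equiv.sum_comp e.symm (fun j => a j ≫ b j)

lemma exists_sum_of_addClosure {M X : C} (h : addClosure M X) :
    ∃ (n : ℕ) (a : Fin n → (X ⟶ M)) (b : Fin n → (M ⟶ X)), ∑ j, a j ≫ b j = 𝟙 X := by
  obtain ⟨n, ⟨r⟩⟩ := h
  refine ⟨n, fun j => r.i ≫ biproduct.π _ j, fun j => biproduct.ι (fun _ : Fin n => M) j ≫ r.r, ?_⟩
  have h := biproduct.total (f := fun _ : Fin n => M)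
  calc _ = r.i ≫ (∑ j, biproduct.π _ j ≫ biproduct.ι (fun _ : Fin n => M) j) ≫ r.r := by
        simp only [Preadditive.comp_sum, Preadditive.sum_comp, Category.assoc]
    _ = 𝟙 X := by rw [h, Category.id_comp, r.retract]

lemma addClosure_self (M : C) : addClosure M M :=
  addClosure_of_sum (J := Unit) (fun _ => 𝟙 M) (fun _ => 𝟙 M) (by simp)

lemma addClosure_trans {M N X : C} (h : addClosure N X) (h' : addClosure M N) :
    addClosure M X := by
  obtain ⟨n, a, b, e⟩ := exists_sum_of_addClosure h
  obtain ⟨m, a', b', e'⟩ := exists_sum_of_addClosure h'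
  refine addClosure_of_sum (J := Fin n × Fin m) (fun p => a p.1 ≫ a' p.2)
    (fun p => b' p.2 ≫ b p.1) ?_
  rw [Fintype.sum_prod_type]
  calc _ = ∑ j, a j ≫ (∑ l, a' l ≫ b' l) ≫ b j := by
        simp [Preadditive.comp_sum, Preadditive.sum_comp]
    _ = 𝟙 X := by simp [e', e]

lemma addClosure_eq {M N : C} (h : addClosure N M) (h' : addClosure M N) :
    addClosure M = addClosure N := by
  ext X
  exact ⟨fun hX => addClosure_trans hX h, fun hX => addClosure_trans hX h'⟩

lemma addClosure_of_retract {M X : C} (r : Retract X M) : addClosure M X :=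
  addClosure_of_sum (J := Unit) (fun _ => r.i) (fun _ => r.r) (by simp)

lemma addClosure_biproduct {M : C} {J : Type*} [Finite J] {Q : J → C}
    (h : ∀ j, addClosure M (Q j)) : addClosure M (⨁ Q) := by
  have := Fintype.ofFinite J
  choose n a b e using fun j => exists_sum_of_addClosure (h j)
  refine addClosure_of_sum (J := Σ j, Fin (n j)) (fun p => biproduct.π Q p.1 ≫ a p.1 p.2)
    (fun p => b p.1 p.2 ≫ biproduct.ι Q p.1) ?_
  rw [Fintype.sum_sigma]
  calc _ = ∑ j, biproduct.π Q j ≫ (∑ l, a j l ≫ b j l) ≫ biproduct.ι Q j := by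
        simp [Preadditive.comp_sum, Preadditive.sum_comp]
    _ = 𝟙 _ := by
        simp only [e, Category.id_comp]
        apply biproduct.hom_ext'
        intro i
        rw [Preadditive.comp_sum, Finset.sum_eq_single i (fun j _ h => by
          rw [biproduct.ι_π_ne_assoc _ h.symm, zero_comp]) (by simp)]
        simp

lemma addClosure_map {D : Type*} [Category D] [Preadditive D] [HasFiniteBiproducts D]
    (F : C ⥤ D) [F.Additive] {M X : C} (h : addClosure M X) :
    addClosure (F.obj M) (F.obj X) := by
  obtain ⟨n, a, b, e⟩ := exists_sum_of_addClosure h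
  refine addClosure_of_sum (fun j => F.map (a j)) (fun j => F.map (b j)) ?_
  simp only [← F.map_comp]
  rw [← F.map_sum, e, F.map_id]

end AddClosure

/-! ### Krull–Schmidt theory in a Hom-finite category with split idempotents -/

section KrullSchmidt

/-- Fitting's argument: the coprime factors `X ^ n` and `q` of the minimal polynomial of `f` yield
an idempotent that is a polynomial in `f`; if it is `0`, then `f` is nilpotent, and if it is `1`,
then `f` is invertible. -/
lemma isUnit_or_isNilpotent_of_idem {k R : Type*} [Field k] [Ring R] [Algebra k R]
    [FiniteDimensional k R] (hR : ∀ e : R, e * e = e → e = 0 ∨ e = 1) (f : R) :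
    IsUnit f ∨ IsNilpotent f := by
  have hint : IsIntegral k f := Algebra.IsIntegral.isIntegral f
  have h0 := minpoly.ne_zero hint
  obtain ⟨q, hq, hdvd⟩ := Polynomial.exists_eq_pow_rootMultiplicity_mul_and_not_dvd _ h0 0
  rw [Polynomial.C_0, sub_zero] at hq hdvd
  set n := Polynomial.rootMultiplicity 0 (minpoly k f)
  -- The exponent `n + 1` instead of `n` leaves a factor `X` to spare even when `n = 0`: if `a * X ^
  -- (n + 1)` evaluates to `1`, then `a * X ^ n` evaluates to an inverse of `f`.
  have hcop : IsCoprime (Polynomial.X ^ (n + 1) : Polynomial k) q :=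
    ((Polynomial.irreducible_X.coprime_iff_not_dvd).2 hdvd).pow_left
  obtain ⟨a, b, hab⟩ := hcop
  have hz (p : Polynomial k) : Polynomial.aeval f (Polynomial.X ^ n * q * p) = 0 := by
    rw [map_mul, ← hq, minpoly.aeval, zero_mul]
  obtain ⟨e, hedef⟩ : ∃ e : R, e = Polynomial.aeval f (a * Polynomial.X ^ (n + 1)) := ⟨_, rfl⟩
  have he : e * e = e := by
    have : a * Polynomial.X ^ (n + 1) * (a * Polynomial.X ^ (n + 1)) =
        a * Polynomial.X ^ (n + 1) - Polynomial.X ^ n * q * (a * b * Polynomial.X) := by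
      linear_combination (a * Polynomial.X ^ (n + 1)) * hab
    rw [hedef, ← map_mul, this, map_sub, hz, sub_zero]
  rcases hR e he with h | h
  · right
    refine ⟨n, ?_⟩
    have : (Polynomial.X ^ n : Polynomial k) =
        Polynomial.X ^ n * (a * Polynomial.X ^ (n + 1)) + Polynomial.X ^ n * q * b := by
      linear_combination (-Polynomial.X ^ n) * hab
    calc f ^ n = Polynomial.aeval f (Polynomial.X ^ n : Polynomial k) := by simp
      _ = 0 := by rw [this, map_add, hz, map_mul, ← hedef, h, mul_zero, add_zero]
  · left
    have h1 : f * Polynomial.aeval f (a * Polynomial.X ^ n) = 1 := by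
      rw [← h, hedef, show a * Polynomial.X ^ (n + 1) =
        Polynomial.X * (a * Polynomial.X ^ n) by ring, map_mul _ Polynomial.X, Polynomial.aeval_X]
    have h2 : Polynomial.aeval f (a * Polynomial.X ^ n) * f = 1 := by
      rw [← h, hedef, show a * Polynomial.X ^ (n + 1) =
        (a * Polynomial.X ^ n) * Polynomial.X by ring, map_mul _ _ Polynomial.X,
        Polynomial.aeval_X]
    exact ⟨⟨f, _, h1, h2⟩, rfl⟩

attribute [local instance] hasBinaryBiproducts_of_finite_biproducts

variable {k : Type*} [Field k] {C : Type*} [Category C] [Preadditive C] [HasFiniteBiproducts C]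

section

variable [IsIdempotentComplete C]

lemma exists_iso_biprod_of_idem {X : C} (p : X ⟶ X) (hp : p ≫ p = p) :
    ∃ (Y Z : C) (e : X ≅ Y ⊞ Z), p = e.hom ≫ biprod.fst ≫ biprod.inl ≫ e.inv := by
  obtain ⟨Y, i, r, h, h'⟩ := IsIdempotentComplete.idempotents_split X p hp
  obtain ⟨Z, j, s, l, l'⟩ := IsIdempotentComplete.idempotents_split X (𝟙 X - p) (by simp [hp])
  have his : i ≫ s = 0 := by
    have h0 : i ≫ s ≫ j = 0 := by
      rw [l', Preadditive.comp_sub, ← h', reassoc_of% h, Category.comp_id, sub_self]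
    rw [← Category.comp_id s, ← l, reassoc_of% h0, zero_comp]
  have hjr : j ≫ r = 0 := by
    have h0 : j ≫ r ≫ i = 0 := by
      rw [h', show p = 𝟙 X - (𝟙 X - p) by abel, Preadditive.comp_sub, ← l', reassoc_of% l,
        Category.comp_id, sub_self]
    rw [← Category.comp_id r, ← h, reassoc_of% h0, zero_comp]
  refine ⟨Y, Z, ⟨biprod.lift r s, biprod.desc i j, ?_, ?_⟩, ?_⟩
  · rw [biprod.lift_desc, h', l']; simp
  · ext <;> simp [h, l, his, hjr]
  · simp [h']

lemma exists_complement {X Z : C} (r : Retract X Z) : ∃ Y : C, Nonempty (Z ≅ X ⊞ Y) := by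
  obtain ⟨X', Y, e, he⟩ := exists_iso_biprod_of_idem (r.r ≫ r.i) (by simp)
  refine ⟨Y, ⟨e ≪≫ biprod.mapIso ⟨biprod.inl ≫ e.inv ≫ r.r, r.i ≫ e.hom ≫ biprod.fst, ?_, ?_⟩
    (Iso.refl Y)⟩⟩
  · simp only [Category.assoc]
    rw [reassoc_of% he]
    simp
  · have : r.i ≫ e.hom ≫ biprod.fst ≫ biprod.inl ≫ e.inv ≫ r.r = r.i ≫ (r.r ≫ r.i) ≫ r.r := by
      rw [he]; simp
    simpa using this

lemma eq_zero_or_eq_id_of_indecomposable {X : C} (hX : Indecomposable X) (p : X ⟶ X)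
    (hp : p ≫ p = p) : p = 0 ∨ p = 𝟙 X := by
  obtain ⟨Y, Z, e, he⟩ := exists_iso_biprod_of_idem p hp
  rcases hX.2 Y Z e with h | h
  · left
    rw [he, h.eq_of_tgt biprod.fst 0, zero_comp, comp_zero]
  · right
    have h1 : (biprod.fst ≫ biprod.inl : Y ⊞ Z ⟶ Y ⊞ Z) = 𝟙 _ := by
      rw [← biprod.total, h.eq_of_tgt biprod.snd 0]; simp
    rw [he, reassoc_of% h1]; simp

variable [Linear k C]

variable (k) in
lemma isUnit_or_isNilpotent (X : C) (hfin : FiniteDimensional k (X ⟶ X))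
    (hX : Indecomposable X) (f : End X) : IsUnit f ∨ IsNilpotent f := by
  have : FiniteDimensional k (End X) := hfin
  exact isUnit_or_isNilpotent_of_idem (k := k) (R := End X)
    (fun e he => eq_zero_or_eq_id_of_indecomposable hX e he) f

variable (k) in
-- Locality of the endomorphism ring: after normalizing the sum to the identity, each summand is
-- invertible or nilpotent, and in the nilpotent case the remaining sum is `1` minus a nilpotent,
-- hence invertible.
lemma exists_isIso_of_sum_isIso (X : C) (hfin : FiniteDimensional k (X ⟶ X))
    (hX : Indecomposable X) {J : Type*} (s : Finset J) (f : J → (X ⟶ X))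
    (h : IsIso (∑ j ∈ s, f j)) : ∃ j ∈ s, IsIso (f j) := by
  classical
  induction s using Finset.induction_on with
  | empty =>
    exfalso
    apply hX.1
    rw [Finset.sum_empty] at h
    rw [IsZero.iff_id_eq_zero, ← IsIso.hom_inv_id (0 : X ⟶ X), zero_comp]
  | insert i s hi ih =>
    rw [Finset.sum_insert hi] at h
    set u := f i + ∑ j ∈ s, f j with hu
    have h1 : inv u ≫ f i + inv u ≫ ∑ j ∈ s, f j = 𝟙 X := by
      rw [← Preadditive.comp_add, ← hu, IsIso.inv_hom_id]
    have key (g : X ⟶ X) (hg : IsUnit (show End X from inv u ≫ g)) : IsIso g := by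
      have : IsIso (inv u ≫ g) := (isUnit_iff_isIso _).1 hg
      exact IsIso.of_isIso_comp_left (inv u) g
    rcases isUnit_or_isNilpotent k X hfin hX (inv u ≫ f i) with h2 | h2
    · exact ⟨i, by simp, key _ h2⟩
    · have h3 : IsUnit (show End X from inv u ≫ ∑ j ∈ s, f j) := by
        have h4 : (inv u ≫ ∑ j ∈ s, f j) = 𝟙 X - inv u ≫ f i := by rw [← h1]; abel
        rw [h4]
        exact IsNilpotent.isUnit_one_sub h2
      obtain ⟨j, hj, hj'⟩ := ih (key _ h3)
      exact ⟨j, by simp [hj], hj'⟩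

variable (k) in
lemma exists_retract_of_sum {X : C} (hfin : FiniteDimensional k (X ⟶ X))
    (hX : Indecomposable X) {J : Type*} [Fintype J] (M : J → C) (a : ∀ j, X ⟶ M j)
    (b : ∀ j, M j ⟶ X) (h : ∑ j, a j ≫ b j = 𝟙 X) : ∃ j, Nonempty (Retract X (M j)) := by
  obtain ⟨j, -, hj⟩ := exists_isIso_of_sum_isIso k X hfin hX Finset.univ (fun j => a j ≫ b j)
    (by rw [h]; infer_instance)
  exact ⟨j, ⟨⟨a j, b j ≫ inv (a j ≫ b j), by rw [← Category.assoc, IsIso.hom_inv_id]⟩⟩⟩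

/-- The composite `M ⟶ N ⟶ M` has a one-sided inverse in the finite-dimensional algebra `End M`,
where one-sided inverses are two-sided. -/
lemma iso_of_retracts {M N : C} (hM : FiniteDimensional k (M ⟶ M)) (r : Retract M N)
    (s : Retract N M) : Nonempty (M ≅ N) := by
  have : FiniteDimensional k (End M) := hM
  have : IsNoetherianRing (End M) := IsNoetherianRing.of_finite k _
  have h1 : (r.i ≫ s.i) ≫ (s.r ≫ r.r) = 𝟙 M := by simp
  have h2 : (s.r ≫ r.r) ≫ (r.i ≫ s.i) = 𝟙 M :=
    mul_eq_one_symm (M := End M) (a := s.r ≫ r.r) (b := r.i ≫ s.i) h1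
  have h3 : s.r ≫ r.r ≫ r.i = s.r := by
    have := congrArg (fun t => t ≫ s.r) h2
    simpa using this
  refine ⟨⟨r.i, r.r, r.retract, ?_⟩⟩
  rw [← Category.id_comp (r.r ≫ r.i), ← s.retract, Category.assoc, h3]

lemma finrank_end_biprod (hC : ∀ X Y : C, FiniteDimensional k (X ⟶ Y)) (X Y : C) :
    Module.finrank k (X ⟶ X) + Module.finrank k (Y ⟶ Y) ≤
      Module.finrank k (X ⊞ Y ⟶ X ⊞ Y) := by
  have := hC X X
  have := hC Y Y
  have := hC (X ⊞ Y) (X ⊞ Y)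
  rw [← Module.finrank_prod]
  let φ : ((X ⟶ X) × (Y ⟶ Y)) →ₗ[k] (X ⊞ Y ⟶ X ⊞ Y) :=
    { toFun := fun p => biprod.map p.1 p.2
      map_add' := fun p q => by ext <;> simp
      map_smul' := fun c p => by ext <;> simp }
  refine LinearMap.finrank_le_finrank_of_injective (f := φ) fun p q h => ?_
  have h : biprod.map p.1 p.2 = biprod.map q.1 q.2 := h
  ext
  · simpa using congrArg (fun t => biprod.inl ≫ t ≫ biprod.fst) h
  · simpa using congrArg (fun t => biprod.inr ≫ t ≫ biprod.snd) h

lemma finrank_end_congr {X Y : C} (e : X ≅ Y) :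
    Module.finrank k (X ⟶ X) = Module.finrank k (Y ⟶ Y) :=
  LinearEquiv.finrank_eq
    { toFun := fun f => e.inv ≫ f ≫ e.hom
      invFun := fun f => e.hom ≫ f ≫ e.inv
      left_inv := fun f => by simp
      right_inv := fun f => by simp
      map_add' := fun f g => by simp
      map_smul' := fun c f => by simp }

lemma finrank_end_pos (hC : ∀ X Y : C, FiniteDimensional k (X ⟶ Y)) {X : C} (h : ¬ IsZero X) :
    0 < Module.finrank k (X ⟶ X) := by
  have := hC X X
  have : Nontrivial (X ⟶ X) := ⟨𝟙 X, 0, fun e => h ((IsZero.iff_id_eq_zero X).2 e)⟩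
  exact Module.finrank_pos

lemma finrank_end_lt (hC : ∀ X Y : C, FiniteDimensional k (X ⟶ Y)) {X Y Z : C}
    (e : Z ≅ X ⊞ Y) (hX : ¬ IsZero X) :
    Module.finrank k (Y ⟶ Y) < Module.finrank k (Z ⟶ Z) := by
  have h1 := finrank_end_biprod hC X Y
  have h2 := finrank_end_congr (k := k) e
  have h3 := finrank_end_pos hC hX
  omega

variable (k) in
lemma retract_or_retract_of_biprod {X A B : C} (hfin : FiniteDimensional k (X ⟶ X))
    (hX : Indecomposable X) (r : Retract X (A ⊞ B)) :
    Nonempty (Retract X A) ∨ Nonempty (Retract X B) := by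
  have h := exists_retract_of_sum k hfin hX (fun b : Bool => cond b A B)
    (fun b => Bool.rec (r.i ≫ biprod.snd) (r.i ≫ biprod.fst) b)
    (fun b => Bool.rec (biprod.inr ≫ r.r) (biprod.inl ≫ r.r) b) (by
      have h : r.i ≫ (biprod.fst ≫ biprod.inl + biprod.snd ≫ biprod.inr) ≫ r.r = 𝟙 X := by
        rw [biprod.total, Category.id_comp, r.retract]
      rw [Fintype.sum_bool]
      simp only [Preadditive.comp_add, Preadditive.add_comp, Category.assoc] at h ⊢
      exact h)
  obtain ⟨b, hb⟩ := h
  cases b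
  · exact Or.inr hb
  · exact Or.inl hb

variable (k) in
lemma retract_of_addClosure {X M : C} (hfin : FiniteDimensional k (X ⟶ X))
    (hX : Indecomposable X) (h : addClosure M X) : Nonempty (Retract X M) := by
  obtain ⟨n, a, b, e⟩ := exists_sum_of_addClosure h
  obtain ⟨-, h⟩ := exists_retract_of_sum k hfin hX (fun _ => M) a b e
  exact h

lemma exists_indecomposable_retract (hC : ∀ X Y : C, FiniteDimensional k (X ⟶ Y)) (Z : C)
    (hZ : ¬ IsZero Z) : ∃ X : C, Indecomposable X ∧ Nonempty (Retract X Z) := by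
  induction h : Module.finrank k (Z ⟶ Z) using Nat.strong_induction_on generalizing Z with
  | _ n ih =>
    by_cases hI : Indecomposable Z
    · exact ⟨Z, hI, ⟨Retract.refl Z⟩⟩
    · simp only [Indecomposable, not_and, not_forall, not_or] at hI
      obtain ⟨A, B, e, hA, hB⟩ := hI hZ
      obtain ⟨X, hX, ⟨r⟩⟩ := ih _ (h ▸ finrank_end_lt hC e hA) B hB rfl
      exact ⟨X, hX, ⟨(r.trans ⟨biprod.inr, biprod.snd, by simp⟩).trans (Retract.ofIso e.symm)⟩⟩

lemma IsBasic.of_retract {M N : C} (h : IsBasic M) (r : Retract N M) : IsBasic N :=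
  fun X hX => ⟨fun s => (h X hX).false (s.trans r)⟩

lemma isIso_of_retract_of_indecomposable {X Y : C} (hX : Indecomposable X)
    (hY : ¬ IsZero Y) (r : Retract Y X) : Nonempty (Y ≅ X) := by
  rcases eq_zero_or_eq_id_of_indecomposable hX (r.r ≫ r.i) (by simp) with h | h
  · exfalso
    apply hY
    have h1 : (r.i ≫ r.r) ≫ r.i ≫ r.r = 𝟙 Y := by simp
    rw [IsZero.iff_id_eq_zero, ← h1, Category.assoc, reassoc_of% h, zero_comp, comp_zero]
  · exact ⟨⟨r.i, r.r, r.retract, h⟩⟩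

/-- Induction on `dim End M`: an indecomposable summand `X` of `M` is split off from both `M` and
`N`. Because `M` is basic, the summands of the complement `M'` differ from `X`, so they must occur
in the complement of `X` in `N`. -/
lemma IsBasic.retract (hC : ∀ X Y : C, FiniteDimensional k (X ⟶ Y)) {M N : C} (hM : IsBasic M)
    (h : ∀ X, Indecomposable X → Nonempty (Retract X M) → Nonempty (Retract X N)) :
    Nonempty (Retract M N) := by
  induction hn : Module.finrank k (M ⟶ M) using Nat.strong_induction_on generalizing M N with
  | _ n ih =>
    by_cases h0 : IsZero M
    · exact ⟨⟨0, 0, h0.eq_of_src _ _⟩⟩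
    obtain ⟨X, hX, ⟨r⟩⟩ := exists_indecomposable_retract hC M h0
    obtain ⟨s⟩ := h X hX ⟨r⟩
    obtain ⟨M', ⟨e⟩⟩ := exists_complement r
    obtain ⟨N', ⟨e'⟩⟩ := exists_complement s
    have rM : Retract M' M :=
      (⟨biprod.inr, biprod.snd, by simp⟩ : Retract M' (X ⊞ M')).trans (Retract.ofIso e.symm)
    obtain ⟨t⟩ := ih _ (hn ▸ finrank_end_lt hC e hX.1) (hM.of_retract rM) (N := N')
      (fun Y hY ⟨q⟩ => by
        obtain ⟨q'⟩ := h Y hY ⟨q.trans rM⟩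
        refine (retract_or_retract_of_biprod k (hC _ _) hY
          (q'.trans (Retract.ofIso e'))).resolve_left ?_
        rintro ⟨p⟩
        obtain ⟨f⟩ := isIso_of_retract_of_indecomposable hX hY.1 p
        -- If `Y` were isomorphic to the removed `X`, then `X ⊞ X` would be a summand of `X ⊞ M' ≅
        -- M`.
        exact (hM X hX).false ((⟨biprod.map (𝟙 X) (f.inv ≫ q.i), biprod.map (𝟙 X) (q.r ≫ f.hom),
          by ext <;> simp⟩ : Retract (X ⊞ X) (X ⊞ M')).trans (Retract.ofIso e.symm))) rfl
    exact ⟨((Retract.ofIso e).trans ⟨biprod.map (𝟙 X) t.i, biprod.map (𝟙 X) t.r,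
      by ext <;> simp⟩).trans (Retract.ofIso e'.symm)⟩

/-- A basic object is determined up to isomorphism by its additive closure. -/
lemma IsBasic.iso_of_addClosure (hC : ∀ X Y : C, FiniteDimensional k (X ⟶ Y)) {M N : C}
    (hM : IsBasic M) (hN : IsBasic N) (h : addClosure M N) (h' : addClosure N M) :
    Nonempty (M ≅ N) := by
  obtain ⟨r⟩ := hM.retract hC (N := N) fun X hX ⟨r⟩ =>
    retract_of_addClosure k (hC _ _) hX (addClosure_trans (addClosure_of_retract r) h')
  obtain ⟨s⟩ := hN.retract hC (N := M) fun X hX ⟨r⟩ =>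
    retract_of_addClosure k (hC _ _) hX (addClosure_trans (addClosure_of_retract r) h)
  exact iso_of_retracts (hC _ _) r s

/-- A repeated summand can be dropped: `X ⊞ X ⊞ W` and `X ⊞ W` have the same additive closure. The
process stops because `dim End` decreases. -/
lemma exists_isBasic (hC : ∀ X Y : C, FiniteDimensional k (X ⟶ Y)) (Z : C) :
    ∃ N : C, IsBasic N ∧ addClosure Z N ∧ addClosure N Z := by
  induction hn : Module.finrank k (Z ⟶ Z) using Nat.strong_induction_on generalizing Z with
  | _ n ih =>
    by_cases hb : IsBasic Z
    · exact ⟨Z, hb, addClosure_self Z, addClosure_self Z⟩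
    simp only [IsBasic, not_forall, not_isEmpty_iff] at hb
    obtain ⟨X, hX, ⟨r⟩⟩ := hb
    obtain ⟨W, ⟨e₀⟩⟩ := exists_complement r
    let e : Z ≅ X ⊞ (X ⊞ W) := e₀ ≪≫ biprod.associator X X W
    have h1 : addClosure (X ⊞ W) Z := by
      refine addClosure_of_sum (J := Bool)
        (fun b => Bool.rec (e.hom ≫ biprod.snd) (e.hom ≫ biprod.fst ≫ biprod.inl) b)
        (fun b => Bool.rec (biprod.inr ≫ e.inv) (biprod.fst ≫ biprod.inl ≫ e.inv) b) ?_
      have h : e.hom ≫ (biprod.fst ≫ biprod.inl + biprod.snd ≫ biprod.inr) ≫ e.inv = 𝟙 Z := by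
        rw [biprod.total, Category.id_comp, e.hom_inv_id]
      simpa only [Fintype.sum_bool, Preadditive.comp_add, Preadditive.add_comp,
        Category.assoc, biprod.inl_fst_assoc] using h
    have h2 : addClosure Z (X ⊞ W) := addClosure_of_retract
      ((⟨biprod.inr, biprod.snd, by simp⟩ : Retract (X ⊞ W) (X ⊞ (X ⊞ W))).trans
        (Retract.ofIso e.symm))
    obtain ⟨N, hN, h3, h4⟩ := ih _ (hn ▸ finrank_end_lt hC e hX.1) (X ⊞ W) rfl
    exact ⟨N, hN, addClosure_trans h3 h2, addClosure_trans h1 h4⟩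

end

end KrullSchmidt
end EquivariantTilting

namespace EquivariantTilting

/-! ### Characters of a split finite group -/

section Characters

variable {k : Type*} [Field k] {G : Type*} [Group G]

lemma linearIndependent_characters :
    LinearIndependent k (fun χ : G →* kˣ => (fun g => ((χ g : kˣ) : k) : G → k)) := by
  have h := (linearIndependent_monoidHom G k).comp
    (fun χ : G →* kˣ => (Units.coeHom k).comp χ) (fun χ χ' h => by
      ext g
      exact DFunLike.congr_fun h g)
  exact h

lemma finite_characters [Finite G] : Finite (G →* kˣ) :=
  (linearIndependent_characters (k := k) (G := G)).finite

namespace SplitsOver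

/-- The sum `s` of all group elements satisfies `s * s = |G| • s`. If `|G|` vanished in `k`, then
`s` would be a nonzero nilpotent of the group algebra, but a product of fields is reduced. -/
lemma natCard_ne_zero [Finite G] (hG : SplitsOver k G) : (Nat.card G : k) ≠ 0 := by
  classical
  have := Fintype.ofFinite G
  obtain ⟨n, ⟨φ⟩⟩ := hG
  intro h0
  let s : MonoidAlgebra k G := ∑ g : G, MonoidAlgebra.of k G g
  have h1 (g : G) : MonoidAlgebra.of k G g * s = s := by
    simp only [s, Finset.mul_sum, ← map_mul]
    exact Equiv.sum_comp (Equiv.mulLeft g) (fun g => MonoidAlgebra.of k G g)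
  have h2 : s * s = 0 := by
    have : (∑ g : G, MonoidAlgebra.of k G g) * s = (Nat.card G : k) • s := by
      rw [Finset.sum_mul]
      simp only [h1, Finset.sum_const, Finset.card_univ, Nat.card_eq_fintype_card]
      rw [Nat.cast_smul_eq_nsmul]
    rw [h0, zero_smul] at this
    exact this
  have h3 : φ s = 0 := by
    have : φ s * φ s = 0 := by rw [← map_mul, h2, map_zero]
    funext i
    exact mul_self_eq_zero.1 (congrFun this i)
  have h4 : s = 0 := φ.injective (by rw [h3, map_zero])
  have h5 : s.coeff 1 = 1 := by
    simp [s, MonoidAlgebra.of_apply, Finsupp.single_apply]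
  rw [h4] at h5
  exact zero_ne_one h5

/-- The coordinates of `kG ≅ k ^ n`, restricted to `G`, are characters, and together they are
injective on `G`. -/
lemma exists_character_apply_ne_one (hG : SplitsOver k G) {g : G} (hg : g ≠ 1) :
    ∃ χ : G →* kˣ, χ g ≠ 1 := by
  obtain ⟨n, ⟨φ⟩⟩ := hG
  by_contra! h
  apply hg
  apply MonoidAlgebra.of_injective (R := k)
  apply φ.injective
  funext i
  have := h (MonoidHom.toHomUnits (((Pi.evalMonoidHom (fun _ : Fin n => k) i).comp
    (φ : MonoidAlgebra k G →* (Fin n → k))).comp (MonoidAlgebra.of k G)))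
  have h2 := congrArg (fun u : kˣ => (u : k)) this
  simpa [← MonoidAlgebra.one_def] using h2

/-- Linear independence of characters bounds their number by `|G|`; conversely the `n = |G|`
coordinates of `kG ≅ k ^ n` restrict to distinct characters, because `G` generates `kG` as an
algebra. -/
lemma card_characters [Finite G] (hG : SplitsOver k G) : Nat.card (G →* kˣ) = Nat.card G := by
  have := Fintype.ofFinite G
  have := finite_characters (k := k) (G := G)
  have := Fintype.ofFinite (G →* kˣ)
  rw [Nat.card_eq_fintype_card, Nat.card_eq_fintype_card]
  apply le_antisymm
  · have := (linearIndependent_characters (k := k) (G := G)).fintype_card_le_finrank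
    simpa using this
  · obtain ⟨n, ⟨φ⟩⟩ := hG
    have hn : Fintype.card G = n := by
      have h1 := φ.toLinearEquiv.finrank_eq
      have h2 : Module.finrank k (MonoidAlgebra k G) = Fintype.card G :=
        Module.finrank_eq_card_basis (MonoidAlgebra.basis G k)
      rw [h2] at h1
      simpa using h1
    let c (i : Fin n) : G →* kˣ := MonoidHom.toHomUnits
      (((Pi.evalMonoidHom (fun _ : Fin n => k) i).comp
        (φ : MonoidAlgebra k G →* (Fin n → k))).comp (MonoidAlgebra.of k G))
    have hc : Function.Injective c := by
      intro i j hij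
      have h1 : (Pi.evalAlgHom k (fun _ : Fin n => k) i).comp φ.toAlgHom =
          (Pi.evalAlgHom k (fun _ : Fin n => k) j).comp φ.toAlgHom := by
        apply MonoidAlgebra.algHom_ext
        · intro g
          have := congrArg (fun u : kˣ => (u : k)) (DFunLike.congr_fun hij g)
          simpa [c] using this
        · ext
      by_contra hne
      have h2 := DFunLike.congr_fun h1 (φ.symm (Pi.single i 1))
      simp [Ne.symm hne] at h2
    have := Fintype.card_le_of_injective c hc
    simpa [hn] using this

lemma sum_characters_of_ne_one (hG : SplitsOver k G) [Fintype (G →* kˣ)]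
    {g : G} (hg : g ≠ 1) : ∑ χ : G →* kˣ, ((χ g : kˣ) : k) = 0 := by
  obtain ⟨ψ, hψ⟩ := hG.exists_character_apply_ne_one hg
  have h := Equiv.sum_comp (Equiv.mulLeft ψ) (fun χ : G →* kˣ => ((χ g : kˣ) : k))
  simp only [Equiv.coe_mulLeft, MonoidHom.mul_apply, Units.val_mul, ← Finset.mul_sum] at h
  by_contra h0
  exact hψ (Units.ext (mul_right_cancel₀ h0 (by rw [h]; simp)))

lemma sum_characters_one [Finite G] (hG : SplitsOver k G) [Fintype (G →* kˣ)] :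
    ∑ χ : G →* kˣ, ((χ 1 : kˣ) : k) = Nat.card G := by
  simp [← hG.card_characters]

end SplitsOver

lemma sum_apply_character [Fintype G] {χ : G →* kˣ} (hχ : χ ≠ 1) :
    ∑ g : G, ((χ g : kˣ) : k) = 0 := by
  classical
  have h := sum_hom_units ((Units.coeHom k).comp χ)
  rw [if_neg] at h
  · simpa using h
  · intro h1
    apply hχ
    ext g
    exact DFunLike.congr_fun h1 g

end Characters

/-! ### Weight decomposition of morphisms between underlying objects -/

section Averaging

variable {k : Type w} [Field k] {G : Type*} [Group G] {C : Type u} [Category.{v} C]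
  [Preadditive C] [Linear k C] [HasShift C ℤ] [HasExactTriangles C] {A : TriangleAction k G C}

namespace EquivariantObject

variable {X Y Z : EquivariantObject A}

/-- The action of a group element on the morphisms of underlying objects. -/
def conj (X Y : EquivariantObject A) (g : G) (f : X.X ⟶ Y.X) : X.X ⟶ Y.X :=
  (X.α g).hom ≫ (A.fn g).map f ≫ (Y.α g).inv

lemma conj_mul (g h : G) (f : X.X ⟶ Y.X) : conj X Y (g * h) f = conj X Y g (conj X Y h f) := by
  have h1 := (A.ε g h _ rfl).hom.naturality f
  dsimp at h1
  simp only [conj, Functor.map_comp, Category.assoc, X.α_mul g h _ rfl, ← reassoc_of% h1]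
  congr 3
  rw [Iso.comp_inv_eq, Y.α_mul g h _ rfl]
  simp [← Functor.map_comp_assoc]

/-- The action carries no unit datum, so this comes from multiplicativity: `conj X Y 1` is
idempotent by `conj_mul` and injective because `F_1` is faithful. -/
lemma conj_one (f : X.X ⟶ Y.X) : conj X Y 1 f = f := by
  have h := conj_mul (X := X) (Y := Y) 1 1 f
  rw [mul_one] at h
  have hinj : Function.Injective (conj X Y 1) := fun a b hab => by
    simp only [conj, Iso.cancel_iso_hom_left, Iso.cancel_iso_inv_right] at hab
    exact (A.fn 1).map_injective hab
  exact (hinj h).symm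

lemma comm_iff_conj (f : X.X ⟶ Y.X) (g : G) :
    f ≫ (Y.α g).hom = (X.α g).hom ≫ (A.fn g).map f ↔ conj X Y g f = f := by
  rw [conj, ← Category.assoc, Iso.comp_inv_eq]
  exact eq_comm

lemma conj_sum {J : Type*} (s : Finset J) (g : G) (f : J → (X.X ⟶ Y.X)) :
    conj X Y g (∑ j ∈ s, f j) = ∑ j ∈ s, conj X Y g (f j) := by
  simp [conj, Functor.map_sum, Preadditive.comp_sum, Preadditive.sum_comp]

lemma conj_smul (g : G) (c : k) (f : X.X ⟶ Y.X) :
    conj X Y g (c • f) = c • conj X Y g f := by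
  simp [conj]

lemma conj_add (g : G) (f f' : X.X ⟶ Y.X) :
    conj X Y g (f + f') = conj X Y g f + conj X Y g f' := by
  simp [conj]

/-- The underlying morphism of a morphism that is equivariant up to a character. -/
def base (χ : G →* kˣ) (a : X ⟶ (twist A χ).obj Y) : X.X ⟶ Y.X := a.f

lemma base_injective (χ : G →* kˣ) : Function.Injective (base χ (X := X) (Y := Y)) :=
  fun _ _ h => hom_ext h

lemma base_add (χ : G →* kˣ) (a b : X ⟶ (twist A χ).obj Y) :
    base χ (a + b) = base χ a + base χ b := rfl

lemma base_smul (χ : G →* kˣ) (c : k) (a : X ⟶ (twist A χ).obj Y) :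
    base χ (c • a) = c • base χ a := rfl

lemma base_zero (χ : G →* kˣ) : base χ (0 : X ⟶ (twist A χ).obj Y) = 0 := rfl

/-- Identifies equivariant morphisms `X ⟶ F_χ Y` with a weight space of the conjugation action. The
inverse of `g` comes from the convention for `χ ⊗ α`. -/
lemma conj_eq_smul_iff (χ : G →* kˣ) (f : X.X ⟶ Y.X) (g : G) :
    conj X Y g f = ((χ g⁻¹ : kˣ) : k) • f ↔
      f ≫ (((twist A χ).obj Y).α g).hom = (X.α g).hom ≫ (A.fn g).map f := by
  rw [conj, ← Category.assoc, Iso.comp_inv_eq]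
  have h : f ≫ (((twist A χ).obj Y).α g).hom = (((χ g⁻¹ : kˣ) : k) • f) ≫ (Y.α g).hom :=
    (Linear.comp_smul _ _ _ _ _ _).trans (Linear.smul_comp _ _ _ _ _ _).symm
  exact ⟨fun e => h.trans e.symm, fun e => (h.symm.trans e).symm⟩

lemma conj_base (χ : G →* kˣ) (a : X ⟶ (twist A χ).obj Y) (g : G) :
    conj X Y g (base χ a) = ((χ g⁻¹ : kˣ) : k) • base χ a :=
  (conj_eq_smul_iff χ (base χ a) g).2 (a.comm g)

/-- A morphism that is equivariant up to a character. -/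
def mkTwist (χ : G →* kˣ) (f : X.X ⟶ Y.X)
    (h : ∀ g, conj X Y g f = ((χ g⁻¹ : kˣ) : k) • f) : X ⟶ (twist A χ).obj Y where
  f := f
  comm g := (conj_eq_smul_iff χ f g).1 (h g)

variable [Fintype G]

/-- The component of weight `χ` of a morphism of underlying objects. -/
noncomputable def component (χ : G →* kˣ) (f : X.X ⟶ Y.X) : X ⟶ (twist A χ).obj Y :=
  mkTwist χ ((Nat.card G : k)⁻¹ • ∑ g : G, ((χ g : kˣ) : k) • conj X Y g f) fun h => by
    -- Reindexing the average by `g ↦ h * g` turns `conj` by `h * g` into `conj` by `h` of `conj` by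
    -- `g`, and `χ (h⁻¹) * χ (h * g)` into `χ g`.
    rw [conj_smul, conj_sum, smul_comm, Finset.smul_sum (r := ((χ h⁻¹ : kˣ) : k)),
      ← Equiv.sum_comp (Equiv.mulLeft h) fun g => ((χ h⁻¹ : kˣ) : k) • _]
    congr 1
    refine Finset.sum_congr rfl fun g _ => ?_
    rw [Equiv.coe_mulLeft, conj_smul, conj_mul, smul_smul, ← Units.val_mul, ← map_mul,
      inv_mul_cancel_left]

lemma base_component (χ : G →* kˣ) (f : X.X ⟶ Y.X) :
    base χ (component χ f : X ⟶ (twist A χ).obj Y) =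
      (Nat.card G : k)⁻¹ • ∑ g : G, ((χ g : kˣ) : k) • conj X Y g f := rfl

lemma component_add (χ : G →* kˣ) (f f' : X.X ⟶ Y.X) :
    (component χ (f + f') : X ⟶ (twist A χ).obj Y) = component χ f + component χ f' := by
  apply base_injective
  simp only [base_add, base_component, conj_add, smul_add, Finset.sum_add_distrib]

lemma component_smul (χ : G →* kˣ) (c : k) (f : X.X ⟶ Y.X) :
    (component χ (c • f) : X ⟶ (twist A χ).obj Y) = c • component χ f := by
  apply base_injective
  rw [base_smul, base_component, base_component, smul_comm c, Finset.smul_sum (r := c)]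
  congr 1
  refine Finset.sum_congr rfl fun g _ => ?_
  rw [conj_smul, smul_comm]

/-- After exchanging the sums, orthogonality over the characters kills every `g ≠ 1`, and the term
of `g = 1` is `|G| • f`. -/
lemma sum_component (hG : SplitsOver k G) [Fintype (G →* kˣ)] (f : X.X ⟶ Y.X) :
    ∑ χ : G →* kˣ, base χ (component χ f : X ⟶ (twist A χ).obj Y) = f := by
  classical
  simp only [base_component]
  rw [← Finset.smul_sum, Finset.sum_comm]
  simp only [← Finset.sum_smul]
  rw [Finset.sum_eq_single 1 (fun g _ hg => by rw [hG.sum_characters_of_ne_one hg, zero_smul])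
    (by simp), hG.sum_characters_one, conj_one, inv_smul_smul₀ hG.natCard_ne_zero]

lemma component_base (hG : SplitsOver k G) (χ : G →* kˣ) (a : X ⟶ (twist A χ).obj Y) :
    (component χ (base χ a) : X ⟶ (twist A χ).obj Y) = a := by
  apply base_injective
  rw [base_component]
  have : ∀ g : G, ((χ g : kˣ) : k) • conj X Y g (base χ a) = base χ a := fun g => by
    rw [conj_base, smul_smul]
    simp
  simp only [this, Finset.sum_const, Finset.card_univ, ← Nat.card_eq_fintype_card]
  rw [← Nat.cast_smul_eq_nsmul k, inv_smul_smul₀ hG.natCard_ne_zero]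

lemma component_base_of_ne {χ ψ : G →* kˣ} (h : ψ ≠ χ) (a : X ⟶ (twist A χ).obj Y) :
    (component ψ (base χ a) : X ⟶ (twist A ψ).obj Y) = 0 := by
  apply base_injective
  rw [base_component, base_zero]
  have : ∀ g : G, ((ψ g : kˣ) : k) • conj X Y g (base χ a) =
      (((ψ * χ⁻¹) g : kˣ) : k) • base χ a := fun g => by
    rw [conj_base, smul_smul]
    simp
  simp only [this, ← Finset.sum_smul]
  rw [sum_apply_character (fun e => h (mul_inv_eq_one.1 e)), zero_smul, smul_zero]

/-- Every morphism of underlying objects is a sum of morphisms that are equivariant up to a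
character. -/
lemma twist_induction (hG : SplitsOver k G) {P : (X.X ⟶ Y.X) → Prop}
    (hadd : ∀ f f', P f → P f' → P (f + f'))
    (h : ∀ (χ : G →* kˣ) (a : X ⟶ (twist A χ).obj Y), P (base χ a)) (f : X.X ⟶ Y.X) : P f := by
  have := finite_characters (k := k) (G := G)
  have := Fintype.ofFinite (G →* kˣ)
  rw [← sum_component hG f]
  -- The zero morphism of weight `1` provides the value of `P` at the empty sum.
  exact Finset.sum_induction _ P hadd (h 1 0) fun χ _ => h χ _

end EquivariantObject

end Averaging

end EquivariantTilting

namespace EquivariantTilting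

noncomputable section

/-! ### Extending transformations and functors along retracts -/

section DenseExtension

variable {T E : Type*} [Category T] [Category E] {J : Type*} {o : J → T} {c : T → J}

lemma natTrans_ext_of_retract (ρ : ∀ X, Retract X (o (c X))) {P Q : T ⥤ E} {φ ψ : P ⟶ Q}
    (h : ∀ j, φ.app (o j) = ψ.app (o j)) : φ = ψ := by
  ext X
  have h1 := φ.naturality (ρ X).r
  have h2 := ψ.naturality (ρ X).r
  rw [h, ← h2] at h1
  simpa only [← Functor.map_comp_assoc, (ρ X).retract, CategoryTheory.Functor.map_id, Category.id_comp]
    using congrArg (fun t => P.map (ρ X).i ≫ t) h1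

/-- A natural transformation given by its components at objects of which every object is a
retract. -/
@[simps]
def extendNatTrans (ρ : ∀ X, Retract X (o (c X))) {P Q : T ⥤ E}
    (φ : ∀ j, P.obj (o j) ⟶ Q.obj (o j))
    (hφ : ∀ i j (f : o i ⟶ o j), P.map f ≫ φ j = φ i ≫ Q.map f) : P ⟶ Q where
  app X := P.map (ρ X).i ≫ φ _ ≫ Q.map (ρ X).r
  naturality X Y f := by
    -- The chosen retractions need not be natural in `X`; instead `f` is replaced by a morphism
    -- between the given objects, where the hypothesis on `φ` applies.
    have h := hφ _ _ ((ρ X).r ≫ f ≫ (ρ Y).i)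
    have h' : P.map (ρ X).i ≫ P.map ((ρ X).r ≫ f ≫ (ρ Y).i) = P.map (f ≫ (ρ Y).i) := by
      rw [← Functor.map_comp, (ρ X).retract_assoc]
    have h'' : Q.map ((ρ X).r ≫ f ≫ (ρ Y).i) ≫ Q.map (ρ Y).r = Q.map ((ρ X).r ≫ f) := by
      rw [← Functor.map_comp, Category.assoc, Category.assoc, (ρ Y).retract, Category.comp_id]
    rw [← Functor.map_comp_assoc, ← h', Category.assoc, reassoc_of% h, h'', Functor.map_comp,
      Category.assoc, Category.assoc]

lemma extendNatTrans_app_obj (ρ : ∀ X, Retract X (o (c X))) {P Q : T ⥤ E}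
    (φ : ∀ j, P.obj (o j) ⟶ Q.obj (o j))
    (hφ : ∀ i j (f : o i ⟶ o j), P.map f ≫ φ j = φ i ≫ Q.map f) (j : J) :
    (extendNatTrans ρ φ hφ).app (o j) = φ j := by
  rw [extendNatTrans_app, ← hφ, ← Functor.map_comp_assoc, (ρ _).retract]
  simp

/-- The natural isomorphism given by its components at objects of which every object is a
retract. -/
def extendNatIso (ρ : ∀ X, Retract X (o (c X))) {P Q : T ⥤ E}
    (φ : ∀ j, P.obj (o j) ≅ Q.obj (o j))
    (hφ : ∀ i j (f : o i ⟶ o j), P.map f ≫ (φ j).hom = (φ i).hom ≫ Q.map f) : P ≅ Q where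
  hom := extendNatTrans ρ (fun j => (φ j).hom) hφ
  inv := extendNatTrans ρ (fun j => (φ j).inv) fun i j f => by
    rw [Iso.eq_inv_comp, ← reassoc_of% hφ i j f, Iso.hom_inv_id, Category.comp_id]
  hom_inv_id := natTrans_ext_of_retract ρ fun j => by
    rw [NatTrans.comp_app, extendNatTrans_app_obj, extendNatTrans_app_obj]
    simp
  inv_hom_id := natTrans_ext_of_retract ρ fun j => by
    rw [NatTrans.comp_app, extendNatTrans_app_obj, extendNatTrans_app_obj]
    simp

/-- A functor on the full subcategory of a category spanned by a family of objects. -/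
structure FunctorOn (o : J → T) (E : Type*) [Category E] where
  /-- the map on objects -/
  obj : J → E
  /-- the map on morphisms -/
  map : ∀ {i j : J}, (o i ⟶ o j) → (obj i ⟶ obj j)
  map_id : ∀ i, map (𝟙 (o i)) = 𝟙 (obj i)
  map_comp : ∀ {i j l : J} (f : o i ⟶ o j) (g : o j ⟶ o l), map (f ≫ g) = map f ≫ map g

namespace FunctorOn

variable [IsIdempotentComplete E] (L : FunctorOn o E) (ρ : ∀ X, Retract X (o (c X)))

/-- `X` is the image of an idempotent of `o (c X)`, so an extension of `L` has to send it to the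
image of the corresponding idempotent of `L.obj (c X)`. -/
lemma exists_splitting (X : T) : ∃ (Y : E) (i : Y ⟶ L.obj (c X)) (r : L.obj (c X) ⟶ Y),
    i ≫ r = 𝟙 Y ∧ r ≫ i = L.map ((ρ X).r ≫ (ρ X).i) :=
  IsIdempotentComplete.idempotents_split _ _ (by rw [← L.map_comp]; simp)

/-- The value of the extended functor. -/
def extObj (X : T) : E := (L.exists_splitting ρ X).choose

/-- The inclusion of the value of the extended functor. -/
def extι (X : T) : L.extObj ρ X ⟶ L.obj (c X) := (L.exists_splitting ρ X).choose_spec.choose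

/-- The projection to the value of the extended functor. -/
def extπ (X : T) : L.obj (c X) ⟶ L.extObj ρ X :=
  (L.exists_splitting ρ X).choose_spec.choose_spec.choose

lemma extι_extπ (X : T) : L.extι ρ X ≫ L.extπ ρ X = 𝟙 _ :=
  (L.exists_splitting ρ X).choose_spec.choose_spec.choose_spec.1

lemma extπ_extι (X : T) : L.extπ ρ X ≫ L.extι ρ X = L.map ((ρ X).r ≫ (ρ X).i) :=
  (L.exists_splitting ρ X).choose_spec.choose_spec.choose_spec.2

/-- The extended functor on morphisms. -/
def extMap {X Y : T} (f : X ⟶ Y) : L.extObj ρ X ⟶ L.extObj ρ Y :=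
  L.extι ρ X ≫ L.map ((ρ X).r ≫ f ≫ (ρ Y).i) ≫ L.extπ ρ Y

lemma extι_map_r_map_i (X : T) :
    L.extι ρ X ≫ L.map ((ρ X).r ≫ (ρ X).i) = L.extι ρ X := by
  rw [← extπ_extι, reassoc_of% (extι_extπ)]

lemma map_r_map_i_extπ (X : T) :
    L.map ((ρ X).r ≫ (ρ X).i) ≫ L.extπ ρ X = L.extπ ρ X := by
  rw [← extπ_extι, Category.assoc, extι_extπ, Category.comp_id]

/-- The extended functor takes the given values up to isomorphism. -/
def extObjIso (j : J) : L.extObj ρ (o j) ≅ L.obj j where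
  hom := L.extι ρ (o j) ≫ L.map (ρ (o j)).r
  inv := L.map (ρ (o j)).i ≫ L.extπ ρ (o j)
  hom_inv_id := by
    rw [Category.assoc, ← Category.assoc (L.map _), ← L.map_comp, map_r_map_i_extπ, extι_extπ]
  inv_hom_id := by
    rw [Category.assoc, reassoc_of% (L.extπ_extι), ← L.map_comp, ← L.map_comp]
    simp [L.map_id]

lemma extObjIso_naturality {i j : J} (f : o i ⟶ o j) :
    L.extMap ρ f ≫ (L.extObjIso ρ j).hom = (L.extObjIso ρ i).hom ≫ L.map f := by
  simp only [extMap, extObjIso, Category.assoc]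
  rw [reassoc_of% (L.extπ_extι), ← L.map_comp, ← L.map_comp, ← L.map_comp]
  simp

/-- The extension of a functor from a full subcategory to a category all of whose objects are
retracts of objects of the subcategory. -/
def extend : T ⥤ E where
  obj := L.extObj ρ
  map f := L.extMap ρ f
  map_id X := by
    rw [extMap, Category.id_comp, reassoc_of% (extι_map_r_map_i), extι_extπ]
  map_comp {X Y Z} f g := by
    simp only [extMap, Category.assoc]
    rw [reassoc_of% (L.extπ_extι), ← Category.assoc (L.map _) (L.map _), ← L.map_comp,
      ← Category.assoc (L.map _) (L.map _), ← L.map_comp]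
    simp

/-- The extension restricts to the given functor. -/
def extendIso (j : J) : (L.extend ρ).obj (o j) ≅ L.obj j := L.extObjIso ρ j

lemma extendIso_naturality {i j : J} (f : o i ⟶ o j) :
    (L.extend ρ).map f ≫ (L.extendIso ρ j).hom = (L.extendIso ρ i).hom ≫ L.map f :=
  L.extObjIso_naturality ρ f

end FunctorOn

end DenseExtension

/-! ### The unit of the action and the retraction of induced objects -/

section Unit

variable {k : Type w} [Field k] {G : Type*} [Group G] {C : Type u} [Category.{v} C]
  [Preadditive C] [Linear k C] [HasShift C ℤ] [HasExactTriangles C] (A : TriangleAction k G C)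

/-- The functor attached to the unit of the group is isomorphic to the identity. -/
def TriangleAction.unitIso : 𝟭 C ≅ A.fn 1 :=
  NatIso.ofComponents
    -- The unit is not part of the action: the inverse of `ε 1 1`, from `F_1 X` to `F_1 (F_1 X)`, is
    -- lifted through the fully faithful functor `F_1`.
    (fun X => (A.fn 1).preimageIso ((A.ε 1 1 1 (one_mul 1)).app X).symm)
    (fun {X Y} f => (A.fn 1).map_injective (by
      simp))

lemma TriangleAction.map_unitIso_hom_app (X : C) :
    (A.fn 1).map (A.unitIso.hom.app X) = (A.ε 1 1 1 (one_mul 1)).inv.app X := by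
  simp [unitIso]

/-- After applying `F_1` this becomes the compatibility of `ε 1 1` with shifts. It is what turns
objectwise retractions onto `X` into a retraction of triangles. -/
lemma TriangleAction.unitIso_hom_app_shift (X : C) (n : ℤ) :
    A.unitIso.hom.app (X⟦n⟧) ≫ ((A.fn 1).commShiftIso n).hom.app X =
      (A.unitIso.hom.app X)⟦n⟧' := by
  apply (A.fn 1).map_injective
  have h := NatTrans.shift_app_comm (A.ε 1 1 1 (one_mul 1)).inv n X
  have h' := (A.fn 1).commShiftIso_hom_naturality (A.unitIso.hom.app X) n
  dsimp at h'
  rw [A.map_unitIso_hom_app] at h'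
  rw [Functor.commShiftIso_comp_hom_app] at h
  rw [← cancel_mono (((A.fn 1).commShiftIso n).hom.app _), Functor.map_comp,
    A.map_unitIso_hom_app, Category.assoc, h', h]

variable [HasFiniteBiproducts C] [Finite G]

/-- Every object is a retract of the sum of its translates. -/
def retractSum (X : C) : Retract X (⨁ fun h => (A.fn h).obj X) where
  i := A.unitIso.hom.app X ≫ biproduct.ι (fun h => (A.fn h).obj X) 1
  r := biproduct.π (fun h => (A.fn h).obj X) 1 ≫ A.unitIso.inv.app X
  retract := by simp

/-- Every object is a retract of the underlying object of its induced object. -/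
def retractInd (X : C) : Retract X (EquivariantObject.ind A X).X := retractSum A X

end Unit

/-! ### Injectivity of equivariantization -/

section Injectivity

variable {k : Type w} [Field k] {G : Type*} [Group G] [Finite G] {C : Type u} [Category.{v} C]
  [Preadditive C] [Linear k C] [HasShift C ℤ] [HasExactTriangles C] [HasFiniteBiproducts C]
  [∀ n : ℤ, (shiftFunctor C n).Linear k] {A : TriangleAction k G C}

open EquivariantObject

lemma natTrans_ext_equivariant (A : TriangleAction k G C) {E : Type*} [Category E] {P Q : C ⥤ E}
    {φ ψ : P ⟶ Q} (h : ∀ Z : EquivariantObject A, φ.app Z.X = ψ.app Z.X) : φ = ψ :=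
  natTrans_ext_of_retract (o := fun Z : EquivariantObject A => Z.X) (retractInd A) h

/-- Compatibility with the dual action says that the components at `Z` and `F_χ Z` agree on
underlying objects. This makes the components natural for morphisms of every weight, so that they
extend to `C`. -/
lemma EquivariantEndofunctor.isomorphic_of_equivariantization (hG : SplitsOver k G)
    {E E' : EquivariantEndofunctor A}
    (h : E.equivariantization.Isomorphic E'.equivariantization) : E.Isomorphic E' := by
  have := Fintype.ofFinite G
  obtain ⟨φ, hs, hδ⟩ := h
  let φ : equivariantFunctor E ≅ equivariantFunctor E' := φ
  let p (Z : EquivariantObject A) : E.toFunctor.obj Z.X ≅ E'.toFunctor.obj Z.X :=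
    (forget A).mapIso (φ.app Z)
  have hχ (χ : G →* kˣ) (Z : EquivariantObject A) :
      (p ((twist A χ).obj Z)).hom = (p Z).hom := by
    have h1 := congrArg EquivariantObject.Hom.f (hδ χ Z)
    have h2 : 𝟙 _ ≫ (p Z).hom = (p ((twist A χ).obj Z)).hom ≫ 𝟙 _ := h1
    rw [Category.id_comp, Category.comp_id] at h2
    exact h2.symm
  have hnat (X Y : EquivariantObject A) (f : X.X ⟶ Y.X) :
      E.toFunctor.map f ≫ (p Y).hom = (p X).hom ≫ E'.toFunctor.map f := by
    refine twist_induction (P := fun f => E.toFunctor.map f ≫ (p Y).hom =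
      (p X).hom ≫ E'.toFunctor.map f) hG (fun f f' hf hf' => ?_) (fun χ a => ?_) f
    · rw [Functor.map_add, Functor.map_add, Preadditive.add_comp, hf, hf', Preadditive.comp_add]
    -- A morphism of weight `χ` is an equivariant morphism into `F_χ Y`, where naturality of `φ`
    -- applies.
    · rw [← hχ χ Y]
      exact congrArg EquivariantObject.Hom.f (φ.hom.naturality a)
  let ψ : E.toFunctor ≅ E'.toFunctor := extendNatIso (o := fun Z : EquivariantObject A => Z.X)
    (retractInd A) p hnat
  have hψ (Z : EquivariantObject A) : ψ.hom.app Z.X = (φ.hom.app Z).f :=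
    extendNatTrans_app_obj (o := fun Z : EquivariantObject A => Z.X) (retractInd A)
      (fun Z => (p Z).hom) hnat Z
  refine ⟨ψ, ⟨fun n => natTrans_ext_equivariant A fun Z => ?_⟩, fun g X => ?_⟩
  · have : NatTrans.CommShift φ.hom ℤ := hs
    have h1 := NatTrans.shift_app_comm φ.hom n Z
    have h2 : (E.toFunctor.commShiftIso n).hom.app Z.X ≫ (φ.hom.app Z).f⟦n⟧' =
      (φ.hom.app (Z⟦n⟧)).f ≫ (E'.toFunctor.commShiftIso n).hom.app Z.X :=
        congrArg EquivariantObject.Hom.f h1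
    rw [← hψ, ← hψ] at h2
    exact h2
  · have key : (E.δ g).hom ≫ Functor.whiskerRight ψ.hom (A.fn g) =
        Functor.whiskerLeft (A.fn g) ψ.hom ≫ (E'.δ g).hom := by
      refine natTrans_ext_equivariant A fun Z => ?_
      dsimp
      -- That `φ` at `Z` is an equivariant morphism is the compatibility with `δ g`, up to the
      -- isomorphism `E (α g)`.
      have h1 : (φ.hom.app Z).f ≫ E'.toFunctor.map (Z.α g).hom ≫ (E'.δ g).hom.app Z.X =
          (E.toFunctor.map (Z.α g).hom ≫ (E.δ g).hom.app Z.X) ≫ (A.fn g).map (φ.hom.app Z).f :=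
        (φ.hom.app Z).comm g
      rw [← hψ] at h1
      rw [← cancel_epi (E.toFunctor.map (Z.α g).hom), ψ.hom.naturality_assoc]
      exact (Category.assoc _ _ _).symm.trans h1.symm
    exact NatTrans.congr_app key X

end Injectivity

/-! ### Action of an endofunctor of `T^G` on underlying morphisms -/

section Descent

variable {k : Type w} [Field k] {G : Type*} [Group G] {C : Type u} [Category.{v} C]
  [Preadditive C] [Linear k C] [HasShift C ℤ] [HasExactTriangles C]
  [∀ n : ℤ, (shiftFunctor C n).Additive] [∀ n : ℤ, (shiftFunctor C n).Linear k]
  {A : TriangleAction k G C}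

open EquivariantObject

namespace EquivariantObject

variable {X Y Z : EquivariantObject A}

/-- The composition of morphisms that are equivariant up to characters. -/
def twComp {χ ψ : G →* kˣ} (a : X ⟶ (twist A χ).obj Y) (b : Y ⟶ (twist A ψ).obj Z) :
    X ⟶ (twist A (χ * ψ)).obj Z :=
  a ≫ (twist A χ).map b ≫ (twistMul A χ ψ _ rfl).hom.app Z

lemma base_twComp {χ ψ : G →* kˣ} (a : X ⟶ (twist A χ).obj Y) (b : Y ⟶ (twist A ψ).obj Z) :
    base (χ * ψ) (twComp a b) = base χ a ≫ base ψ b := by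
  have h : base χ a ≫ base ψ b ≫ 𝟙 Z.X = base χ a ≫ base ψ b := by rw [Category.comp_id]
  exact h

/-- The shift of a morphism that is equivariant up to a character. -/
def twShift {χ : G →* kˣ} (n : ℤ) (a : X ⟶ (twist A χ).obj Y) :
    X⟦n⟧ ⟶ (twist A χ).obj (Y⟦n⟧) :=
  a⟦n⟧' ≫ ((twist A χ).commShiftIso n).inv.app Y

lemma base_twShift {χ : G →* kˣ} (n : ℤ) (a : X ⟶ (twist A χ).obj Y) :
    base χ (twShift n a) = (base χ a)⟦n⟧' := by
  have h : (base χ a)⟦n⟧' ≫ 𝟙 _ = (base χ a)⟦n⟧' := by rw [Category.comp_id]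
  exact h

end EquivariantObject

variable (H : EquivariantEndofunctor (dualAction A))

namespace EquivariantEndofunctor

/-- The underlying object of the value of an endofunctor of the category of equivariant
objects. -/
abbrev objX (Z : EquivariantObject A) : C := (H.toFunctor.obj Z).X

/-- The underlying morphism of the value of an endofunctor of the category of equivariant
objects. -/
def mapX {X Y : EquivariantObject A} (a : X ⟶ Y) : H.objX X ⟶ H.objX Y := (H.toFunctor.map a).f

lemma mapX_id (X : EquivariantObject A) : H.mapX (𝟙 X) = 𝟙 (H.objX X) :=
  congrArg Hom.f (H.toFunctor.map_id X)

lemma mapX_comp {X Y Z : EquivariantObject A} (a : X ⟶ Y) (b : Y ⟶ Z) :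
    H.mapX (a ≫ b) = H.mapX a ≫ H.mapX b :=
  congrArg Hom.f (H.toFunctor.map_comp a b)

lemma mapX_add {X Y : EquivariantObject A} (a b : X ⟶ Y) :
    H.mapX (a + b) = H.mapX a + H.mapX b :=
  congrArg Hom.f H.toFunctor.map_add

lemma mapX_smul {X Y : EquivariantObject A} (c : k) (a : X ⟶ Y) :
    H.mapX (c • a) = c • H.mapX a :=
  congrArg Hom.f (H.toFunctor.map_smul c a)

lemma conj_mapX {X Y : EquivariantObject A} (a : X ⟶ Y) (g : G) :
    conj (H.toFunctor.obj X) (H.toFunctor.obj Y) g (H.mapX a) = H.mapX a := by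
  rw [← comm_iff_conj]
  exact (H.toFunctor.map a).comm g

/-- The underlying isomorphism of the compatibility isomorphism with a character. -/
def δX (χ : G →* kˣ) (Y : EquivariantObject A) : H.objX ((twist A χ).obj Y) ≅ H.objX Y where
  hom := ((H.δ χ).hom.app Y).f
  inv := ((H.δ χ).inv.app Y).f
  hom_inv_id := congrArg Hom.f ((H.δ χ).hom_inv_id_app Y)
  inv_hom_id := congrArg Hom.f ((H.δ χ).inv_hom_id_app Y)

lemma δX_naturality (χ : G →* kˣ) {Y Z : EquivariantObject A} (b : Y ⟶ Z) :
    H.mapX ((twist A χ).map b) ≫ (H.δX χ Z).hom = (H.δX χ Y).hom ≫ H.mapX b :=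
  congrArg Hom.f ((H.δ χ).hom.naturality b)

lemma δX_mul (χ ψ : G →* kˣ) (Z : EquivariantObject A) :
    H.mapX ((twistMul A χ ψ _ rfl).hom.app Z) ≫ (H.δX (χ * ψ) Z).hom =
      (H.δX χ ((twist A ψ).obj Z)).hom ≫ (H.δX ψ Z).hom := by
  have h : H.mapX ((twistMul A χ ψ _ rfl).hom.app Z) ≫ (H.δX (χ * ψ) Z).hom =
      (H.δX χ ((twist A ψ).obj Z)).hom ≫ (H.δX ψ Z).hom ≫ 𝟙 _ :=
    congrArg Hom.f (H.δ_mul χ ψ _ rfl Z)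
  rwa [Category.comp_id] at h

lemma conj_δX (χ : G →* kˣ) (Y : EquivariantObject A) (g : G) :
    conj (H.toFunctor.obj ((twist A χ).obj Y)) (H.toFunctor.obj Y) g (H.δX χ Y).hom =
      ((χ g⁻¹ : kˣ) : k) • (H.δX χ Y).hom :=
  (conj_eq_smul_iff (X := H.toFunctor.obj ((twist A χ).obj Y)) χ (H.δX χ Y).hom g).2
    (((H.δ χ).hom.app Y).comm g)

/-- The underlying isomorphism of the connecting isomorphism. -/
def shiftX (n : ℤ) (Z : EquivariantObject A) : H.objX (Z⟦n⟧) ≅ (H.objX Z)⟦n⟧ :=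
  (forget A).mapIso ((H.toFunctor.commShiftIso n).app Z)

lemma shiftX_naturality (n : ℤ) {Y Z : EquivariantObject A} (b : Y ⟶ Z) :
    H.mapX (b⟦n⟧') ≫ (H.shiftX n Z).hom = (H.shiftX n Y).hom ≫ (H.mapX b)⟦n⟧' :=
  congrArg Hom.f ((H.toFunctor.commShiftIso n).hom.naturality b)

lemma δX_shift (χ : G →* kˣ) (n : ℤ) (Y : EquivariantObject A) :
    H.mapX (((twist A χ).commShiftIso n).hom.app Y) ≫ (H.shiftX n ((twist A χ).obj Y)).hom ≫
      ((H.δX χ Y).hom)⟦n⟧' = (H.δX χ (Y⟦n⟧)).hom ≫ (H.shiftX n Y).hom := by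
  have h1 := NatTrans.shift_app_comm (H.δ χ).hom n Y
  rw [Functor.commShiftIso_comp_hom_app, Functor.commShiftIso_comp_hom_app, Category.assoc] at h1
  have h2 : H.mapX (((twist A χ).commShiftIso n).hom.app Y) ≫
      (H.shiftX n ((twist A χ).obj Y)).hom ≫ ((H.δX χ Y).hom)⟦n⟧' =
      (H.δX χ (Y⟦n⟧)).hom ≫ (H.shiftX n Y).hom ≫ 𝟙 _ := congrArg Hom.f h1
  rwa [Category.comp_id] at h2

lemma shiftX_comm (n : ℤ) (Z : EquivariantObject A) (g : G) :
    (H.shiftX n Z).hom ≫ ((H.toFunctor.obj Z).α g).hom⟦n⟧' ≫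
      ((A.fn g).commShiftIso n).inv.app (H.objX Z) =
    ((H.toFunctor.obj (Z⟦n⟧)).α g).hom ≫ (A.fn g).map (H.shiftX n Z).hom :=
  ((H.toFunctor.commShiftIso n).hom.app Z).comm g

lemma shiftX_zero (Z : EquivariantObject A) : (H.shiftX 0 Z).hom =
    H.mapX ((shiftFunctorZero (EquivariantObject A) ℤ).hom.app Z) ≫
      (shiftFunctorZero C ℤ).inv.app (H.objX Z) := by
  have h := congrArg (fun t => t.hom.app Z) (H.toFunctor.commShiftIso_zero ℤ)
  exact congrArg Hom.f (h.trans (Functor.CommShift.isoZero_hom_app _ _ _))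

lemma shiftX_add (n m : ℤ) (Z : EquivariantObject A) : (H.shiftX (n + m) Z).hom =
    H.mapX ((shiftFunctorAdd (EquivariantObject A) n m).hom.app Z) ≫ (H.shiftX m (Z⟦n⟧)).hom ≫
      (H.shiftX n Z).hom⟦m⟧' ≫ (shiftFunctorAdd C n m).inv.app (H.objX Z) := by
  have h := congrArg (fun t => t.hom.app Z) (H.toFunctor.commShiftIso_add n m)
  exact congrArg Hom.f (h.trans (Functor.CommShift.isoAdd_hom_app _ _ _))

/-- The action of an equivariant endofunctor on morphisms equivariant up to a character. -/
def twMap {χ : G →* kˣ} {X Y : EquivariantObject A} (a : X ⟶ (twist A χ).obj Y) :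
    H.objX X ⟶ H.objX Y :=
  H.mapX a ≫ (H.δX χ Y).hom

/-- Naturality of `δ χ` moves it past the second morphism, and the cocycle identity merges `δ χ` and
`δ ψ` into `δ (χ * ψ)`. -/
lemma twMap_comp {χ ψ : G →* kˣ} {X Y Z : EquivariantObject A} (a : X ⟶ (twist A χ).obj Y)
    (b : Y ⟶ (twist A ψ).obj Z) : H.twMap (twComp a b) = H.twMap a ≫ H.twMap b := by
  have h : H.mapX (twComp a b) = H.mapX a ≫ H.mapX ((twist A χ).map b) ≫
      H.mapX ((twistMul A χ ψ _ rfl).hom.app Z) :=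
    (H.mapX_comp _ _).trans (congrArg _ (H.mapX_comp _ _))
  simp only [twMap, h, Category.assoc, δX_mul]
  rw [← Category.assoc (H.mapX ((twist A χ).map b)), δX_naturality, Category.assoc]

lemma twMap_shift {χ : G →* kˣ} {X Y : EquivariantObject A} (n : ℤ)
    (a : X ⟶ (twist A χ).obj Y) :
    H.twMap (twShift n a) ≫ (H.shiftX n Y).hom = (H.shiftX n X).hom ≫ (H.twMap a)⟦n⟧' := by
  have h1 := H.δX_shift χ n Y
  have h2 := H.shiftX_naturality n a
  have h3 : H.mapX (twShift n a) = H.mapX (a⟦n⟧') ≫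
      H.mapX (((twist A χ).commShiftIso n).inv.app Y) := H.mapX_comp _ _
  have h4 : H.mapX (((twist A χ).commShiftIso n).inv.app Y) ≫
      H.mapX (((twist A χ).commShiftIso n).hom.app Y) = 𝟙 _ := by
    rw [← mapX_comp, Iso.inv_hom_id_app]
    exact H.mapX_id _
  rw [twMap, Category.assoc, ← h1, h3, Category.assoc, reassoc_of% h4, reassoc_of% h2, twMap,
    Functor.map_comp]

/-- Weights are preserved: `H a` is equivariant, hence fixed by conjugation, while `δ χ` scales by
`χ (g⁻¹)`. -/
lemma conj_twMap {χ : G →* kˣ} {X Y : EquivariantObject A} (a : X ⟶ (twist A χ).obj Y) (g : G) :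
    conj (H.toFunctor.obj X) (H.toFunctor.obj Y) g (H.twMap a) =
      ((χ g⁻¹ : kˣ) : k) • H.twMap a := by
  have h1 := H.conj_mapX a g
  have h2 := H.conj_δX χ Y g
  have h3 : conj (H.toFunctor.obj X) (H.toFunctor.obj Y) g (H.twMap a) =
      conj (H.toFunctor.obj X) (H.toFunctor.obj ((twist A χ).obj Y)) g (H.mapX a) ≫
      conj (H.toFunctor.obj ((twist A χ).obj Y)) (H.toFunctor.obj Y) g (H.δX χ Y).hom := by
    simp [conj, twMap]
  rw [h3, h1, h2, Linear.comp_smul]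
  rfl

section

variable [Fintype G] [Fintype (G →* kˣ)]

/-- The action of an equivariant endofunctor on morphisms of underlying objects. -/
def mapU (X Y : EquivariantObject A) (f : X.X ⟶ Y.X) : H.objX X ⟶ H.objX Y :=
  ∑ χ : G →* kˣ, H.twMap (component χ f : X ⟶ (twist A χ).obj Y)

lemma mapU_add {X Y : EquivariantObject A} (f f' : X.X ⟶ Y.X) :
    H.mapU X Y (f + f') = H.mapU X Y f + H.mapU X Y f' := by
  simp only [mapU, component_add, twMap, mapX_add, Preadditive.add_comp, Finset.sum_add_distrib]

lemma mapU_smul {X Y : EquivariantObject A} (c : k) (f : X.X ⟶ Y.X) :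
    H.mapU X Y (c • f) = c • H.mapU X Y f := by
  simp only [mapU, component_smul, twMap, mapX_smul, Linear.smul_comp, Finset.smul_sum]

lemma mapU_base (hG : SplitsOver k G) {χ : G →* kˣ} {X Y : EquivariantObject A} (a : X ⟶ (twist A χ).obj Y) :
    H.mapU X Y (base χ a) = H.twMap a := by
  have h0 (ψ : G →* kˣ) : H.twMap (0 : X ⟶ (twist A ψ).obj Y) = 0 := by
    have h := H.mapX_smul (0 : k) (0 : X ⟶ (twist A ψ).obj Y)
    rw [zero_smul, zero_smul] at h
    rw [twMap, h, zero_comp]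
  rw [mapU, Finset.sum_eq_single χ (fun ψ _ h => by rw [component_base_of_ne h, h0]) (by simp),
    component_base hG]

lemma mapU_comp (hG : SplitsOver k G) {X Y Z : EquivariantObject A} (f : X.X ⟶ Y.X) (f' : Y.X ⟶ Z.X) :
    H.mapU X Z (f ≫ f') = H.mapU X Y f ≫ H.mapU Y Z f' := by
  refine twist_induction (P := fun f => H.mapU X Z (f ≫ f') = H.mapU X Y f ≫ H.mapU Y Z f') hG
    (fun f₁ f₂ h₁ h₂ => ?_) (fun χ a => ?_) f
  · rw [Preadditive.add_comp, mapU_add, mapU_add, h₁, h₂, Preadditive.add_comp]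
  refine twist_induction (P := fun f' => H.mapU X Z (base χ a ≫ f') =
    H.mapU X Y (base χ a) ≫ H.mapU Y Z f') hG (fun f₁ f₂ h₁ h₂ => ?_) (fun ψ b => ?_) f'
  · rw [Preadditive.comp_add, mapU_add, mapU_add, h₁, h₂, Preadditive.comp_add]
  · rw [← base_twComp, H.mapU_base hG, H.mapU_base hG, H.mapU_base hG, twMap_comp]

/-- No normalization of `δ 1` is assumed. The identity has weight `1`, so its image is a composite
of isomorphisms; it is also idempotent by `mapU_comp`, and an invertible idempotent is the identity.
-/
lemma mapU_id (hG : SplitsOver k G) (X : EquivariantObject A) : H.mapU X X (𝟙 X.X) = 𝟙 (H.objX X) := by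
  let u : X ⟶ (twist A 1).obj X := (twistOne A).inv.app X
  have hu : base 1 u = 𝟙 X.X := rfl
  have h : H.mapU X X (𝟙 X.X) ≫ H.mapU X X (𝟙 X.X) = H.mapU X X (𝟙 X.X) := by
    rw [← mapU_comp H hG, Category.comp_id]
  have : IsIso (H.mapU X X (𝟙 X.X)) := by
    have h1 : H.mapX u ≫ H.mapX ((twistOne A).hom.app X) = 𝟙 _ := by
      rw [← mapX_comp, Iso.inv_hom_id_app]
      exact H.mapX_id _
    have h2 : H.mapX ((twistOne A).hom.app X) ≫ H.mapX u = 𝟙 _ := by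
      rw [← mapX_comp, Iso.hom_inv_id_app]
      exact H.mapX_id _
    have : IsIso (H.mapX u) := ⟨⟨_, h1, h2⟩⟩
    rw [← hu, mapU_base H hG, twMap]
    infer_instance
  rwa [← cancel_epi (H.mapU X X (𝟙 X.X)), Category.comp_id]

lemma mapU_f (hG : SplitsOver k G) {X Y : EquivariantObject A} (a : X ⟶ Y) : H.mapU X Y a.f = H.mapX a := by
  let u : Y ⟶ (twist A 1).obj Y := (twistOne A).inv.app Y
  have hu : base 1 u = 𝟙 Y.X := rfl
  have h : H.twMap u = 𝟙 _ := by rw [← H.mapU_base hG, hu, H.mapU_id hG]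
  have h1 : a.f = base 1 (a ≫ u) := (Category.comp_id a.f).symm
  rw [h1, H.mapU_base hG, twMap, mapX_comp, Category.assoc]
  exact (congrArg (fun t => H.mapX a ≫ t) h).trans (Category.comp_id _)

lemma mapU_shift (hG : SplitsOver k G) (n : ℤ) {X Y : EquivariantObject A} (f : X.X ⟶ Y.X) :
    H.mapU (X⟦n⟧) (Y⟦n⟧) (f⟦n⟧') ≫ (H.shiftX n Y).hom =
      (H.shiftX n X).hom ≫ (H.mapU X Y f)⟦n⟧' := by
  refine twist_induction (P := fun f : X.X ⟶ Y.X =>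
    H.mapU (X⟦n⟧) (Y⟦n⟧) (f⟦n⟧') ≫ (H.shiftX n Y).hom =
      (H.shiftX n X).hom ≫ (H.mapU X Y f)⟦n⟧') hG (fun f₁ f₂ h₁ h₂ => ?_) (fun χ a => ?_) f
  · have h : H.mapU (X⟦n⟧) (Y⟦n⟧) ((f₁ + f₂)⟦n⟧') =
        H.mapU (X⟦n⟧) (Y⟦n⟧) (f₁⟦n⟧') + H.mapU (X⟦n⟧) (Y⟦n⟧) (f₂⟦n⟧') := by
      rw [Functor.map_add]
      exact H.mapU_add (X := X⟦n⟧) (Y := Y⟦n⟧) _ _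
    rw [h, Preadditive.add_comp, h₁, h₂, mapU_add, Functor.map_add, Preadditive.comp_add]
  · rw [← base_twShift, H.mapU_base hG, H.mapU_base hG, twMap_shift]

/-- Both sides scale by `χ (g⁻¹)` on morphisms of weight `χ`. This is the source of the
compatibility of the descended functor with `G`. -/
lemma mapU_conj (hG : SplitsOver k G) {X Y : EquivariantObject A} (g : G) (f : X.X ⟶ Y.X) :
    H.mapU X Y (conj X Y g f) =
      conj (H.toFunctor.obj X) (H.toFunctor.obj Y) g (H.mapU X Y f) := by
  refine twist_induction (P := fun f => H.mapU X Y (conj X Y g f) =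
      conj (H.toFunctor.obj X) (H.toFunctor.obj Y) g (H.mapU X Y f)) hG
    (fun f₁ f₂ h₁ h₂ => ?_) (fun χ a => ?_) f
  · rw [conj_add, mapU_add, mapU_add, conj_add, h₁, h₂]
  · rw [conj_base, mapU_smul, H.mapU_base hG, conj_twMap]

end

end EquivariantEndofunctor

end Descent

/-! ### The descended functor and its structure isomorphisms -/

section DescentFunctor

variable {k : Type w} [Field k] {G : Type*} [Group G] [Fintype G] [Fintype (G →* kˣ)]
  {C : Type u} [Category.{v} C]
  [Preadditive C] [Linear k C] [HasShift C ℤ] [HasExactTriangles C]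
  [∀ n : ℤ, (shiftFunctor C n).Additive] [∀ n : ℤ, (shiftFunctor C n).Linear k]
  [HasFiniteBiproducts C] [IsIdempotentComplete C]
  {A : TriangleAction k G C}

open EquivariantObject

namespace EquivariantEndofunctor

variable (H : EquivariantEndofunctor (dualAction A)) (hG : SplitsOver k G)

/-- An equivariant endofunctor, as a functor on the underlying objects. -/
def functorOn : FunctorOn (fun Z : EquivariantObject A => Z.X) C where
  obj := H.objX
  map f := H.mapU _ _ f
  map_id Z := H.mapU_id hG Z
  map_comp f f' := H.mapU_comp hG f f'

/-- The functor on `C` obtained from an equivariant endofunctor of the category of equivariant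
objects. -/
def descend : C ⥤ C := (H.functorOn hG).extend (retractInd A)

/-- The descended functor agrees with the given one on underlying objects. -/
def descendIso (Z : EquivariantObject A) : (H.descend hG).obj Z.X ≅ H.objX Z :=
  (H.functorOn hG).extendIso (retractInd A) Z

lemma descendIso_naturality {X Y : EquivariantObject A} (f : X.X ⟶ Y.X) :
    (H.descend hG).map f ≫ (H.descendIso hG Y).hom =
      (H.descendIso hG X).hom ≫ H.mapU X Y f :=
  (H.functorOn hG).extendIso_naturality (retractInd A) f

lemma descendIso_inv_naturality {X Y : EquivariantObject A} (f : X.X ⟶ Y.X) :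
    (H.descendIso hG X).inv ≫ (H.descend hG).map f =
      H.mapU X Y f ≫ (H.descendIso hG Y).inv := by
  rw [Iso.inv_comp_eq, ← reassoc_of% descendIso_naturality, Iso.hom_inv_id, Category.comp_id]

instance : (H.descend hG).Additive where
  map_add {X Y f f'} := by
    have h : (H.functorOn hG).map ((retractInd A X).r ≫ (f + f') ≫ (retractInd A Y).i) =
        (H.functorOn hG).map ((retractInd A X).r ≫ f ≫ (retractInd A Y).i) +
          (H.functorOn hG).map ((retractInd A X).r ≫ f' ≫ (retractInd A Y).i) := by
      rw [Preadditive.add_comp, Preadditive.comp_add]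
      exact H.mapU_add _ _
    change (H.functorOn hG).extMap (retractInd A) (f + f') =
      (H.functorOn hG).extMap (retractInd A) f + (H.functorOn hG).extMap (retractInd A) f'
    simp only [FunctorOn.extMap]
    rw [h, Preadditive.add_comp, Preadditive.comp_add]

instance : (H.descend hG).Linear k where
  map_smul {X Y} f c := by
    have h : (H.functorOn hG).map ((retractInd A X).r ≫ (c • f) ≫ (retractInd A Y).i) =
        c • (H.functorOn hG).map ((retractInd A X).r ≫ f ≫ (retractInd A Y).i) := by
      rw [Linear.smul_comp, Linear.comp_smul]
      exact H.mapU_smul _ _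
    change (H.functorOn hG).extMap (retractInd A) (c • f) =
      c • (H.functorOn hG).extMap (retractInd A) f
    simp only [FunctorOn.extMap]
    rw [h, Linear.smul_comp, Linear.comp_smul]

/-- The value of the descended functor at a shift. -/
def descendIsoShift (n : ℤ) (Z : EquivariantObject A) :
    (H.descend hG).obj (Z.X⟦n⟧) ≅ H.objX (Z⟦n⟧) :=
  H.descendIso hG (Z⟦n⟧)

/-- The connecting isomorphisms of the descended functor, on underlying objects. -/
def descendShiftObj (n : ℤ) (Z : EquivariantObject A) :
    (H.descend hG).obj (Z.X⟦n⟧) ≅ ((H.descend hG).obj Z.X)⟦n⟧ :=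
  H.descendIsoShift hG n Z ≪≫ H.shiftX n Z ≪≫
    (shiftFunctor C n).mapIso (H.descendIso hG Z).symm

lemma descendShiftObj_naturality (n : ℤ) (X Y : EquivariantObject A) (f : X.X ⟶ Y.X) :
    (shiftFunctor C n ⋙ H.descend hG).map f ≫ (H.descendShiftObj hG n Y).hom =
      (H.descendShiftObj hG n X).hom ≫ (H.descend hG ⋙ shiftFunctor C n).map f := by
    obtain ⟨u, h1, h2⟩ : ∃ u : H.objX (X⟦n⟧) ⟶ H.objX (Y⟦n⟧),
        (H.descend hG).map (f⟦n⟧') ≫ (H.descendIsoShift hG n Y).hom =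
          (H.descendIsoShift hG n X).hom ≫ u ∧
        u ≫ (H.shiftX n Y).hom = (H.shiftX n X).hom ≫ (H.mapU X Y f)⟦n⟧' :=
      ⟨_, H.descendIso_naturality hG (X := X⟦n⟧) (Y := Y⟦n⟧) (f⟦n⟧'), H.mapU_shift hG n f⟩
    have h3 := H.descendIso_inv_naturality hG f
    simp only [descendShiftObj, Iso.trans_hom, Functor.mapIso_hom, Iso.symm_hom,
      Category.assoc, Functor.comp_map]
    rw [reassoc_of% h1, reassoc_of% h2, ← Functor.map_comp, ← Functor.map_comp, h3]

/-- The connecting isomorphisms of the descended functor. -/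
def descendShift (n : ℤ) :
    shiftFunctor C n ⋙ H.descend hG ≅ H.descend hG ⋙ shiftFunctor C n :=
  extendNatIso (o := fun Z : EquivariantObject A => Z.X) (retractInd A)
    (H.descendShiftObj hG n) (H.descendShiftObj_naturality hG n)

lemma descendShift_hom_app (n : ℤ) (Z : EquivariantObject A) :
    (H.descendShift hG n).hom.app Z.X = (H.descendIsoShift hG n Z).hom ≫ (H.shiftX n Z).hom ≫
      (H.descendIso hG Z).inv⟦n⟧' :=
  extendNatTrans_app_obj (o := fun Z : EquivariantObject A => Z.X) (retractInd A)
    (P := shiftFunctor C n ⋙ H.descend hG) (Q := H.descend hG ⋙ shiftFunctor C n)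
    (fun Z => (H.descendShiftObj hG n Z).hom) (H.descendShiftObj_naturality hG n) Z

lemma descend_map_f {X Y : EquivariantObject A} (a : X ⟶ Y) :
    (H.descend hG).map a.f ≫ (H.descendIso hG Y).hom =
      (H.descendIso hG X).hom ≫ H.mapX a := by
  rw [descendIso_naturality, H.mapU_f hG]

lemma descendShift_zero : H.descendShift hG 0 = Functor.CommShift.isoZero (H.descend hG) ℤ := by
  ext1
  refine natTrans_ext_equivariant A fun Z => ?_
  rw [descendShift_hom_app, shiftX_zero, Functor.CommShift.isoZero_hom_app]
  have h2 : (H.descend hG).map ((shiftFunctorZero C ℤ).hom.app Z.X) ≫ (H.descendIso hG Z).hom =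
    (H.descendIsoShift hG 0 Z).hom ≫
      H.mapX ((shiftFunctorZero (EquivariantObject A) ℤ).hom.app Z) :=
    H.descend_map_f hG ((shiftFunctorZero (EquivariantObject A) ℤ).hom.app Z)
  have h3 := (shiftFunctorZero C ℤ).inv.naturality (H.descendIso hG Z).inv
  dsimp at h3
  rw [Category.assoc, ← h3, ← reassoc_of% h2]
  simp

lemma descendShift_add (n m : ℤ) : H.descendShift hG (n + m) =
    Functor.CommShift.isoAdd (H.descendShift hG n) (H.descendShift hG m) := by
  ext1
  refine natTrans_ext_equivariant A fun Z => ?_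
  rw [descendShift_hom_app, shiftX_add, Functor.CommShift.isoAdd_hom_app]
  obtain ⟨θ, h2, h4⟩ : ∃ θ : (H.descend hG).obj (Z.X⟦n⟧⟦m⟧) ≅ H.objX ((Z⟦n⟧)⟦m⟧),
      (H.descend hG).map ((shiftFunctorAdd C n m).hom.app Z.X) ≫ θ.hom =
      (H.descendIsoShift hG (n + m) Z).hom ≫
        H.mapX ((shiftFunctorAdd (EquivariantObject A) n m).hom.app Z) ∧
      (H.descendShift hG m).hom.app (Z.X⟦n⟧) = θ.hom ≫
        (H.shiftX m (Z⟦n⟧)).hom ≫ (H.descendIsoShift hG n Z).inv⟦m⟧' :=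
    ⟨_, H.descend_map_f hG ((shiftFunctorAdd (EquivariantObject A) n m).hom.app Z),
      H.descendShift_hom_app hG m (Z⟦n⟧)⟩
  have h3 := (shiftFunctorAdd C n m).inv.naturality (H.descendIso hG Z).inv
  dsimp at h3
  rw [h4, descendShift_hom_app]
  simp only [Category.assoc, ← h3, Functor.map_comp]
  rw [← reassoc_of% h2, ← Functor.map_comp_assoc (shiftFunctor C m)
    (H.descendIsoShift hG n Z).inv, Iso.inv_hom_id]
  simp

instance : (H.descend hG).CommShift ℤ where
  commShiftIso := H.descendShift hG
  commShiftIso_zero := H.descendShift_zero hG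
  commShiftIso_add := H.descendShift_add hG

lemma descend_commShiftIso_hom_app (n : ℤ) (Z : EquivariantObject A) :
    ((H.descend hG).commShiftIso n).hom.app Z.X = (H.descendIsoShift hG n Z).hom ≫
      (H.shiftX n Z).hom ≫ (H.descendIso hG Z).inv⟦n⟧' :=
  H.descendShift_hom_app hG n Z

/-- The compatibility of the descended functor with the group action, on underlying objects. -/
def descendδObj (g : G) (Z : EquivariantObject A) :
    (H.descend hG).obj ((A.fn g).obj Z.X) ≅ (A.fn g).obj ((H.descend hG).obj Z.X) :=
  (H.descend hG).mapIso (Z.α g).symm ≪≫ H.descendIso hG Z ≪≫ (H.toFunctor.obj Z).α g ≪≫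
    (A.fn g).mapIso (H.descendIso hG Z).symm

/-- The equivariant structures of `X` and `Y` translate `F_g f` into `conj X Y g f`, and `mapU_conj`
translates back through those of `H X` and `H Y`. -/
lemma descendδObj_naturality (g : G) (X Y : EquivariantObject A) (f : X.X ⟶ Y.X) :
    (A.fn g ⋙ H.descend hG).map f ≫ (H.descendδObj hG g Y).hom =
      (H.descendδObj hG g X).hom ≫ (H.descend hG ⋙ A.fn g).map f := by
    have h1 := H.mapU_conj hG g f
    have h2 : (H.descend hG).map ((A.fn g).map f) ≫ (H.descend hG).map (Y.α g).inv =
        (H.descend hG).map (X.α g).inv ≫ (H.descend hG).map (conj X Y g f) := by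
      rw [← Functor.map_comp, ← Functor.map_comp]
      simp [conj]
    have h3 := H.descendIso_inv_naturality hG f
    have h4 : H.mapU X Y (conj X Y g f) ≫ ((H.toFunctor.obj Y).α g).hom =
        ((H.toFunctor.obj X).α g).hom ≫ (A.fn g).map (H.mapU X Y f) := by
      rw [h1, conj]
      simp
    simp only [Functor.comp_map, descendδObj, Iso.trans_hom, Functor.mapIso_hom, Iso.symm_hom,
      Category.assoc]
    rw [reassoc_of% h2, reassoc_of% descendIso_naturality, reassoc_of% h4, ← Functor.map_comp,
      ← Functor.map_comp, h3]

/-- The compatibility of the descended functor with the group action. -/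
def descendδ (g : G) : A.fn g ⋙ H.descend hG ≅ H.descend hG ⋙ A.fn g :=
  extendNatIso (o := fun Z : EquivariantObject A => Z.X) (retractInd A)
    (H.descendδObj hG g) (H.descendδObj_naturality hG g)

lemma map_α_descendδ (g : G) (Z : EquivariantObject A) :
    (H.descend hG).map (Z.α g).hom ≫ (H.descendδ hG g).hom.app Z.X =
      (H.descendIso hG Z).hom ≫ ((H.toFunctor.obj Z).α g).hom ≫
        (A.fn g).map (H.descendIso hG Z).inv := by
  have h : (H.descendδ hG g).hom.app Z.X = (H.descendδObj hG g Z).hom :=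
    extendNatTrans_app_obj (o := fun Z : EquivariantObject A => Z.X) (retractInd A)
      (P := A.fn g ⋙ H.descend hG) (Q := H.descend hG ⋙ A.fn g) (fun Z => (H.descendδObj hG g Z).hom)
      (H.descendδObj_naturality hG g) Z
  rw [h, descendδObj]
  simp [← Functor.map_comp_assoc]

/-- Both sides are natural, so underlying objects of equivariant objects suffice. There,
precomposing with the images of `α g` and `F_g (α h)` reduces the identity to the multiplicativity
of the equivariant structures of `Z` and of `H Z`. -/
lemma descendδ_mul (g h m : G) (e : g * h = m) (X : C) :
    (H.descend hG).map ((A.ε g h m e).hom.app X) ≫ (H.descendδ hG m).hom.app X =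
      (H.descendδ hG g).hom.app ((A.fn h).obj X) ≫
        (A.fn g).map ((H.descendδ hG h).hom.app X) ≫
          (A.ε g h m e).hom.app ((H.descend hG).obj X) := by
  have key : Functor.whiskerRight (A.ε g h m e).hom (H.descend hG) ≫ (H.descendδ hG m).hom =
      Functor.whiskerLeft (A.fn h) (H.descendδ hG g).hom ≫
        Functor.whiskerRight (H.descendδ hG h).hom (A.fn g) ≫
          Functor.whiskerLeft (H.descend hG) (A.ε g h m e).hom := by
    refine natTrans_ext_equivariant A fun Z => ?_
    dsimp
    have h1 := (H.descendδ hG g).hom.naturality (Z.α h).hom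
    have h2 := (A.ε g h m e).hom.naturality (H.descendIso hG Z).inv
    dsimp at h1 h2
    rw [← cancel_epi ((H.descend hG).map ((A.fn g).map (Z.α h).hom)),
      ← cancel_epi ((H.descend hG).map (Z.α g).hom), reassoc_of% h1, reassoc_of% (map_α_descendδ),
      ← Functor.map_comp_assoc (A.fn g) ((H.descend hG).map _), map_α_descendδ,
      ← Functor.map_comp_assoc, ← Functor.map_comp_assoc, Category.assoc, ← Z.α_mul g h m e,
      map_α_descendδ, (H.toFunctor.obj Z).α_mul g h m e]
    simp only [Functor.map_comp, Category.assoc, h2]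
    rw [← Functor.map_comp_assoc (A.fn g) (H.descendIso hG Z).inv, Iso.inv_hom_id]
    simp
  exact NatTrans.congr_app key X

instance (g : G) : NatTrans.CommShift (H.descendδ hG g).hom ℤ where
  shift_comm n := by
    refine natTrans_ext_equivariant A fun Z => ?_
    rw [NatTrans.comp_app, NatTrans.comp_app, Functor.commShiftIso_comp_hom_app,
      Functor.commShiftIso_comp_hom_app]
    dsimp
    -- The structure map of `Z⟦n⟧` is spelled out so that `map_α_descendδ` can be compared at `Z⟦n⟧`
    -- and at `Z`; the link between the two is that `shiftX` is equivariant.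
    have h1 : (H.descend hG).map ((Z.α g).hom⟦n⟧' ≫ ((A.fn g).commShiftIso n).inv.app Z.X) ≫
        (H.descendδ hG g).hom.app (Z.X⟦n⟧) =
        (H.descendIsoShift hG n Z).hom ≫ ((H.toFunctor.obj (Z⟦n⟧)).α g).hom ≫
        (A.fn g).map (H.descendIsoShift hG n Z).inv := H.map_α_descendδ hG g (Z⟦n⟧)
    have h2 := (H.descend hG).commShiftIso_hom_naturality (Z.α g).hom n
    have h3 : (A.fn g).map (H.descendIsoShift hG n Z).inv ≫
        (A.fn g).map (((H.descend hG).commShiftIso n).hom.app Z.X) =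
        (A.fn g).map (H.shiftX n Z).hom ≫ (A.fn g).map ((H.descendIso hG Z).inv⟦n⟧') := by
      have h3 : (H.descendIsoShift hG n Z).inv ≫ ((H.descend hG).commShiftIso n).hom.app Z.X =
          (H.shiftX n Z).hom ≫ (H.descendIso hG Z).inv⟦n⟧' := by
        rw [descend_commShiftIso_hom_app]
        exact Iso.inv_hom_id_assoc _ _
      exact ((A.fn g).map_comp _ _).symm.trans
        ((congrArg (A.fn g).map h3).trans ((A.fn g).map_comp _ _))
    have h4 := (A.fn g).commShiftIso_hom_naturality (H.descendIso hG Z).inv n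
    have h5 := H.shiftX_comm n Z g
    rw [← cancel_epi ((H.descend hG).map ((Z.α g).hom⟦n⟧' ≫
      ((A.fn g).commShiftIso n).inv.app Z.X)), reassoc_of% h1, reassoc_of% h3, h4,
      ← reassoc_of% h5, Iso.inv_hom_id_app_assoc, Functor.map_comp, Category.assoc,
      Category.assoc, ← Functor.map_comp_assoc (H.descend hG) (((A.fn g).commShiftIso n).inv.app Z.X),
      Iso.inv_hom_id_app]
    simp only [CategoryTheory.Functor.map_id, Category.id_comp, reassoc_of% h2]
    rw [← Functor.map_comp, map_α_descendδ, descend_commShiftIso_hom_app]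
    simp [← Functor.map_comp]

end EquivariantEndofunctor

end DescentFunctor

/-! ### Retracts and finite sums of distinguished triangles -/

section Triangles

variable {T : Type u} [Category.{v} T] [Preadditive T] [HasZeroObject T] [HasShift T ℤ]
  [∀ n : ℤ, (shiftFunctor T n).Additive] [Pretriangulated T]

/-- A retract of a distinguished triangle is distinguished. -/
lemma distinguished_of_retract {Δ Δ' : Triangle T} (ρ : Retract Δ Δ') (h : Δ' ∈ distTriang T) :
    Δ ∈ distTriang T := by
  have e₁ : ρ.i.hom₁ ≫ ρ.r.hom₁ = 𝟙 _ := congrArg TriangleMorphism.hom₁ ρ.retract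
  have e₂ : ρ.i.hom₂ ≫ ρ.r.hom₂ = 𝟙 _ := congrArg TriangleMorphism.hom₂ ρ.retract
  have e₃ : ρ.i.hom₃ ≫ ρ.r.hom₃ = 𝟙 _ := congrArg TriangleMorphism.hom₃ ρ.retract
  have i₁ := ρ.i.comm₁
  have i₂ := ρ.i.comm₂
  have i₃ := ρ.i.comm₃
  have r₁ := ρ.r.comm₁
  have r₂ := ρ.r.comm₂
  have r₃ := ρ.r.comm₃
  -- Exactness of `Hom(W, -)` at the second and third objects passes from `Δ'` to its retract `Δ`.
  have ex₂ {W : T} (x : W ⟶ Δ.obj₂) (hx : x ≫ Δ.mor₂ = 0) : ∃ y, x = y ≫ Δ.mor₁ := by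
    obtain ⟨y, hy⟩ := Triangle.coyoneda_exact₂ _ h (x ≫ ρ.i.hom₂) (by
      rw [Category.assoc, ← i₂, reassoc_of% hx, zero_comp])
    refine ⟨y ≫ ρ.r.hom₁, ?_⟩
    rw [Category.assoc, ← r₁, ← reassoc_of% hy, e₂, Category.comp_id]
  have ex₃ {W : T} (x : W ⟶ Δ.obj₃) (hx : x ≫ Δ.mor₃ = 0) : ∃ y, x = y ≫ Δ.mor₂ := by
    obtain ⟨y, hy⟩ := Triangle.coyoneda_exact₃ _ h (x ≫ ρ.i.hom₃) (by
      rw [Category.assoc, ← i₃, reassoc_of% hx, zero_comp])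
    refine ⟨y ≫ ρ.r.hom₂, ?_⟩
    rw [Category.assoc, ← r₂, ← reassoc_of% hy, e₃, Category.comp_id]
  have z₁₂ : Δ.mor₁ ≫ Δ.mor₂ = 0 := by
    rw [← Category.comp_id Δ.mor₂, ← e₃, reassoc_of% i₂, reassoc_of% i₁,
      comp_distTriang_mor_zero₁₂_assoc _ h, zero_comp, comp_zero]
  have z₃₁ : Δ.mor₃ ≫ Δ.mor₁⟦1⟧' = 0 := by
    have h1 : Δ.mor₁⟦(1 : ℤ)⟧' = (ρ.i.hom₁)⟦1⟧' ≫ Δ'.mor₁⟦1⟧' ≫ (ρ.r.hom₂)⟦1⟧' := by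
      rw [← Functor.map_comp, ← Functor.map_comp, ← reassoc_of% i₁, e₂, Category.comp_id]
    rw [h1, reassoc_of% i₃, comp_distTriang_mor_zero₃₁_assoc _ h, zero_comp, comp_zero]
  -- A cone `Z` of the first morphism of `Δ` is compared with `Δ.obj₃` by passing through `Δ'`; the
  -- resulting `t` is shown to be a monomorphism with a section.
  obtain ⟨Z, v, w, hZ⟩ := distinguished_cocone_triangle Δ.mor₁
  obtain ⟨c, hc₂, hc₃⟩ : ∃ c : Z ⟶ Δ'.obj₃, v ≫ c = ρ.i.hom₂ ≫ Δ'.mor₂ ∧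
      w ≫ ρ.i.hom₁⟦1⟧' = c ≫ Δ'.mor₃ := complete_distinguished_triangle_morphism _ _ hZ h ρ.i.hom₁ ρ.i.hom₂ i₁
  obtain ⟨t, ht⟩ : ∃ t : Z ⟶ Δ.obj₃, t = c ≫ ρ.r.hom₃ := ⟨_, rfl⟩
  have ht₂ : v ≫ t = Δ.mor₂ := by
    rw [ht, reassoc_of% hc₂, r₂, reassoc_of% e₂]
  have ht₃ : w = t ≫ Δ.mor₃ := by
    rw [ht, Category.assoc, ← r₃, ← reassoc_of% hc₃, ← Functor.map_comp, e₁,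
      CategoryTheory.Functor.map_id, Category.comp_id]
  have hmono : Mono t := by
    rw [Preadditive.mono_iff_cancel_zero]
    intro W x hx
    obtain ⟨y, hy⟩ : ∃ y : W ⟶ Δ.obj₂, x = y ≫ v := Triangle.coyoneda_exact₃ _ hZ x (by
      change x ≫ w = 0
      rw [ht₃, reassoc_of% hx, zero_comp])
    obtain ⟨y', hy'⟩ := ex₂ y (by rw [← ht₂, ← Category.assoc, ← hy, hx])
    have : Δ.mor₁ ≫ v = 0 := comp_distTriang_mor_zero₁₂ _ hZ
    rw [hy, hy', Category.assoc, this, comp_zero]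
  obtain ⟨s, hs⟩ : ∃ s : Δ.obj₃ ⟶ Z, s ≫ t = 𝟙 _ := by
    obtain ⟨s, hs⟩ : ∃ s : Δ.obj₃ ⟶ Z, Δ.mor₃ = s ≫ w :=
      Triangle.coyoneda_exact₁ _ hZ Δ.mor₃ z₃₁
    obtain ⟨y, hy⟩ := ex₃ (𝟙 _ - s ≫ t) (by
      rw [Preadditive.sub_comp, Category.id_comp, Category.assoc, ← ht₃, ← hs, sub_self])
    -- The lift `s` of `Δ.mor₃` through `w` is a section of `t` only up to an error killed by
    -- `Δ.mor₃`; the error factors through `Δ.mor₂ = v ≫ t` and is corrected by `y ≫ v`.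
    refine ⟨s + y ≫ v, ?_⟩
    rw [Preadditive.add_comp, Category.assoc, ht₂, ← hy]
    abel
  have hs' : t ≫ s = 𝟙 _ := by
    rw [← cancel_mono t, Category.assoc, hs, Category.comp_id, Category.id_comp]
  have k₂ : Δ.mor₂ ≫ s = v := by rw [← ht₂, Category.assoc, hs', Category.comp_id]
  have k₃ : Δ.mor₃ = s ≫ w := by rw [ht₃, reassoc_of% hs]
  exact isomorphic_distinguished _ hZ _ (Triangle.isoMk _ _ (Iso.refl _) (Iso.refl _)
    ⟨s, t, hs, hs'⟩ ((Category.comp_id _).trans (Category.id_comp _).symm)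
    (k₂.trans (Category.id_comp _).symm)
    ((congrArg (Δ.mor₃ ≫ ·) (CategoryTheory.Functor.map_id _ _)).trans
      ((Category.comp_id _).trans k₃)))

/-- The direct sum of a finite family of triangles. -/
def biproductTriangle {J : Type*} [Finite J] (Δ : J → Triangle T) : Triangle T :=
  Triangle.mk (biproduct.map fun j => (Δ j).mor₁) (biproduct.map fun j => (Δ j).mor₂)
    (biproduct.desc fun j => (Δ j).mor₃ ≫ (biproduct.ι (fun j => (Δ j).obj₁) j)⟦(1 : ℤ)⟧')

lemma biproductTriangle_mor₃_map_π {J : Type*} [Finite J] (Δ : J → Triangle T) (j : J) :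
    (biproduct.desc fun j => (Δ j).mor₃ ≫ (biproduct.ι (fun j => (Δ j).obj₁) j)⟦(1 : ℤ)⟧') ≫
      (biproduct.π (fun j => (Δ j).obj₁) j)⟦(1 : ℤ)⟧' =
    biproduct.π (fun j => (Δ j).obj₃) j ≫ (Δ j).mor₃ := by
  apply biproduct.hom_ext'
  intro i
  rw [biproduct.ι_desc_assoc, Category.assoc, ← Functor.map_comp]
  by_cases h : i = j
  · subst h
    simp
  · rw [biproduct.ι_π_ne _ h, biproduct.ι_π_ne_assoc _ h, Functor.map_zero, comp_zero, zero_comp]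

/-- The projections of a direct sum of triangles. -/
def biproductTriangleπ {J : Type*} [Finite J] (Δ : J → Triangle T) (j : J) :
    biproductTriangle Δ ⟶ Δ j where
  hom₁ := biproduct.π _ j
  hom₂ := biproduct.π _ j
  hom₃ := biproduct.π _ j
  comm₁ := biproduct.map_π (fun j => (Δ j).mor₁) j
  comm₂ := biproduct.map_π (fun j => (Δ j).mor₂) j
  comm₃ := biproductTriangle_mor₃_map_π Δ j

lemma biproduct_isIso_lift {J : Type*} [Finite J] (Q : J → T) :
    IsIso (Pi.lift fun j => biproduct.π Q j) := by
  have h : (biproduct.isoProduct Q).hom = Pi.lift fun j => biproduct.π Q j := by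
    ext j
    simp
  rw [← h]
  infer_instance

/-- Products of distinguished triangles are distinguished, and the projections identify the direct
sum with the product. -/
lemma biproductTriangle_distinguished {J : Type*} [Finite J] (Δ : J → Triangle T)
    (h : ∀ j, Δ j ∈ distTriang T) : biproductTriangle Δ ∈ distTriang T := by
  let φ := productTriangle.lift Δ (biproductTriangleπ Δ)
  have := Triangle.isIso_of_isIsos φ (biproduct_isIso_lift fun j => (Δ j).obj₁)
    (biproduct_isIso_lift fun j => (Δ j).obj₂) (biproduct_isIso_lift fun j => (Δ j).obj₃)
  exact isomorphic_distinguished _ (productTriangle_distinguished Δ h) _ (asIso φ)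

end Triangles

/-! ### Induction of triangles -/

section Induction

variable {k : Type w} [Field k] {G : Type*} [Group G] [Finite G] {T : Type u} [Category.{v} T]
  [Preadditive T] [Linear k T] [HasZeroObject T] [HasShift T ℤ]
  [∀ n : ℤ, (shiftFunctor T n).Additive] [Pretriangulated T] (A : TriangleAction k G T)

namespace EquivariantObject

lemma biproduct_map_indα {X Y : T} (f : X ⟶ Y) (g : G) :
    (biproduct.map fun h => (A.fn h).map f) ≫ (indα A Y g).hom =
      (indα A X g).hom ≫ (A.fn g).map (biproduct.map fun h => (A.fn h).map f) := by
  apply biproduct.hom_ext'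
  intro p
  have e : g * (g⁻¹ * p) = p := by simp
  have h1 := ι_indα A X g _ p e
  have h2 := ι_indα A Y g _ p e
  have h3 := (A.ε g (g⁻¹ * p) p e).inv.naturality f
  have h4 : (A.fn g).map (biproduct.ι (fun h => (A.fn h).obj X) (g⁻¹ * p)) ≫
      (A.fn g).map (biproduct.map fun h => (A.fn h).map f) =
      (A.fn g).map ((A.fn (g⁻¹ * p)).map f) ≫
        (A.fn g).map (biproduct.ι (fun h => (A.fn h).obj Y) (g⁻¹ * p)) := by
    rw [← Functor.map_comp, ← Functor.map_comp, biproduct.ι_map]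
  rw [biproduct.ι_map_assoc, h2, reassoc_of% h3, reassoc_of% h1, h4]

/-- The comparison of induction with the shift, on underlying objects. -/
def indShiftMap (X : T) (n : ℤ) :
    (⨁ fun h => (A.fn h).obj (X⟦n⟧)) ⟶ (⨁ fun h => (A.fn h).obj X)⟦n⟧ :=
  biproduct.desc (f := fun h => (A.fn h).obj (X⟦n⟧))
    fun h => ((A.fn h).commShiftIso n).hom.app X ≫ (biproduct.ι (fun h => (A.fn h).obj X) h)⟦n⟧'

lemma ι_indShiftMap (X : T) (n : ℤ) (h : G) :
    biproduct.ι (fun h => (A.fn h).obj (X⟦n⟧)) h ≫ indShiftMap A X n =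
      ((A.fn h).commShiftIso n).hom.app X ≫ (biproduct.ι (fun h => (A.fn h).obj X) h)⟦n⟧' :=
  biproduct.ι_desc _ _

lemma indShift_comm (X : T) (n : ℤ) (g : G) :
    indShiftMap A X n ≫
        (indα A X g).hom⟦n⟧' ≫ ((A.fn g).commShiftIso n).inv.app _ =
      (indα A (X⟦n⟧) g).hom ≫ (A.fn g).map (indShiftMap A X n) := by
  apply biproduct.hom_ext'
  intro p
  have e : g * (g⁻¹ * p) = p := by simp
  have h1 := ι_indα A (X⟦n⟧) g _ p e
  have h2 := ι_indα A X g _ p e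
  have h3 := NatTrans.shift_app_comm (A.ε g (g⁻¹ * p) p e).inv n X
  rw [Functor.commShiftIso_comp_hom_app] at h3
  have h4 := (A.fn g).commShiftIso_inv_naturality
    (biproduct.ι (fun h => (A.fn h).obj X) (g⁻¹ * p)) n
  rw [reassoc_of% h1, ← Functor.map_comp, ι_indShiftMap, reassoc_of% (ι_indShiftMap),
    ← Functor.map_comp_assoc, h2, Functor.map_comp,
    Category.assoc, reassoc_of% h3, h4]
  simp

/-- Induction on morphisms. -/
def indMap {X Y : T} (f : X ⟶ Y) : ind A X ⟶ ind A Y where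
  f := biproduct.map fun h => (A.fn h).map f
  comm g := biproduct_map_indα A f g

/-- The comparison of induction with the shift. -/
def indShift (X : T) (n : ℤ) : ind A (X⟦n⟧) ⟶ (ind A X)⟦n⟧ where
  f := indShiftMap A X n
  comm g := indShift_comm A X n g

/-- Induction of triangles. -/
def indTriangle (Δ : Triangle T) : Triangle (EquivariantObject A) :=
  Triangle.mk (indMap A Δ.mor₁) (indMap A Δ.mor₂) (indMap A Δ.mor₃ ≫ indShift A Δ.obj₁ 1)

lemma forgetTriangle_indTriangle (Δ : Triangle T) : forgetTriangle A (indTriangle A Δ) =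
    biproductTriangle fun h => (A.fn h).mapTriangle.obj Δ := by
  have h : (biproduct.map fun h => (A.fn h).map Δ.mor₃) ≫ indShiftMap A Δ.obj₁ 1 =
      biproduct.desc fun h => ((A.fn h).map Δ.mor₃ ≫ ((A.fn h).commShiftIso 1).hom.app Δ.obj₁) ≫
        (biproduct.ι (fun h => (A.fn h).obj Δ.obj₁) h)⟦(1 : ℤ)⟧' := by
    apply biproduct.hom_ext'
    intro p
    rw [biproduct.ι_map_assoc, ι_indShiftMap, biproduct.ι_desc, Category.assoc]
  exact congrArg (Triangle.mk (biproduct.map fun h => (A.fn h).map Δ.mor₁)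
    (biproduct.map fun h => (A.fn h).map Δ.mor₂)) h

lemma indTriangle_exact {Δ : Triangle T} (h : Δ ∈ distTriang T) :
    indTriangle A Δ ∈ HasExactTriangles.exact (C := EquivariantObject A) := by
  change forgetTriangle A (indTriangle A Δ) ∈ distTriang T
  rw [forgetTriangle_indTriangle]
  exact biproductTriangle_distinguished _ fun g => (A.F g).map_exact Δ h

lemma retractSum_i_naturality {X Y : T} (f : X ⟶ Y) :
    f ≫ (retractSum A Y).i = (retractSum A X).i ≫ biproduct.map fun h => (A.fn h).map f := by
  have h := A.unitIso.hom.naturality f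
  dsimp at h
  rw [retractSum, retractSum, reassoc_of% h, Category.assoc, biproduct.ι_map]

lemma retractSum_r_naturality {X Y : T} (f : X ⟶ Y) :
    (biproduct.map fun h => (A.fn h).map f) ≫ (retractSum A Y).r = (retractSum A X).r ≫ f := by
  have h := A.unitIso.inv.naturality f
  dsimp at h
  rw [retractSum, retractSum, Category.assoc, ← h, biproduct.map_π_assoc]

/-- Every triangle is a retract of the triangle underlying its induced triangle. -/
def retractBiproductTriangle (Δ : Triangle T) :
    Retract Δ (biproductTriangle fun h => (A.fn h).mapTriangle.obj Δ) where
  i :=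
    { hom₁ := (retractSum A Δ.obj₁).i
      hom₂ := (retractSum A Δ.obj₂).i
      hom₃ := (retractSum A Δ.obj₃).i
      comm₁ := retractSum_i_naturality A Δ.mor₁
      comm₂ := retractSum_i_naturality A Δ.mor₂
      comm₃ := by
        have h1 := A.unitIso_hom_app_shift Δ.obj₁ 1
        have h2 := A.unitIso.hom.naturality Δ.mor₃
        dsimp at h2
        change Δ.mor₃ ≫ (A.unitIso.hom.app Δ.obj₁ ≫
            biproduct.ι (fun h => (A.fn h).obj Δ.obj₁) 1)⟦(1 : ℤ)⟧' =
          (A.unitIso.hom.app Δ.obj₃ ≫ biproduct.ι (fun h => (A.fn h).obj Δ.obj₃) 1) ≫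
            biproduct.desc fun h =>
              ((A.fn h).map Δ.mor₃ ≫ ((A.fn h).commShiftIso 1).hom.app Δ.obj₁) ≫
                (biproduct.ι (fun h => (A.fn h).obj Δ.obj₁) h)⟦(1 : ℤ)⟧'
        rw [Category.assoc, biproduct.ι_desc, Functor.map_comp, ← h1]
        simp only [Category.assoc, reassoc_of% h2] }
  r :=
    { hom₁ := (retractSum A Δ.obj₁).r
      hom₂ := (retractSum A Δ.obj₂).r
      hom₃ := (retractSum A Δ.obj₃).r
      comm₁ := retractSum_r_naturality A Δ.mor₁
      comm₂ := retractSum_r_naturality A Δ.mor₂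
      comm₃ := by
        have h1 := A.unitIso_hom_app_shift Δ.obj₁ 1
        have h2 := A.unitIso.inv.naturality Δ.mor₃
        have h3 : (biproduct.desc fun h =>
              ((A.fn h).map Δ.mor₃ ≫ ((A.fn h).commShiftIso 1).hom.app Δ.obj₁) ≫
                (biproduct.ι (fun h => (A.fn h).obj Δ.obj₁) h)⟦(1 : ℤ)⟧') ≫
            (biproduct.π (fun h => (A.fn h).obj Δ.obj₁) 1)⟦(1 : ℤ)⟧' =
          biproduct.π (fun h => (A.fn h).obj Δ.obj₃) 1 ≫
            ((A.fn 1).map Δ.mor₃ ≫ ((A.fn 1).commShiftIso 1).hom.app Δ.obj₁) :=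
          biproductTriangle_mor₃_map_π (fun h => (A.fn h).mapTriangle.obj Δ) 1
        dsimp at h2
        change (biproduct.desc fun h =>
              ((A.fn h).map Δ.mor₃ ≫ ((A.fn h).commShiftIso 1).hom.app Δ.obj₁) ≫
                (biproduct.ι (fun h => (A.fn h).obj Δ.obj₁) h)⟦(1 : ℤ)⟧') ≫
            (biproduct.π (fun h => (A.fn h).obj Δ.obj₁) 1 ≫ A.unitIso.inv.app Δ.obj₁)⟦(1 : ℤ)⟧' =
          (biproduct.π (fun h => (A.fn h).obj Δ.obj₃) 1 ≫ A.unitIso.inv.app Δ.obj₃) ≫ Δ.mor₃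
        have h4 : ((A.fn 1).commShiftIso 1).hom.app Δ.obj₁ ≫
            (A.unitIso.inv.app Δ.obj₁)⟦(1 : ℤ)⟧' = A.unitIso.inv.app (Δ.obj₁⟦(1 : ℤ)⟧) := by
          rw [← cancel_epi (A.unitIso.hom.app _), reassoc_of% h1, ← Functor.map_comp,
            Iso.hom_inv_id_app, Iso.hom_inv_id_app]
          simp
        rw [Functor.map_comp]
        simp only [Category.assoc] at h3 ⊢
        rw [reassoc_of% h3, h4, h2] }
  retract := by
    ext
    exacts [(retractSum A Δ.obj₁).retract, (retractSum A Δ.obj₂).retract,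
      (retractSum A Δ.obj₃).retract]

/-- Every triangle is a retract of the triangle underlying its induced triangle. -/
def retractIndTriangle (Δ : Triangle T) : Retract Δ (forgetTriangle A (indTriangle A Δ)) :=
  (retractBiproductTriangle A Δ).trans
    (Retract.ofIso (eqToIso (forgetTriangle_indTriangle A Δ).symm))

end EquivariantObject

end Induction

/-! ### Exactness of the descended functor; it lifts the given one -/

section DescentExact

variable {k : Type w} [Field k] {G : Type*} [Group G] [Fintype G] [Fintype (G →* kˣ)]
  {T : Type u} [Category.{v} T]
  [Preadditive T] [Linear k T] [HasZeroObject T] [HasShift T ℤ]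
  [∀ n : ℤ, (shiftFunctor T n).Additive] [∀ n : ℤ, (shiftFunctor T n).Linear k]
  [Pretriangulated T] [IsIdempotentComplete T] {A : TriangleAction k G T}

open EquivariantObject

namespace EquivariantEndofunctor

variable (H : EquivariantEndofunctor (dualAction A)) (hG : SplitsOver k G)

lemma commShiftIso_hom_app_descendIso (n : ℤ) (Z : EquivariantObject A) :
    ((H.descend hG).commShiftIso n).hom.app Z.X ≫ (H.descendIso hG Z).hom⟦n⟧' =
      (H.descendIsoShift hG n Z).hom ≫ (H.shiftX n Z).hom := by
  rw [descend_commShiftIso_hom_app]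
  simp only [Category.assoc]
  rw [← Functor.map_comp, Iso.inv_hom_id, CategoryTheory.Functor.map_id, Category.comp_id]

lemma descend_mapTriangle_forgetTriangle_exact (Δ : Triangle (EquivariantObject A))
    (h : Δ ∈ HasExactTriangles.exact (C := EquivariantObject A)) :
    (H.descend hG).mapTriangle.obj (forgetTriangle A Δ) ∈ distTriang T := by
  have h' : forgetTriangle A (H.toFunctor.mapTriangle.obj Δ) ∈ distTriang T := H.map_exact Δ h
  refine isomorphic_distinguished _ h' _ (Triangle.isoMk _ _ (H.descendIso hG Δ.obj₁)
    (H.descendIso hG Δ.obj₂) (H.descendIso hG Δ.obj₃) (H.descend_map_f hG Δ.mor₁)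
    (H.descend_map_f hG Δ.mor₂) ?_)
  have h1 : (H.descend hG).map Δ.mor₃.f ≫ (H.descendIsoShift hG 1 Δ.obj₁).hom =
    (H.descendIso hG Δ.obj₃).hom ≫ H.mapX Δ.mor₃ := H.descend_map_f hG Δ.mor₃
  have h2 : ((H.descend hG).map Δ.mor₃.f ≫
      ((H.descend hG).commShiftIso 1).hom.app Δ.obj₁.X) ≫ (H.descendIso hG Δ.obj₁).hom⟦1⟧' =
      (H.descendIso hG Δ.obj₃).hom ≫ H.mapX Δ.mor₃ ≫ (H.shiftX 1 Δ.obj₁).hom := by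
    refine (Category.assoc _ _ _).trans ((congrArg (_ ≫ ·)
      (H.commShiftIso_hom_app_descendIso hG 1 Δ.obj₁)).trans ?_)
    exact (Category.assoc _ _ _).symm.trans
      ((congrArg (· ≫ (H.shiftX 1 Δ.obj₁).hom) h1).trans (Category.assoc _ _ _))
  exact h2

/-- The equivariant triangle endofunctor of `T` obtained from an equivariant triangle endofunctor
of the category of equivariant objects. -/
def descendEndofunctor : EquivariantEndofunctor A where
  toFunctor := H.descend hG
  additive := inferInstance
  linear := inferInstance
  commShift := inferInstance
  -- Exactness is known on triangles that underlie exact triangles of `T^G`; an arbitrary `Δ` is a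
  -- retract of the one underlying its induced triangle.
  map_exact Δ h := distinguished_of_retract ((retractIndTriangle A Δ).map (H.descend hG).mapTriangle)
    (H.descend_mapTriangle_forgetTriangle_exact hG _ (indTriangle_exact A h))
  δ := H.descendδ hG
  δ_commShift _ := inferInstance
  δ_mul := H.descendδ_mul hG

/-- The equivariantization of the descended functor is the original functor. -/
def equivariantFunctorDescendIso :
    equivariantFunctor (H.descendEndofunctor hG) ≅ H.toFunctor :=
  NatIso.ofComponents (fun Z => isoMk (H.descendIso hG Z) fun g => by
      have h := H.map_α_descendδ hG g Z
      have h' : (H.descendIso hG Z).hom ≫ ((H.toFunctor.obj Z).α g).hom =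
          ((H.descend hG).map (Z.α g).hom ≫ (H.descendδ hG g).hom.app Z.X) ≫
            (A.fn g).map (H.descendIso hG Z).hom := by
        rw [h]
        simp [← Functor.map_comp]
      exact h')
    (fun a => EquivariantObject.hom_ext (H.descend_map_f hG a))

lemma equivariantization_descendEndofunctor :
    (H.descendEndofunctor hG).equivariantization.Isomorphic H := by
  refine ⟨H.equivariantFunctorDescendIso hG, ⟨fun n => ?_⟩, fun χ Z => ?_⟩
  · ext Z : 2
    exact EquivariantObject.hom_ext (H.commShiftIso_hom_app_descendIso hG n Z)
  -- The identity of `Z.X`, read as a morphism from `F_χ Z` to `Z`, has weight `χ`, and `mapU` sends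
  -- it to `δ χ`. Naturality at this morphism is the required compatibility.
  · have h1 := H.descendIso_naturality hG (X := (twist A χ).obj Z) (Y := Z) (𝟙 Z.X)
    have h2 : H.mapU ((twist A χ).obj Z) Z (𝟙 Z.X) = (H.δX χ Z).hom := by
      have h3 := H.mapU_base hG (χ := χ) (X := (twist A χ).obj Z) (Y := Z) (𝟙 _)
      refine h3.trans ?_
      rw [twMap, mapX_id, Category.id_comp]
    have h4 : (H.descendIso hG Z).hom =
        (H.descendIso hG ((twist A χ).obj Z)).hom ≫ (H.δX χ Z).hom := by
      rw [← h2, ← h1]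
      exact (((congrArg (· ≫ (H.descendIso hG Z).hom) ((H.descend hG).map_id Z.X))).trans
        (Category.id_comp _)).symm
    exact EquivariantObject.hom_ext ((Category.id_comp _).trans h4)

end EquivariantEndofunctor

end DescentExact

/-! ### Quasi-inverses of equivariant autoequivalences -/

section Inverse

variable {k : Type w} [Field k] {G : Type*} [Group G] {C : Type u} [Category.{v} C]
  [Preadditive C] [Linear k C] [HasShift C ℤ] [HasExactTriangles C] {A : TriangleAction k G C}

namespace EquivariantAutoequivalence

variable (E : EquivariantAutoequivalence A)

/-- The quasi-inverse of an equivariant triangle autoequivalence. -/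
abbrev inv : C ⥤ C := E.toFunctor.asEquivalence.inverse

instance : E.toFunctor.asEquivalence.functor.CommShift ℤ := E.commShift
instance : E.toFunctor.asEquivalence.functor.Additive := E.additive
instance : E.toFunctor.asEquivalence.functor.Linear k := E.linear

instance : E.inv.CommShift ℤ := E.toFunctor.asEquivalence.commShiftInverse ℤ

instance : E.toFunctor.asEquivalence.CommShift ℤ :=
  E.toFunctor.asEquivalence.commShift_of_functor ℤ

/-- The unit of the equivalence given by an equivariant triangle autoequivalence. -/
def unitIso : 𝟭 C ≅ E.toFunctor ⋙ E.inv := E.toFunctor.asEquivalence.unitIso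

/-- The counit of the equivalence given by an equivariant triangle autoequivalence. -/
def counitIso : E.inv ⋙ E.toFunctor ≅ 𝟭 C := E.toFunctor.asEquivalence.counitIso

instance : NatTrans.CommShift E.unitIso.hom ℤ :=
  inferInstanceAs (NatTrans.CommShift E.toFunctor.asEquivalence.unitIso.hom ℤ)

instance : NatTrans.CommShift E.counitIso.hom ℤ :=
  inferInstanceAs (NatTrans.CommShift E.toFunctor.asEquivalence.counitIso.hom ℤ)

lemma map_unitIso_inv_app (X : C) :
    E.toFunctor.map (E.unitIso.inv.app X) = E.counitIso.hom.app (E.toFunctor.obj X) :=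
  (E.toFunctor.asEquivalence.counit_app_functor X).symm

lemma map_inv_map {X Y : C} (f : X ⟶ Y) : E.toFunctor.map (E.inv.map f) =
    E.counitIso.hom.app X ≫ f ≫ E.counitIso.inv.app Y :=
  E.toFunctor.asEquivalence.fun_inv_map X Y f

/-- The compatibility of the quasi-inverse with the group action. -/
def invδ (g : G) : A.fn g ⋙ E.inv ≅ E.inv ⋙ A.fn g :=
  (Functor.leftUnitor _).symm ≪≫ Functor.isoWhiskerRight E.counitIso.symm _ ≪≫
    Functor.associator _ _ _ ≪≫
    Functor.isoWhiskerLeft E.inv ((Functor.associator _ _ _).symm ≪≫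
      Functor.isoWhiskerRight (E.δ g).symm E.inv ≪≫ Functor.associator _ _ _ ≪≫
      Functor.isoWhiskerLeft (A.fn g) E.unitIso.symm ≪≫ Functor.rightUnitor _)

instance (g : G) : NatTrans.CommShift (E.invδ g).hom ℤ :=
  inferInstanceAs (NatTrans.CommShift ((Functor.leftUnitor _).inv ≫
    Functor.whiskerRight E.counitIso.inv _ ≫ (Functor.associator _ _ _).hom ≫
    Functor.whiskerLeft E.inv ((Functor.associator _ _ _).inv ≫
      Functor.whiskerRight (E.δ g).inv E.inv ≫ (Functor.associator _ _ _).hom ≫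
      Functor.whiskerLeft (A.fn g) E.unitIso.inv ≫ (Functor.rightUnitor _).hom)) ℤ)

/-- Describes `invδ` by its image under the faithful functor `E`, up to `δ`; identities for `invδ`
are thereby reduced to those for `δ`. -/
lemma map_invδ_hom_app (g : G) (X : C) : E.toFunctor.map ((E.invδ g).hom.app X) ≫
    (E.δ g).hom.app (E.inv.obj X) =
      E.counitIso.hom.app ((A.fn g).obj X) ≫ (A.fn g).map (E.counitIso.inv.app X) := by
  have h := E.counitIso.hom.naturality ((E.δ g).inv.app (E.inv.obj X))
  dsimp at h
  simp only [invδ, Iso.trans_hom, NatTrans.comp_app, Functor.isoWhiskerLeft_hom,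
    Functor.isoWhiskerRight_hom, Functor.whiskerLeft_app, Functor.whiskerRight_app, Iso.symm_hom,
    Functor.leftUnitor_inv_app, Functor.associator_hom_app, Functor.associator_inv_app,
    Functor.rightUnitor_hom_app, Functor.map_comp, map_unitIso_inv_app, map_inv_map]
  simp [map_inv_map]

lemma invδ_mul (g h m : G) (e : g * h = m) (X : C) :
    E.inv.map ((A.ε g h m e).hom.app X) ≫ (E.invδ m).hom.app X =
      (E.invδ g).hom.app ((A.fn h).obj X) ≫ (A.fn g).map ((E.invδ h).hom.app X) ≫
        (A.ε g h m e).hom.app (E.inv.obj X) := by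
  apply E.toFunctor.map_injective
  have h1 := (A.ε g h m e).hom.naturality (E.counitIso.inv.app X)
  have h2 := (E.δ g).hom.naturality ((E.invδ h).hom.app X)
  have h3 := E.δ_mul g h m e (E.inv.obj X)
  dsimp at h1 h2
  rw [← cancel_mono ((E.δ m).hom.app (E.inv.obj X))]
  simp only [Functor.map_comp, Category.assoc]
  rw [map_invδ_hom_app, map_inv_map, h3, reassoc_of% h2, reassoc_of% (map_invδ_hom_app),
    ← Functor.map_comp_assoc (A.fn g) (E.toFunctor.map _), map_invδ_hom_app]
  simp [← h1]

end EquivariantAutoequivalence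

end Inverse

/-! ### Automorphism classes form a group -/

section Groups

variable {k : Type w} [Field k] {G : Type*} [Group G] {T : Type u} [Category.{v} T]
  [Preadditive T] [Linear k T] [HasZeroObject T] [HasShift T ℤ]
  [∀ n : ℤ, (shiftFunctor T n).Additive]
  [Pretriangulated T] {A : TriangleAction k G T}

/-- The quasi-inverse as an equivariant triangle autoequivalence. -/
def EquivariantAutoequivalence.inverse (E : EquivariantAutoequivalence A) :
    EquivariantAutoequivalence A where
  toFunctor := E.inv
  additive := inferInstance
  linear := inferInstance
  commShift := inferInstance
  map_exact Δ h := by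
    -- The quasi-inverse is a right adjoint of a triangulated functor, hence triangulated.
    have : E.toFunctor.asEquivalence.functor.IsTriangulated := ⟨E.map_exact⟩
    exact (E.toFunctor.asEquivalence.toAdjunction.isTriangulated_rightAdjoint).map_distinguished
      Δ h
  δ := E.invδ
  δ_commShift _ := inferInstance
  δ_mul := E.invδ_mul
  isEquivalence := inferInstance

lemma EquivariantAutoequivalence.inverse_comp (E : EquivariantAutoequivalence A) :
    (E.inverse.toEquivariantEndofunctor.comp E.toEquivariantEndofunctor).Isomorphic
      (EquivariantEndofunctor.id A) := by
  refine ⟨E.unitIso.symm, inferInstanceAs (NatTrans.CommShift E.unitIso.inv ℤ), fun g X => ?_⟩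
  apply E.toFunctor.map_injective
  have h1 := (E.δ g).hom.naturality (E.unitIso.inv.app X)
  have h2 := E.map_invδ_hom_app g (E.toFunctor.obj X)
  have h3 : E.counitIso.inv.app (E.toFunctor.obj X) ≫ E.counitIso.hom.app (E.toFunctor.obj X) = 𝟙 _ :=
    Iso.inv_hom_id_app _ _
  dsimp at h1 h3
  have key : E.toFunctor.map (E.inv.map ((E.δ g).hom.app X)) ≫
      E.toFunctor.map ((E.invδ g).hom.app (E.toFunctor.obj X)) ≫
        E.toFunctor.map ((A.fn g).map (E.unitIso.inv.app X)) =
      E.toFunctor.map (E.unitIso.inv.app ((A.fn g).obj X)) := by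
    rw [← cancel_mono ((E.δ g).hom.app X), Category.assoc, Category.assoc, h1, reassoc_of% h2,
      map_unitIso_inv_app, map_unitIso_inv_app, map_inv_map, ← Functor.map_comp, h3]
    simp
  simpa [EquivariantEndofunctor.comp, TriangleEndofunctor.comp, EquivariantEndofunctor.id,
    TriangleEndofunctor.id, EquivariantAutoequivalence.inverse] using key

/-- It suffices to find left inverses: in a monoid where every element has one, all elements are
units. -/
lemma TriangleAut.isUnit (a : TriangleAut A) : IsUnit a := by
  have hinv : ∀ a : TriangleAut A, ∃ b, b * a = 1 := by
    rintro ⟨E⟩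
    exact ⟨Quotient.mk _ E.inverse, Quotient.sound E.inverse_comp⟩
  obtain ⟨b, hb⟩ := hinv a
  obtain ⟨c, hc⟩ := hinv b
  have hca : c = a := by rw [← mul_one c, ← hb, ← mul_assoc, hc, one_mul]
  exact ⟨⟨a, b, by rw [← hca, hc], hb⟩, rfl⟩

end Groups

/-! ### Equivariantization reflects equivalences -/

section Reflect

variable {k : Type w} [Field k] {G : Type*} [Group G] [Finite G] {C : Type u} [Category.{v} C]
  [Preadditive C] [Linear k C] [HasShift C ℤ] [HasExactTriangles C] [HasFiniteBiproducts C]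
  [∀ n : ℤ, (shiftFunctor C n).Linear k] {A : TriangleAction k G C}

open EquivariantObject

namespace EquivariantEndofunctor

variable (E : EquivariantEndofunctor A)

/-- If `E` kills `f`, it kills all conjugates of `f` and hence the weight components, which are
morphisms of `T^G`. -/
lemma map_eq_zero_of_equivariantFunctor_faithful (hG : SplitsOver k G)
    [(equivariantFunctor E).Faithful] {Z W : EquivariantObject A} (f : Z.X ⟶ W.X)
    (hf : E.toFunctor.map f = 0) : f = 0 := by
  have := Fintype.ofFinite G
  have := finite_characters (k := k) (G := G)
  have := Fintype.ofFinite (G →* kˣ)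
  have hconj (g : G) : E.toFunctor.map (conj Z W g f) = 0 := by
    have h := (E.δ g).hom.naturality f
    have h' : E.toFunctor.map ((A.fn g).map f) = 0 := by
      rw [← cancel_mono ((E.δ g).hom.app W.X)]
      exact h.trans (by simp [hf])
    rw [conj, Functor.map_comp, Functor.map_comp, h', zero_comp, comp_zero]
  have hcomp (χ : G →* kˣ) : (component χ f : Z ⟶ (twist A χ).obj W) = 0 := by
    apply (equivariantFunctor E).map_injective
    rw [Functor.map_zero]
    have h : E.toFunctor.map (base χ (component χ f : Z ⟶ (twist A χ).obj W)) = 0 := by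
      rw [base_component, Functor.map_smul, Functor.map_sum]
      simp [hconj]
    exact EquivariantObject.hom_ext h
  rw [← sum_component hG f]
  exact Finset.sum_eq_zero fun χ _ => by rw [hcomp, base_zero]

/-- By the weight decomposition in the target, only morphisms `E^G Z ⟶ F_χ (E^G W)` have to be
lifted; these lift because `E^G` is full and commutes with `F_χ`. -/
lemma exists_map_eq_of_equivariantFunctor_full (hG : SplitsOver k G)
    [(equivariantFunctor E).Full] {Z W : EquivariantObject A}
    (f : E.toFunctor.obj Z.X ⟶ E.toFunctor.obj W.X) : ∃ f', E.toFunctor.map f' = f := by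
  have := Fintype.ofFinite G
  refine twist_induction (X := (equivariantFunctor E).obj Z) (Y := (equivariantFunctor E).obj W)
    (P := fun f => ∃ f', E.toFunctor.map f' = f) hG ?_ ?_ f
  · rintro _ _ ⟨f, rfl⟩ ⟨f', rfl⟩
    exact ⟨f + f', E.toFunctor.map_add⟩
  · intro χ a
    obtain ⟨b, hb⟩ := (equivariantFunctor E).map_surjective (a ≫ (strictIso E χ).inv.app W)
    refine ⟨base χ b, (congrArg EquivariantObject.Hom.f hb).trans ?_⟩
    exact Category.comp_id _

lemma faithful_of_equivariantFunctor (hG : SplitsOver k G) [(equivariantFunctor E).Faithful] :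
    E.toFunctor.Faithful where
  map_injective {X Y} f f' h := by
    have h1 : (retractInd A X).r ≫ (f - f') ≫ (retractInd A Y).i = 0 :=
      E.map_eq_zero_of_equivariantFunctor_faithful hG _ (by
        rw [Functor.map_comp, Functor.map_comp, Functor.map_sub, h, sub_self, zero_comp, comp_zero])
    have h2 : f - f' = (retractInd A X).i ≫
        ((retractInd A X).r ≫ (f - f') ≫ (retractInd A Y).i) ≫ (retractInd A Y).r := by simp
    rw [h1, zero_comp, comp_zero] at h2
    exact sub_eq_zero.1 h2

lemma full_of_equivariantFunctor (hG : SplitsOver k G) [(equivariantFunctor E).Full] :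
    E.toFunctor.Full where
  map_surjective {X Y} f := by
    obtain ⟨f', hf'⟩ := E.exists_map_eq_of_equivariantFunctor_full hG
      (E.toFunctor.map (retractInd A X).r ≫ f ≫ E.toFunctor.map (retractInd A Y).i)
    refine ⟨(retractInd A X).i ≫ f' ≫ (retractInd A Y).r, ?_⟩
    rw [Functor.map_comp, Functor.map_comp, hf']
    simp only [Category.assoc, ← Functor.map_comp, Retract.retract]
    rw [← Functor.map_comp_assoc]
    simp

lemma isEquivalence_of_equivariantFunctor [IsIdempotentComplete C] (hG : SplitsOver k G)
    [(equivariantFunctor E).IsEquivalence] : E.toFunctor.IsEquivalence := by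
  have := E.faithful_of_equivariantFunctor hG
  have := E.full_of_equivariantFunctor hG
  refine { essSurj := ⟨fun Y => ?_⟩ }
  let Z := (equivariantFunctor E).objPreimage (ind A Y)
  let θ : E.toFunctor.obj Z.X ≅ (ind A Y).X :=
    (forget A).mapIso ((equivariantFunctor E).objObjPreimageIso (ind A Y))
  let ρ : Retract Y (E.toFunctor.obj Z.X) := (retractInd A Y).trans (Retract.ofIso θ.symm)
  -- `Y` is a retract of some `E Z.X`. The corresponding idempotent lifts along the fully faithful
  -- `E`, and `E` sends the image of the lift to an object isomorphic to `Y`.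
  obtain ⟨p, hp⟩ := E.toFunctor.map_surjective (ρ.r ≫ ρ.i)
  obtain ⟨X, i, r, hir, hri⟩ := IsIdempotentComplete.idempotents_split Z.X p (by
    apply E.toFunctor.map_injective
    rw [Functor.map_comp, hp]
    simp)
  refine ⟨X, ⟨⟨E.toFunctor.map i ≫ ρ.r, ρ.i ≫ E.toFunctor.map r, ?_, ?_⟩⟩⟩
  · rw [Category.assoc, ← Category.assoc ρ.r, ← hp, ← hri, ← Functor.map_comp, ← Functor.map_comp]
    simp [hir]
  · rw [Category.assoc, ← Functor.map_comp_assoc, hri, hp]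
    simp

end EquivariantEndofunctor

end Reflect

/-! ### Equivariantization is bijective -/

section Bijective

variable {k : Type w} [Field k] {G : Type*} [Group G] [Finite G] {T : Type u} [Category.{v} T]
  [Preadditive T] [Linear k T] [HasZeroObject T] [HasShift T ℤ]
  [∀ n : ℤ, (shiftFunctor T n).Additive] [∀ n : ℤ, (shiftFunctor T n).Linear k]
  [Pretriangulated T] [IsIdempotentComplete T] (A : TriangleAction k G T)

lemma TriangleAut.equivariantization_bijective (hG : SplitsOver k G) :
    Function.Bijective (TriangleAut.equivariantization A) := by
  have := Fintype.ofFinite G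
  have := finite_characters (k := k) (G := G)
  have := Fintype.ofFinite (G →* kˣ)
  constructor
  · rintro ⟨E⟩ ⟨E'⟩ h
    exact Quotient.sound
      (EquivariantEndofunctor.isomorphic_of_equivariantization hG (Quotient.exact h))
  · rintro ⟨H⟩
    have e : equivariantFunctor (H.descendEndofunctor hG) ≅ H.toFunctor :=
      H.equivariantFunctorDescendIso hG
    have := Functor.isEquivalence_of_iso e.symm
    refine ⟨Quotient.mk _ { toEquivariantEndofunctor := H.descendEndofunctor hG
                            isEquivalence := EquivariantEndofunctor.isEquivalence_of_equivariantFunctor _ hG },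
      Quotient.sound (H.equivariantization_descendEndofunctor hG)⟩

/-- Invertibility is transported along the surjective homomorphism, because the quasi-inverse
argument needs a pretriangulated category and `T^G` carries only a class of exact triangles here. -/
lemma TriangleAut.isUnit_dualAction (hG : SplitsOver k G) (b : TriangleAut (dualAction A)) :
    IsUnit b := by
  obtain ⟨a, rfl⟩ := (TriangleAut.equivariantization_bijective A hG).2 b
  exact (TriangleAut.isUnit a).map _

end Bijective

attribute [local instance] hasBinaryBiproducts_of_finite_biproducts

/-! ### Tilting depends only on the additive closure -/

section ThickAdd

variable {C : Type u} [Category.{v} C] [Preadditive C] [HasShift C ℤ] [HasExactTriangles C]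
  [HasFiniteBiproducts C]

variable (C) in
/-- Thick subcategories of `C` are closed under binary direct sums. -/
def ThickClosedUnderSums : Prop :=
  ∀ P : ObjectProperty C, IsThick P → ∀ X Y : C, P X → P Y → P (X ⊞ Y)

lemma IsThick.of_addClosure (hC : ThickClosedUnderSums C) {P : ObjectProperty C} (hP : IsThick P)
    {M X : C} (hM : P M) (h : addClosure M X) : P X := by
  have hn (n : ℕ) : P (⨁ fun _ : Fin n => M) := by
    induction n with
    | zero =>
      -- The empty sum is a zero object, hence a retract of `M`.
      refine hP.retract _ M ⟨⟨0, 0, ?_⟩⟩ hM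
      apply biproduct.hom_ext'
      exact fun j => j.elim0
    | succ n ih =>
      refine hP.retract _ ((⨁ fun _ : Fin n => M) ⊞ M) ⟨⟨
        biprod.lift (biproduct.lift fun j => biproduct.π (fun _ : Fin (n + 1) => M) j.castSucc)
          (biproduct.π (fun _ : Fin (n + 1) => M) (Fin.last n)),
        biprod.desc (biproduct.desc fun j => biproduct.ι (fun _ : Fin (n + 1) => M) j.castSucc)
          (biproduct.ι (fun _ : Fin (n + 1) => M) (Fin.last n)), ?_⟩⟩ (hC P hP _ _ ih hM)
      rw [biprod.lift_desc, biproduct.lift_desc, ← biproduct.total, Fin.sum_univ_castSucc]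
  obtain ⟨n, ⟨r⟩⟩ := h
  exact hP.retract _ _ ⟨r⟩ (hn n)

lemma hom_shift_eq_zero_of_addClosure [∀ n : ℤ, (shiftFunctor C n).Additive] {M X Y : C} {n : ℤ}
    (hM : ∀ f : M ⟶ M⟦n⟧, f = 0) (hX : addClosure M X) (hY : addClosure M Y) (f : X ⟶ Y⟦n⟧) :
    f = 0 := by
  obtain ⟨p, a, b, e⟩ := exists_sum_of_addClosure hX
  obtain ⟨q, a', b', e'⟩ := exists_sum_of_addClosure hY
  have h : f = (∑ j, a j ≫ b j) ≫ f ≫ (∑ j, a' j ≫ b' j)⟦n⟧' := by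
    rw [e, e', Category.id_comp, CategoryTheory.Functor.map_id, Category.comp_id]
  rw [h]
  simp only [Functor.map_sum, Preadditive.comp_sum, Preadditive.sum_comp, Functor.map_comp,
    Category.assoc]
  refine Finset.sum_eq_zero fun j _ => Finset.sum_eq_zero fun l _ => ?_
  rw [reassoc_of% (hM (b l ≫ f ≫ (a' j)⟦n⟧')), zero_comp, comp_zero]

lemma IsTilting.of_addClosure [∀ n : ℤ, (shiftFunctor C n).Additive]
    (hC : ThickClosedUnderSums C) {M N : C} (hM : IsTilting M) (h : addClosure M N)
    (h' : addClosure N M) : IsTilting N where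
  hom_shift i hi f := hom_shift_eq_zero_of_addClosure (hM.hom_shift i hi) h h f
  generates X P hP hN := hM.generates X P hP (hP.of_addClosure hC hN h')

end ThickAdd

/-! ### Basic versions of stable tilting objects -/

section BasicEquivalence

variable {C : Type u} [Category.{v} C] [Preadditive C] [HasFiniteBiproducts C]

lemma IsBasic.map (F : C ⥤ C) [F.Additive] [F.IsEquivalence] {M : C} (h : IsBasic M) :
    IsBasic (F.obj M) := by
  intro Y hY
  refine ⟨fun r => ?_⟩
  have := preservesBinaryBiproducts_of_preservesBiproducts F
  have hz : ∀ B : C, IsZero (F.obj B) → IsZero B := fun B hB => by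
    rw [IsZero.iff_id_eq_zero] at hB ⊢
    apply F.map_injective
    rw [CategoryTheory.Functor.map_id, Functor.map_zero, hB]
  let X := F.objPreimage Y
  let θ : F.obj X ≅ Y := F.objObjPreimageIso Y
  have hX : Indecomposable X := by
    refine ⟨fun h0 => hY.1 ((F.map_isZero h0).of_iso θ.symm), fun B B' e => ?_⟩
    exact (hY.2 (F.obj B) (F.obj B')
      (θ.symm ≪≫ F.mapIso e ≪≫ F.mapBiprod B B')).imp (hz B) (hz B')
  have r' : Retract (F.obj (X ⊞ X)) (F.obj M) :=
    (Retract.ofIso (F.mapBiprod X X ≪≫ biprod.mapIso θ θ)).trans r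
  exact (h X hX).false
    { i := F.preimage r'.i
      r := F.preimage r'.r
      retract := F.map_injective (by simp) }

end BasicEquivalence

section Stable

variable {k : Type w} [Field k] {G : Type*} [Group G] {C : Type u} [Category.{v} C]
  [Preadditive C] [Linear k C] [HasShift C ℤ] [HasExactTriangles C] [HasFiniteBiproducts C]
  [IsIdempotentComplete C] {A : TriangleAction k G C}

/-- `F_g N` is again basic, and stability of `M` shows that it has the same additive closure as `N`.
-/
lemma IsBasic.isStable_of_addClosure (hC : ∀ X Y : C, FiniteDimensional k (X ⟶ Y)) {M N : C}
    (hN : IsBasic N) (hM : A.IsStable M) (h : addClosure M N) (h' : addClosure N M) :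
    A.IsStable N := fun g => by
  obtain ⟨e⟩ := hM g
  refine hN.iso_of_addClosure hC (hN.map (A.fn g)) ?_ ?_
  · exact addClosure_trans (addClosure_map (A.fn g) h)
      (addClosure_trans (addClosure_of_retract (Retract.ofIso e.symm)) h')
  · exact addClosure_trans h
      (addClosure_trans (addClosure_of_retract (Retract.ofIso e)) (addClosure_map (A.fn g) h'))

lemma exists_stableTilting [∀ n : ℤ, (shiftFunctor C n).Additive]
    (hC : ∀ X Y : C, FiniteDimensional k (X ⟶ Y)) (hC' : ThickClosedUnderSums C) {M : C}
    (hM : IsTilting M) (hM' : A.IsStable M) :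
    ∃ N : StableTilting A, addClosure M N.1 ∧ addClosure N.1 M := by
  obtain ⟨N, hN, h, h'⟩ := exists_isBasic hC M
  exact ⟨⟨N, hM.of_addClosure hC' h h', hN, hN.isStable_of_addClosure hC hM' h h'⟩, h, h'⟩

end Stable

/-! ### Hom-finiteness and split idempotents of `T^G` -/

section EquivariantCategory

variable {k : Type w} [Field k] {G : Type*} [Group G] {C : Type u} [Category.{v} C]
  [Preadditive C] [Linear k C] [HasShift C ℤ] [HasExactTriangles C] {A : TriangleAction k G C}

namespace EquivariantObject

instance (n : ℤ) [∀ n : ℤ, (shiftFunctor C n).Additive] :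
    (shiftFunctor (EquivariantObject A) n).Additive where
  map_add {X Y a b} := by
    have h : (a.f + b.f)⟦n⟧' = a.f⟦n⟧' + b.f⟦n⟧' := (shiftFunctor C n).map_add
    exact hom_ext h

lemma finiteDimensional_hom (hC : ∀ X Y : C, FiniteDimensional k (X ⟶ Y))
    (X Y : EquivariantObject A) : FiniteDimensional k (X ⟶ Y) := by
  have := hC X.X Y.X
  let φ : (X ⟶ Y) →ₗ[k] (X.X ⟶ Y.X) :=
    { toFun := fun a => a.f
      map_add' := fun _ _ => rfl
      map_smul' := fun _ _ => rfl }
  exact FiniteDimensional.of_injective φ (f_injective X Y)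

/-- The equivariant structure on a direct summand given by an equivariant idempotent. -/
def splitting {Z : EquivariantObject A} (p : Z ⟶ Z) {X : C} (i : X ⟶ Z.X) (r : Z.X ⟶ X)
    (hir : i ≫ r = 𝟙 X) (hri : r ≫ i = p.f) : EquivariantObject A where
  X := X
  α g :=
    { hom := i ≫ (Z.α g).hom ≫ (A.fn g).map r
      inv := (A.fn g).map i ≫ (Z.α g).inv ≫ r
      hom_inv_id := by
        have h := p.comm g
        simp only [Category.assoc]
        rw [← Functor.map_comp_assoc, hri, ← reassoc_of% h, Iso.hom_inv_id_assoc, ← hri]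
        simp [hir]
      inv_hom_id := by
        have h := p.comm g
        simp only [Category.assoc]
        rw [reassoc_of% hri, reassoc_of% h, Iso.inv_hom_id_assoc, ← Functor.map_comp,
          ← Functor.map_comp, ← hri, Category.assoc, hir, Category.comp_id, hir,
          CategoryTheory.Functor.map_id] }
  α_mul g h m e := by
    have h1 := p.comm g
    have h2 := (A.ε g h m e).hom.naturality r
    have h3 : i ≫ p.f = i := by rw [← hri, reassoc_of% hir]
    dsimp at h2
    simp only [Functor.map_comp, Category.assoc, Z.α_mul g h m e, ← h2]
    rw [← Functor.map_comp_assoc (A.fn g) r i, hri, ← reassoc_of% h1, reassoc_of% h3]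

instance [IsIdempotentComplete C] : IsIdempotentComplete (EquivariantObject A) where
  idempotents_split Z p hp := by
    obtain ⟨X, i, r, hir, hri⟩ := IsIdempotentComplete.idempotents_split Z.X p.f
      (congrArg Hom.f hp)
    have h3 : i ≫ p.f = i := by rw [← hri, reassoc_of% hir]
    have h4 : p.f ≫ r = r := by rw [← hri, Category.assoc, hir, Category.comp_id]
    refine ⟨splitting p i r hir hri, ⟨i, fun g => ?_⟩, ⟨r, fun g => ?_⟩, hom_ext hir, hom_ext hri⟩
    · have h : i ≫ (Z.α g).hom = (i ≫ (Z.α g).hom ≫ (A.fn g).map r) ≫ (A.fn g).map i := by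
        rw [Category.assoc, Category.assoc, ← Functor.map_comp, hri, ← p.comm, reassoc_of% h3]
      exact h
    · have h : r ≫ i ≫ (Z.α g).hom ≫ (A.fn g).map r = (Z.α g).hom ≫ (A.fn g).map r := by
        rw [reassoc_of% hri, ← Category.assoc, p.comm, Category.assoc, ← Functor.map_comp, h4]
      exact h

end EquivariantObject

end EquivariantCategory

/-! ### Thick subcategories are closed under direct sums -/

section ThickSums

variable {T : Type u} [Category.{v} T] [Preadditive T] [HasZeroObject T] [HasShift T ℤ]
  [∀ n : ℤ, (shiftFunctor T n).Additive] [Pretriangulated T]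

/-- A split triangle is distinguished. -/
lemma distinguished_of_split (Δ : Triangle T) (h : Δ.mor₁ = 0) (r : Δ.obj₃ ⟶ Δ.obj₂)
    (s : Δ.obj₁⟦(1 : ℤ)⟧ ⟶ Δ.obj₃) (h₁ : Δ.mor₂ ≫ r = 𝟙 _) (h₂ : s ≫ Δ.mor₃ = 𝟙 _)
    (h₃ : Δ.mor₂ ≫ Δ.mor₃ = 0) (h₄ : s ≫ r = 0) (h₅ : r ≫ Δ.mor₂ + Δ.mor₃ ≫ s = 𝟙 _) :
    Δ ∈ distTriang T := by
  rw [rotate_distinguished_triangle]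
  -- After rotation, the splitting identifies `Δ` with the triangle of a binary biproduct.
  let e : Δ.obj₃ ≅ Δ.obj₂ ⊞ Δ.obj₁⟦(1 : ℤ)⟧ :=
    { hom := biprod.lift r Δ.mor₃
      inv := biprod.desc Δ.mor₂ s
      hom_inv_id := by rw [biprod.lift_desc, h₅]
      inv_hom_id := by ext <;> simp [h₁, h₂, h₃, h₄] }
  refine isomorphic_distinguished _ (binaryBiproductTriangle_distinguished Δ.obj₂ (Δ.obj₁⟦1⟧)) _
    (Triangle.isoMk _ _ (Iso.refl _) e (Iso.refl _) ?_ ?_ ?_)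
  · have h : Δ.mor₂ ≫ biprod.lift r Δ.mor₃ = 𝟙 _ ≫ biprod.inl := by ext <;> simp [h₁, h₃]
    exact h
  · have h : Δ.mor₃ ≫ 𝟙 _ = biprod.lift r Δ.mor₃ ≫ biprod.snd := by simp
    exact h
  · have h : (-(Δ.mor₁⟦(1 : ℤ)⟧')) ≫ (𝟙 Δ.obj₂)⟦(1 : ℤ)⟧' = 𝟙 _ ≫ 0 := by simp [h]
    exact h

lemma thickClosedUnderSums : ThickClosedUnderSums T := fun _ hP X Y hX hY =>
  hP.cone _ (inv_rot_of_distTriang _ (binaryBiproductTriangle_distinguished X Y))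
    (hP.shift Y (-1) hY) hX

/-- The triangle `Y⟦-1⟧ ⟶ X ⟶ X ⊞ Y ⟶ Y` with zero first morphism is built in `T^G`; its underlying
triangle is split, hence distinguished. Working with splittings avoids comparing the underlying
object of `X ⊞ Y` with a biproduct in `T`. -/
lemma thickClosedUnderSums_equivariant {k : Type w} [Field k] {G : Type*} [Group G] [Linear k T]
    (A : TriangleAction k G T) : ThickClosedUnderSums (EquivariantObject A) := by
  intro P hP X Y hX hY
  let θ : Y ≅ (Y⟦(-1 : ℤ)⟧)⟦(1 : ℤ)⟧ := 
    (shiftFunctorCompIsoId (EquivariantObject A) (-1 : ℤ) 1 (by simp)).symm.app Y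
  let Δ : Triangle (EquivariantObject A) :=
    Triangle.mk (0 : Y⟦(-1 : ℤ)⟧ ⟶ X) (biprod.inl : X ⟶ X ⊞ Y) (biprod.snd ≫ θ.hom)
  refine hP.cone Δ ?_ (hP.shift Y (-1) hY) hX
  refine distinguished_of_split (EquivariantObject.forgetTriangle A Δ) rfl
    (EquivariantObject.Hom.f (biprod.fst : X ⊞ Y ⟶ X))
    (EquivariantObject.Hom.f (θ.inv ≫ (biprod.inr : Y ⟶ X ⊞ Y)))
    (congrArg EquivariantObject.Hom.f (show biprod.inl ≫ biprod.fst = 𝟙 X by simp))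
    (congrArg EquivariantObject.Hom.f
      (show (θ.inv ≫ (biprod.inr : Y ⟶ X ⊞ Y)) ≫ biprod.snd ≫ θ.hom = 𝟙 _ by simp))
    (congrArg EquivariantObject.Hom.f
      (show (biprod.inl : X ⟶ X ⊞ Y) ≫ biprod.snd ≫ θ.hom = 0 by simp))
    (congrArg EquivariantObject.Hom.f
      (show (θ.inv ≫ (biprod.inr : Y ⟶ X ⊞ Y)) ≫ biprod.fst = 0 by simp))
    (congrArg EquivariantObject.Hom.f
      (show biprod.fst ≫ (biprod.inl : X ⟶ X ⊞ Y) + (biprod.snd ≫ θ.hom) ≫ θ.inv ≫ biprod.inr = 𝟙 _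
        by simp))

end ThickSums

attribute [local instance] hasBinaryBiproducts_of_finite_biproducts

/-! ### The induction functor against the forgetful functor and characters -/

section Biproducts

variable {C : Type u} [Category.{v} C] [Preadditive C] [HasFiniteBiproducts C]
  {J : Type*} [Fintype J] {Q : J → C}

lemma biproduct_total (Q : J → C) : ∑ j, biproduct.π Q j ≫ biproduct.ι Q j = 𝟙 (⨁ Q) := by
  apply biproduct.hom_ext'
  intro i
  rw [Preadditive.comp_sum, Finset.sum_eq_single i (fun j _ h => by
    rw [biproduct.ι_π_ne_assoc _ h.symm, zero_comp]) (by simp)]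
  simp

lemma biproduct_lift_eq {X : C} (a : ∀ j, X ⟶ Q j) :
    biproduct.lift a = ∑ j, a j ≫ biproduct.ι Q j := by
  rw [← Category.comp_id (biproduct.lift a), ← biproduct_total, Preadditive.comp_sum]
  simp

lemma biproduct_lift_desc {X Y : C} (a : ∀ j, X ⟶ Q j) (b : ∀ j, Q j ⟶ Y) :
    biproduct.lift a ≫ biproduct.desc b = ∑ j, a j ≫ b j := by
  rw [biproduct_lift_eq, Preadditive.sum_comp]
  simp

end Biproducts

section InductionFunctor

variable {k : Type w} [Field k] {G : Type*} [Group G] [Finite G] {T : Type u} [Category.{v} T]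
  [Preadditive T] [Linear k T] [HasZeroObject T] [HasShift T ℤ]
  [∀ n : ℤ, (shiftFunctor T n).Additive] [Pretriangulated T] (A : TriangleAction k G T)

namespace EquivariantObject

/-- The induction functor. -/
def indFunctor : T ⥤ EquivariantObject A where
  obj X := ind A X
  map f := indMap A f
  map_id X := by
    have h : (biproduct.map fun h => (A.fn h).map (𝟙 X)) =
        𝟙 (⨁ fun h => (A.fn h).obj X) := by
      ext; simp
    exact hom_ext h
  map_comp {X Y Z} f f' := by
    have h : (biproduct.map fun h => (A.fn h).map (f ≫ f')) =
        (biproduct.map fun h => (A.fn h).map f) ≫ biproduct.map fun h => (A.fn h).map f' := by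
      ext; simp
    exact hom_ext h

instance : (indFunctor A).Additive where
  map_add {X Y f f'} := by
    have h : (biproduct.map fun h => (A.fn h).map (f + f')) =
        (biproduct.map fun h => (A.fn h).map f) + biproduct.map fun h => (A.fn h).map f' := by
      apply biproduct.hom_ext'
      intro j
      simp [Functor.map_add]
    exact hom_ext h

instance : (forget A).Additive where

/-- The inverse of the comparison of induction with the shift, on underlying objects. -/
def indShiftInv (X : T) (n : ℤ) :
    (⨁ fun h => (A.fn h).obj X)⟦n⟧ ⟶ ⨁ fun h => (A.fn h).obj (X⟦n⟧) :=
  biproduct.lift (f := fun h => (A.fn h).obj (X⟦n⟧)) fun h =>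
    (biproduct.π (fun h => (A.fn h).obj X) h)⟦n⟧' ≫ ((A.fn h).commShiftIso n).inv.app X

lemma indShiftInv_π (X : T) (n : ℤ) (h : G) :
    indShiftInv A X n ≫ biproduct.π (fun h => (A.fn h).obj (X⟦n⟧)) h =
      (biproduct.π (fun h => (A.fn h).obj X) h)⟦n⟧' ≫ ((A.fn h).commShiftIso n).inv.app X :=
  biproduct.lift_π _ _

lemma indShiftMap_indShiftInv (X : T) (n : ℤ) : indShiftMap A X n ≫ indShiftInv A X n = 𝟙 _ := by
  apply biproduct.hom_ext'
  intro p
  apply biproduct.hom_ext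
  intro q
  rw [Category.assoc, Category.assoc, indShiftInv_π, reassoc_of% (ι_indShiftMap), ← Functor.map_comp_assoc]
  by_cases h : p = q
  · subst h
    simp
  · rw [biproduct.ι_π_ne _ h, Functor.map_zero, zero_comp, comp_zero, Category.comp_id,
      biproduct.ι_π_ne _ h]

lemma indShiftInv_indShiftMap (X : T) (n : ℤ) : indShiftInv A X n ≫ indShiftMap A X n = 𝟙 _ := by
  have := Fintype.ofFinite G
  have h : indShiftInv A X n = ∑ h : G, ((biproduct.π (fun h => (A.fn h).obj X) h)⟦n⟧' ≫
      ((A.fn h).commShiftIso n).inv.app X) ≫ biproduct.ι (fun h => (A.fn h).obj (X⟦n⟧)) h :=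
    biproduct_lift_eq _
  rw [h, Preadditive.sum_comp]
  simp only [Category.assoc, ι_indShiftMap, Iso.inv_hom_id_app_assoc]
  simp only [← Functor.map_comp, ← Functor.map_sum]
  rw [biproduct_total, CategoryTheory.Functor.map_id]

/-- Induction commutes with the shift. -/
def indShiftIso (X : T) (n : ℤ) : ind A (X⟦n⟧) ≅ (ind A X)⟦n⟧ :=
  isoMk ⟨indShiftMap A X n, indShiftInv A X n, indShiftMap_indShiftInv A X n,
    indShiftInv_indShiftMap A X n⟩ (indShift_comm A X n)

variable {A}

lemma lift_α_comm (Z : EquivariantObject A) (g : G) :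
    biproduct.lift (fun h => (Z.α h).hom) ≫ (indα A Z.X g).hom =
      (Z.α g).hom ≫ (A.fn g).map (biproduct.lift fun h => (Z.α h).hom) := by
  have := Fintype.ofFinite G
  rw [biproduct_lift_eq, Preadditive.sum_comp, Functor.map_sum, Preadditive.comp_sum,
    ← Equiv.sum_comp (Equiv.mulLeft g)]
  refine Finset.sum_congr rfl fun l _ => ?_
  have h1 := ι_indα A Z.X g l (g * l) rfl
  rw [Equiv.coe_mulLeft, Category.assoc, h1, Z.α_mul g l _ rfl]
  simp

lemma desc_α_comm (Z : EquivariantObject A) (g : G) :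
    biproduct.desc (fun h => (Z.α h).inv) ≫ (Z.α g).hom =
      (indα A Z.X g).hom ≫ (A.fn g).map (biproduct.desc fun h => (Z.α h).inv) := by
  apply biproduct.hom_ext'
  intro p
  have e : g * (g⁻¹ * p) = p := by simp
  have h1 := ι_indα A Z.X g _ p e
  rw [reassoc_of% h1, biproduct.ι_desc_assoc, ← Functor.map_comp, biproduct.ι_desc,
    Iso.inv_comp_eq, Z.α_mul g _ p e]
  simp [← Functor.map_comp]

/-- The unit map of an equivariant object to the object induced from its underlying object. -/
def toInd (Z : EquivariantObject A) : Z ⟶ ind A Z.X := ⟨biproduct.lift fun h => (Z.α h).hom, Z.lift_α_comm⟩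

/-- The counit map to an equivariant object from the object induced from its underlying object. -/
def ofInd (Z : EquivariantObject A) : ind A Z.X ⟶ Z := ⟨biproduct.desc fun h => (Z.α h).inv, Z.desc_α_comm⟩

/-- Each group element `h` contributes `α h` followed by its inverse. -/
lemma toInd_ofInd (Z : EquivariantObject A) : Z.toInd ≫ Z.ofInd = (Nat.card G : k) • 𝟙 Z := by
  have := Fintype.ofFinite G
  have h : biproduct.lift (fun h => (Z.α h).hom) ≫ biproduct.desc (fun h => (Z.α h).inv) =
      (Nat.card G : k) • 𝟙 Z.X := by
    rw [biproduct_lift_desc]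
    simp [Nat.cast_smul_eq_nsmul]
  exact hom_ext h

/-- If the order of the group is invertible, every equivariant object is a retract of the object
induced from its underlying object. -/
def retractOfInd (hG : (Nat.card G : k) ≠ 0) (Z : EquivariantObject A) :
    Retract Z (ind A Z.X) where
  i := Z.toInd
  r := (Nat.card G : k)⁻¹ • Z.ofInd
  retract := by rw [Linear.comp_smul, toInd_ofInd, inv_smul_smul₀ hG]

/-- Induced objects are invariant under the twists by characters. -/
def indTwistIso (M : T) (χ : G →* kˣ) : ind A M ≅ (twist A χ).obj (ind A M) :=
  -- Scaling the summand of `h` by `χ h` works because the structure map of `g` sends the summand of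
  -- `p` to that of `g⁻¹ * p`, and `χ p * χ g⁻¹ = χ (g⁻¹ * p)`.
  isoMk (biproduct.mapIso fun h => smulIso (χ h) (Iso.refl ((A.fn h).obj M))) fun g => by
    have h : (biproduct.map fun h => ((χ h : kˣ) : k) • 𝟙 ((A.fn h).obj M)) ≫
        (((χ g⁻¹ : kˣ) : k) • (indα A M g).hom) =
        (indα A M g).hom ≫ (A.fn g).map (biproduct.map fun h => ((χ h : kˣ) : k) • 𝟙 _) := by
      apply biproduct.hom_ext'
      intro p
      have e : g * (g⁻¹ * p) = p := by simp
      have h1 := ι_indα A M g _ p e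
      rw [reassoc_of% h1, ← Functor.map_comp, biproduct.ι_map, biproduct.ι_map_assoc,
        Linear.comp_smul, Linear.smul_comp, Category.id_comp, h1, smul_smul,
        Linear.smul_comp, Category.id_comp, Functor.map_smul, Linear.comp_smul]
      congr 1
      rw [← Units.val_mul, ← map_mul, map_mul, mul_comm, ← map_mul]
    exact h

/-- The matrix entry at `(p, q)` is the sum over `χ` of `χ (p * q⁻¹)`, times `(α p)⁻¹` followed by
`α q`. Orthogonality leaves the diagonal with value `|G|`. Dividing by `|G|` exhibits `Ind Z.X` as a
summand of the sum of all `F_χ Z`. -/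
lemma sum_ofInd_toInd (hG : SplitsOver k G) [Fintype (G →* kˣ)] (Z : EquivariantObject A) :
    ∑ χ : G →* kˣ, (ofInd ((twist A χ).obj Z)).f ≫ (toInd ((twist A χ).obj Z)).f =
      (Nat.card G : k) • 𝟙 (⨁ fun h => (A.fn h).obj Z.X) := by
  have hmat (p q : G) (χ : G →* kˣ) :
      biproduct.ι (fun h => (A.fn h).obj Z.X) p ≫
        (biproduct.desc (fun h => (((χ h⁻¹)⁻¹ : kˣ) : k) • (Z.α h).inv) ≫
          biproduct.lift (fun h => ((χ h⁻¹ : kˣ) : k) • (Z.α h).hom)) ≫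
            biproduct.π (fun h => (A.fn h).obj Z.X) q =
      ((χ (p * q⁻¹) : kˣ) : k) • ((Z.α p).inv ≫ (Z.α q).hom) := by
    rw [Category.assoc, biproduct.ι_desc_assoc, biproduct.lift_π, Linear.smul_comp,
      Linear.comp_smul, smul_smul, ← Units.val_mul]
    simp
  have h : ∑ χ : G →* kˣ, biproduct.desc (fun h => (((χ h⁻¹)⁻¹ : kˣ) : k) • (Z.α h).inv) ≫
      biproduct.lift (fun h => ((χ h⁻¹ : kˣ) : k) • (Z.α h).hom) =
      (Nat.card G : k) • 𝟙 (⨁ fun h => (A.fn h).obj Z.X) := by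
    apply biproduct.hom_ext'
    intro p
    apply biproduct.hom_ext
    intro q
    rw [Preadditive.comp_sum, Preadditive.sum_comp]
    simp only [Category.assoc] at hmat ⊢
    simp only [hmat, ← Finset.sum_smul]
    by_cases hpq : p = q
    · subst hpq
      rw [mul_inv_cancel, hG.sum_characters_one]
      simp
    · rw [hG.sum_characters_of_ne_one (fun e => hpq (mul_inv_eq_one.1 e))]
      simp [biproduct.ι_π_ne _ hpq]
  exact h

end EquivariantObject

end InductionFunctor

/-! ### Induction and restriction of stable tilting objects -/

section TiltingInduction

variable {k : Type w} [Field k] {G : Type*} [Group G] [Finite G] {T : Type u} [Category.{v} T]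
  [Preadditive T] [Linear k T] [HasZeroObject T] [HasShift T ℤ]
  [∀ n : ℤ, (shiftFunctor T n).Additive] [∀ n : ℤ, (shiftFunctor T n).Linear k]
  [Pretriangulated T] {A : TriangleAction k G T}

open EquivariantObject

lemma addClosure_ind_X {M : T} (hM : A.IsStable M) : addClosure M (ind A M).X :=
  addClosure_biproduct fun h => addClosure_of_retract (Retract.ofIso (hM h).some.symm)

lemma addClosure_of_ind_X (M : T) : addClosure (ind A M).X M :=
  addClosure_of_retract (retractInd A M)

lemma addClosure_of_ind (hG : SplitsOver k G) (N : EquivariantObject A) :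
    addClosure (ind A N.X) N :=
  addClosure_of_retract (retractOfInd hG.natCard_ne_zero N)

lemma addClosure_ind (hG : SplitsOver k G) {N : EquivariantObject A}
    (hN : (dualAction A).IsStable N) : addClosure N (ind A N.X) := by
  have := finite_characters (k := k) (G := G)
  have := Fintype.ofFinite (G →* kˣ)
  let e (χ : G →* kˣ) : N ≅ (twist A χ).obj N := (hN χ).some
  let a (χ : G →* kˣ) : ind A N.X ⟶ (twist A χ).obj N := ofInd ((twist A χ).obj N)
  let b (χ : G →* kˣ) : (twist A χ).obj N ⟶ ind A N.X := toInd ((twist A χ).obj N)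
  have hab : ∑ χ, a χ ≫ b χ = (Nat.card G : k) • 𝟙 (ind A N.X) := by
    apply EquivariantObject.hom_ext
    rw [sum_f]
    exact sum_ofInd_toInd hG N
  refine addClosure_of_sum (fun χ => (Nat.card G : k)⁻¹ • a χ ≫ (e χ).inv)
    (fun χ => (e χ).hom ≫ b χ) ?_
  simp only [Linear.smul_comp, Category.assoc, Iso.inv_hom_id_assoc]
  rw [← Finset.smul_sum, hab, inv_smul_smul₀ hG.natCard_ne_zero]

lemma isStable_ind (M : T) : (dualAction A).IsStable (ind A M) := fun χ => ⟨indTwistIso M χ⟩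

lemma isStable_X (N : EquivariantObject A) : A.IsStable N.X := fun g => ⟨N.α g⟩

/-- Vanishing: equivariant morphisms are morphisms of underlying objects, and `(Ind M).X` is in `add
M`. Generation: objects `X` with `Ind X` in a given thick subcategory form a thick subcategory of
`T`, and each equivariant `Z` is a retract of `Ind Z.X`. -/
lemma isTilting_ind (hG : SplitsOver k G) {M : T} (hM : IsTilting M) (hM' : A.IsStable M) :
    IsTilting (ind A M) where
  hom_shift i hi f := by
    have h : ∀ t : (ind A M).X ⟶ (ind A M).X⟦i⟧, t = 0 :=
      hom_shift_eq_zero_of_addClosure (hM.hom_shift i hi) (addClosure_ind_X hM')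
        (addClosure_ind_X hM')
    exact EquivariantObject.hom_ext (h f.f)
  generates Z P hP hM := by
    have hQ : IsThick (fun X => P (ind A X)) :=
      { shift := fun X n hX =>
          hP.retract _ _ ⟨Retract.ofIso (indShiftIso A X n)⟩ (hP.shift _ n hX)
        cone := fun Δ hΔ h₁ h₂ => hP.cone _ (indTriangle_exact A hΔ) h₁ h₂
        retract := fun X Y ⟨r⟩ hY => hP.retract _ _ ⟨r.map (indFunctor A)⟩ hY }
    exact hP.retract _ _ ⟨retractOfInd hG.natCard_ne_zero Z⟩ (IsTilting.generates ‹_› Z.X _ hQ hM)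

/-- Vanishing: a morphism `N.X ⟶ N.X⟦i⟧` is a sum of equivariant morphisms from `N` to `F_χ (N⟦i⟧)`,
an object isomorphic to `N⟦i⟧` by stability. Generation: dual to the case of `Ind`, as each `X` is a
retract of `(Ind X).X`. -/
lemma isTilting_X (hG : SplitsOver k G) {N : EquivariantObject A} (hN : IsTilting N)
    (hN' : (dualAction A).IsStable N) : IsTilting N.X where
  hom_shift i hi f := by
    have := Fintype.ofFinite G
    refine twist_induction (X := N) (Y := N⟦i⟧) (P := fun f => f = 0) hG ?_ ?_ f
    · rintro _ _ rfl rfl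
      exact add_zero _
    · intro χ a
      let e : N ≅ (twist A χ).obj N := (hN' χ).some
      have h : a ≫ ((twist A χ).commShiftIso i).hom.app N ≫ e.inv⟦i⟧' = 0 :=
        hN.hom_shift i hi _
      have h' : a = 0 := by
        rw [← cancel_mono (((twist A χ).commShiftIso i).hom.app N ≫ e.inv⟦i⟧'), h, zero_comp]
      rw [h', base_zero]
  generates X P hP hN₀ := by
    have hQ : IsThick (fun Z : EquivariantObject A => P Z.X) :=
      { shift := fun Z n hZ => hP.shift _ n hZ
        cone := fun Δ hΔ h₁ h₂ => hP.cone _ hΔ h₁ h₂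
        retract := fun Z W ⟨r⟩ hW => hP.retract _ _ ⟨r.map (forget A)⟩ hW }
    exact hP.retract _ _ ⟨retractInd A X⟩ (hN.generates (ind A X) _ hQ hN₀)

end TiltingInduction

lemma exists_quotient_equiv {α β : Type*} [Setoid α] [Setoid β] (R : α → β → Prop)
    (hα : ∀ a, ∃ b, R a b) (hβ : ∀ b, ∃ a, R a b)
    (hR : ∀ a a' b b', R a b → R a' b' → (a ≈ a' ↔ b ≈ b')) :
    ∃ e : _root_.Quotient ‹Setoid α› ≃ _root_.Quotient ‹Setoid β›,
      ∀ a b, R a b → e (Quotient.mk _ a) = Quotient.mk _ b := by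
  choose f hf using hα
  let φ : _root_.Quotient ‹Setoid α› → _root_.Quotient ‹Setoid β› :=
    Quotient.map f fun a a' h => (hR a a' _ _ (hf a) (hf a')).1 h
  have hφ (a b) (h : R a b) : φ (Quotient.mk _ a) = Quotient.mk _ b :=
    Quotient.sound ((hR a a _ _ (hf a) h).1 (Setoid.refl a))
  refine ⟨Equiv.ofBijective φ ⟨?_, ?_⟩, hφ⟩
  · rintro ⟨a⟩ ⟨a'⟩ h
    exact Quotient.sound ((hR a a' _ _ (hf a) (hf a')).2 (Quotient.exact h))
  · rintro ⟨b⟩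
    obtain ⟨a, ha⟩ := hβ b
    exact ⟨Quotient.mk _ a, hφ a b ha⟩

/-! ### The correspondence of stable tilting objects -/

section Main

variable {k : Type w} [Field k] {G : Type*} [Group G] [Finite G] {T : Type u} [Category.{v} T]
  [Preadditive T] [Linear k T] [HasZeroObject T] [HasShift T ℤ]
  [∀ n : ℤ, (shiftFunctor T n).Additive] [∀ n : ℤ, (shiftFunctor T n).Linear k]
  [Pretriangulated T] [IsIdempotentComplete T] {A : TriangleAction k G T}

open EquivariantObject

/-- A stable tilting object corresponds to a stable tilting equivariant object if the underlying
object of the latter has the same additive closure. -/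
def Corresponds (M : StableTilting A) (N : StableTilting (dualAction A)) : Prop :=
  addClosure M.1 N.1.X ∧ addClosure N.1.X M.1

/-- Apply `Ind` to the equality of additive closures of `M` and `N.X`, and use that `Ind N.X` and
the stable object `N` have the same additive closure. -/
lemma Corresponds.addClosure_eq_ind (hG : SplitsOver k G) {M : StableTilting A}
    {N : StableTilting (dualAction A)} (h : Corresponds M N) :
    addClosure (ind A M.1) N.1 ∧ addClosure N.1 (ind A M.1) :=
  ⟨addClosure_trans (addClosure_of_ind hG N.1) (addClosure_map (indFunctor A) h.1),
    addClosure_trans (addClosure_map (indFunctor A) h.2) (addClosure_ind hG N.2.2.2)⟩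

lemma exists_corresponds (hG : SplitsOver k G)
    (hT : ∀ X Y : T, FiniteDimensional k (X ⟶ Y)) (M : StableTilting A) :
    ∃ N : StableTilting (dualAction A), Corresponds M N := by
  obtain ⟨N, h, h'⟩ := exists_stableTilting (A := dualAction A)
    (EquivariantObject.finiteDimensional_hom hT) (thickClosedUnderSums_equivariant A)
    (isTilting_ind hG M.2.1 M.2.2.2) (isStable_ind M.1)
  exact ⟨N, addClosure_trans (addClosure_map (forget A) h) (addClosure_ind_X M.2.2.2),
    addClosure_trans (addClosure_of_ind_X M.1) (addClosure_map (forget A) h')⟩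

lemma exists_corresponds' (hG : SplitsOver k G)
    (hT : ∀ X Y : T, FiniteDimensional k (X ⟶ Y)) (N : StableTilting (dualAction A)) :
    ∃ M : StableTilting A, Corresponds M N := by
  obtain ⟨M, h, h'⟩ := exists_stableTilting (A := A) hT thickClosedUnderSums
    (isTilting_X hG N.2.1 N.2.2.2) (isStable_X N.1)
  exact ⟨M, h', h⟩

/-- Either side determines the additive closure of the other, by `Ind` or by the forgetful functor,
and basic objects are determined by their additive closures. -/
lemma Corresponds.equiv_iff (hG : SplitsOver k G)
    (hT : ∀ X Y : T, FiniteDimensional k (X ⟶ Y)) {M M' : StableTilting A}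
    {N N' : StableTilting (dualAction A)} (h : Corresponds M N) (h' : Corresponds M' N') :
    M ≈ M' ↔ N ≈ N' := by
  constructor
  · rintro ⟨e⟩
    obtain ⟨h1, h2⟩ := h.addClosure_eq_ind hG
    obtain ⟨h1', h2'⟩ := h'.addClosure_eq_ind hG
    have e' : ind A M.1 ≅ ind A M'.1 := (indFunctor A).mapIso e
    exact N.2.2.1.iso_of_addClosure (EquivariantObject.finiteDimensional_hom hT) N'.2.2.1
      (addClosure_trans (addClosure_trans h1' (addClosure_of_retract (Retract.ofIso e'.symm))) h2)
      (addClosure_trans (addClosure_trans h1 (addClosure_of_retract (Retract.ofIso e'))) h2')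
  · rintro ⟨e⟩
    have e' : N.1.X ≅ N'.1.X := (forget A).mapIso e
    exact M.2.2.1.iso_of_addClosure hT M'.2.2.1
      (addClosure_trans (addClosure_trans h'.2 (addClosure_of_retract (Retract.ofIso e'.symm))) h.1)
      (addClosure_trans (addClosure_trans h.2 (addClosure_of_retract (Retract.ofIso e'))) h'.1)

end Main

end

end EquivariantTilting

theorem theorem7p5 {k : Type*} [Field k] {G : Type*} [CommGroup G] [Finite G] (hG : SplitsOver k G)
    {T : Type*} [Category T] [Preadditive T] [Linear k T] [HasZeroObject T] [HasShift T ℤ]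
    [∀ n : ℤ, (shiftFunctor T n).Additive] [∀ n : ℤ, (shiftFunctor T n).Linear k]
    [Pretriangulated T] [IsIdempotentComplete T]
    (hT : ∀ X Y : T, FiniteDimensional k (X ⟶ Y)) (A : TriangleAction k G T) :
    (∀ a : TriangleAut A, IsUnit a) ∧ (∀ b : TriangleAut (dualAction A), IsUnit b) ∧
    Function.Bijective (TriangleAut.equivariantization A) ∧
    ∃ ι : TiltSet A ≃ TiltSet (dualAction A),
      (∀ (M : StableTilting A) (N : StableTilting (dualAction A)),
        ι (Quotient.mk _ M) = Quotient.mk _ N →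
          addClosure N.1 = addClosure (EquivariantObject.ind A M.1)) ∧
      (∀ (a : TriangleAut A) (t : TiltSet A), ι (a • t) = TriangleAut.equivariantization A a • ι t) ∧
      ∃ κ : TiltOrbits A ≃ TiltOrbits (dualAction A),
        ∀ t : TiltSet A, κ (Quot.mk _ t) = Quot.mk _ (ι t) := by
  have hbij := TriangleAut.equivariantization_bijective A hG
  obtain ⟨ι, hι⟩ : ∃ ι : TiltSet A ≃ TiltSet (dualAction A), ∀ M N, Corresponds M N →
      ι (Quotient.mk _ M) = Quotient.mk _ N := exists_quotient_equiv (α := StableTilting A)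
    (β := StableTilting (dualAction A)) Corresponds (exists_corresponds hG hT)
    (exists_corresponds' hG hT) fun _ _ _ _ h h' => h.equiv_iff hG hT h'
  have hact : ∀ (a : TriangleAut A) (t : TiltSet A),
      ι (a • t) = TriangleAut.equivariantization A a • ι t := by
    rintro ⟨E⟩ ⟨M⟩
    obtain ⟨N, hN⟩ := exists_corresponds hG hT M
    have h1 : ι (Quotient.mk _ M) = Quotient.mk _ N := hι M N hN
    let E' : EquivariantAutoequivalence (dualAction A) :=
      { toEquivariantEndofunctor := E.toEquivariantEndofunctor.equivariantization
        isEquivalence := (inferInstance :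
          (equivariantFunctor E.toEquivariantEndofunctor).IsEquivalence) }
    have h2 : ι (Quotient.mk _ ⟨E.toFunctor.obj M.1, isTilting_obj E M.2.1,
        isBasic_obj E M.2.2.1, isStable_obj E M.2.2.2⟩) =
        Quotient.mk _ ⟨E'.toFunctor.obj N.1, isTilting_obj E' N.2.1,
          isBasic_obj E' N.2.2.1, isStable_obj E' N.2.2.2⟩ :=
      -- The underlying object of `E^G N` is `E N.X`, so applying `E` to both closures shows that `E
      -- M` corresponds to `E^G N`.
      hι _ _ ⟨addClosure_map E.toFunctor hN.1, addClosure_map E.toFunctor hN.2⟩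
    exact h2.trans (congrArg (fun t : TiltSet (dualAction A) =>
      TriangleAut.equivariantization A (Quotient.mk _ E) • t) h1.symm)
  refine ⟨TriangleAut.isUnit, TriangleAut.isUnit_dualAction A hG, hbij, ι, fun M N h => ?_, hact, ?_⟩
  · obtain ⟨N', hN'⟩ := exists_corresponds hG hT M
    -- Any representative of `ι M` is isomorphic to the chosen partner of `M`, whose additive
    -- closure is known.
    obtain ⟨e⟩ : N ≈ N' := Quotient.exact (h.symm.trans (hι M N' hN'))
    obtain ⟨h1, h2⟩ := hN'.addClosure_eq_ind hG
    have e' : Retract N.1 N'.1 := Retract.ofIso e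
    have e'' : Retract N'.1 N.1 := Retract.ofIso e.symm
    exact addClosure_eq (addClosure_trans (addClosure_of_retract e') h1)
      (addClosure_trans h2 (addClosure_of_retract e''))
  · refine ⟨Quot.congr ι fun t t' => ⟨?_, ?_⟩, fun t => rfl⟩
    · rintro ⟨a, rfl⟩
      exact ⟨_, (hact a t).symm⟩
    -- Surjectivity of equivariantization enters here: an automorphism relating two points upstairs
    -- comes from one of `T`.
    · rintro ⟨b, hb⟩
      obtain ⟨a, rfl⟩ := hbij.2 b
      exact ⟨a, ι.injective (by rw [hact, hb])⟩
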